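/- Let $M$ be a smooth (Hausdorff) manifold of dimension $m+1$ with a smooth, symmetric, nonnegative (possibly degenerate) inner product $\langle\cdot,\cdot\rangle^*$ on $T^*M$ and a nowhere vanishing smooth $(m+1)$-form $dv_M$ (a subriemannian manifold with a background volume form), and let $p_0\in M$. Write $|\omega|_*=(\langle\omega,\omega\rangle^*)^{1/2}$, define $G:T^*M\to TM$ by $\omega(G(\eta))=\langle\omega,\eta\rangle^*$, put $\xi=\mathrm{Range}(G)$, and assume that $\dim\xi=m+1-l$ is constant near $p_0$. For a 1-form $\omega$ let $\omega\lrcorner dv_M$ be the $m$-form with $\eta\wedge(\omega\lrcorner dv_M)=\langle\eta,\omega\rangle^*dv_M$ for all 1-forms $\eta$. For $p\ge 0$ and a smooth function $\phi$ define $H_{\phi,p}$, wherever $|d\phi|_*\neq0$, by $$d\Big(\frac{d\phi}{|d\phi|_*^{1-p}}\lrcorner dv_M\Big)=H_{\phi,p}\,dv_M .$$ Suppose that $M$ has isometric translations near $p_0$: there are an open neighborhood $U$ of $p_0$, $\delta>0$ and a smooth one-parameter family of local diffeomorphisms $\Psi_a:U\to M$, $a\in(-\delta,\delta)$, with $\Psi_0=\mathrm{Id}$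 and $\Psi_{a+b}=\Psi_a\circ\Psi_b$ wherever defined, which on $U$ preserve $\langle\cdot,\cdot\rangle^*$ and $dv_M$. Let $\Sigma\ni p_0$ be a smooth hypersurface to which $\{\Psi_a\}$ is transversal in $U$, that is, $\frac{d}{da}\Psi_a(x)|_{a=0}\notin T_x\Sigma$ for $x\in\Sigma\cap U$. Let $x^1,\dots,x^{m+1}$ be translation-isometric coordinates on an open neighborhood $V\subset U$ of $p_0$: smooth coordinates in which $p_0$ is the origin and $\Sigma\cap V=\{x^{m+1}=0\}$, such that for all $q\in V$ and $a\in(-\delta,\delta)$ with $\Psi_a(q)\in V$ one has $x^j(\Psi_a(q))=x^j(q)$ for $1\le j\le m$, $x^{m+1}(\Psi_a(q))=x^{m+1}(q)+a$, and $A(\Psi_a(q))=A(q)$, where $dv_M=A\,dx^1\wedge\dots\wedge dx^{m+1}$. Let $u,v:\Sigma\cap V\to\mathbb R$ be smooth functions of $(x^1,\dots,x^m)$ whose graphs $\{x^{m+1}=u(x^1,\dots,x^m)\}$ and $\{x^{m+1}=v(x^1,\dots,x^m)\}$ over $\Sigma\cap V$ lie in $V$ and satisfy $|d(u-x^{m+1})|_*\ne0$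 and $|d(v-x^{m+1})|_*\neq 0$ along the respective graph. For $w\in\{u,v\}$ let $H_p(w)(x^1,\dots,x^m)$ be the value of $H_{\phi,p}$ with $\phi=w-x^{m+1}$ at the point $(x^1,\dots,x^m,w(x^1,\dots,x^m))$. Assume (1) $v\ge u$ on $\Sigma\cap V$ and $v(0)=u(0)=0$; (2) for some $p\ge0$, $H_p(v)\le H_p(u)$ on $\Sigma\cap V$; (3) (rank condition) there is a neighborhood $O$ of $p_0$ such that for any smooth sections $X_1,\dots,X_{m-l}$ of $\xi$ over an open set $W\subset O$ that are linearly independent at every point of $W$, the vectors $Z(x)$, $Z\in\pounds(X_1,\dots,X_{m-l})$, span a space of dimension at least $m$ at every $x\in W$; here $\pounds(X_1,\dots,X_{m-l})$ is the smallest $C^\infty(W)$-module of vector fields that contains $X_1,\dots,X_{m-l}$ and is closed under the Lie bracket. Then $v\equiv u$ in a neighborhood of $p_0$ in $\Sigma$. -/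

import Mathlib

open scoped Manifold ContDiff Topology

noncomputable section

namespace SubRiem

/-- The model space `ℝⁿ`. -/
abbrev Coord (n : ℕ) : Type := EuclideanSpace ℝ (Fin n)

section Pointwise

variable {m : ℕ} {M : Type*} [TopologicalSpace M] [ChartedSpace (Coord (m + 1)) M]

/-- The tangent space of the `(m+1)`-dimensional manifold `M` at `x`. -/
abbrev Tan (m : ℕ) {M : Type*} [TopologicalSpace M] [ChartedSpace (Coord (m + 1)) M] (x : M) :
    Type :=
  TangentSpace (𝓡 (m + 1)) x

/-- The cotangent space of `M` at `x`. -/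
abbrev Cotan (m : ℕ) {M : Type*} [TopologicalSpace M] [ChartedSpace (Coord (m + 1)) M] (x : M) :
    Type :=
  Tan m x →L[ℝ] ℝ

/-- Alternating `n`-covectors of `M` at `x`. -/
abbrev Alt (m n : ℕ) {M : Type*} [TopologicalSpace M] [ChartedSpace (Coord (m + 1)) M] (x : M) :
    Type :=
  Tan m x [⋀^Fin n]→L[ℝ] ℝ

/-- The differential of a real function, as a covector. -/
def dAt (m : ℕ) {M : Type*} [TopologicalSpace M] [ChartedSpace (Coord (m + 1)) M]
    (f : M → ℝ) (x : M) : Cotan m x :=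
  mfderiv (𝓡 (m + 1)) 𝓘(ℝ, ℝ) f x

/-- Smoothness of a real function on a set. -/
def SmoothFnOn (m : ℕ) {M : Type*} [TopologicalSpace M] [ChartedSpace (Coord (m + 1)) M]
    (f : M → ℝ) (W : Set M) : Prop :=
  ContMDiffOn (𝓡 (m + 1)) 𝓘(ℝ, ℝ) ∞ f W

/-- Smoothness of a vector field on a set. -/
def SmoothFieldOn [IsManifold (𝓡 (m + 1)) ∞ M] (X : ∀ x : M, Tan m x) (W : Set M) : Prop :=
  ContMDiffOn (𝓡 (m + 1)) (𝓡 (m + 1)).tangent ∞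
    (fun x => (⟨x, X x⟩ : TangentBundle (𝓡 (m + 1)) M)) W

/-- The basis vectors of the tangent space coming from its identification with `ℝ^{m+1}`. -/
def stdVec (x : M) (i : Fin (m + 1)) : Tan m x :=
  (EuclideanSpace.single i (1 : ℝ) : Coord (m + 1))

/-- The dual basis of `stdVec`. -/
def stdCovec (x : M) (i : Fin (m + 1)) : Cotan m x :=
  (EuclideanSpace.proj i : Coord (m + 1) →L[ℝ] ℝ)

end Pointwise

/-- A subriemannian structure: a smooth, symmetric, nonnegative (possibly degenerate) inner product
`⟨·,·⟩*` on the cotangent bundle. Smoothness is expressed by saying that `⟨df, dh⟩*` is smooth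
for all smooth local functions `f`, `h`; for coordinate functions these are the
coefficients `g^{ij}`. -/
structure CoMetric (m : ℕ) (M : Type*) [TopologicalSpace M] [ChartedSpace (Coord (m + 1)) M] where
  form : ∀ x : M, Cotan m x →ₗ[ℝ] Cotan m x →ₗ[ℝ] ℝ
  symm : ∀ (x : M) (θ η : Cotan m x), form x θ η = form x η θ
  nonneg : ∀ (x : M) (θ : Cotan m x), 0 ≤ form x θ θ
  smooth : ∀ (W : Set M), IsOpen W → ∀ f h : M → ℝ, SmoothFnOn m f W → SmoothFnOn m h W →
    SmoothFnOn m (fun x => form x (dAt m f x) (dAt m h x)) W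

/-- A background volume form: a smooth nowhere vanishing `(m+1)`-form. -/
structure VolumeForm (m : ℕ) (M : Type*) [TopologicalSpace M] [ChartedSpace (Coord (m + 1)) M]
    [IsManifold (𝓡 (m + 1)) ∞ M] where
  form : ∀ x : M, Alt m (m + 1) x
  ne_zero : ∀ x : M, form x ≠ 0
  smooth : ∀ (W : Set M), IsOpen W → ∀ X : Fin (m + 1) → ∀ x : M, Tan m x,
    (∀ i, SmoothFieldOn (X i) W) → SmoothFnOn m (fun x => form x (fun i => X i x)) W

section Curvature

variable {m : ℕ} {M : Type*} [TopologicalSpace M] [ChartedSpace (Coord (m + 1)) M]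

/-- The norm `|θ|_* = (⟨θ, θ⟩*)^{1/2}`. -/
def CoMetric.norm (g : CoMetric m M) (x : M) (θ : Cotan m x) : ℝ :=
  Real.sqrt (g.form x θ θ)

/-- The map `G : T*M → TM` with `θ (G η) = ⟨θ, η⟩*` (see `CoMetric.apply_sharp`). -/
def CoMetric.sharp (g : CoMetric m M) (x : M) : Cotan m x →ₗ[ℝ] Tan m x :=
  ∑ i : Fin (m + 1), (g.form x (stdCovec x i)).smulRight (stdVec x i)

theorem covec_eq_sum (x : M) (θ : Cotan m x) :
    θ = ∑ i : Fin (m + 1), θ (stdVec x i) • stdCovec x i := by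
  have key : ∀ (L : Coord (m + 1) →L[ℝ] ℝ), L = ∑ i : Fin (m + 1),
      L (EuclideanSpace.single i (1 : ℝ)) •
        (EuclideanSpace.proj i : Coord (m + 1) →L[ℝ] ℝ) := by
    intro L
    ext v
    have hv : v = ∑ i : Fin (m + 1), v i • EuclideanSpace.single i (1 : ℝ) := by
      ext j
      simp [Pi.single_apply]
    conv_lhs => rw [hv]
    simp [mul_comm]
  exact key θ

/-- The defining property of `G`. -/
theorem CoMetric.apply_sharp (g : CoMetric m M) (x : M) (θ η : Cotan m x) :
    θ (g.sharp x η) = g.form x θ η := by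
  conv_rhs => rw [covec_eq_sum x θ]
  simp [CoMetric.sharp, mul_comm]

/-- The horizontal space `ξ_x = Range G_x`. -/
def CoMetric.horizontal (g : CoMetric m M) (x : M) : Submodule ℝ (Tan m x) :=
  LinearMap.range (g.sharp x)

/-- Contraction of an alternating covector with a vector in the first slot. -/
def contract {n : ℕ} (x : M) (α : Alt m (n + 1) x) (w : Tan m x) : Alt m n x :=
  ContinuousAlternatingMap.curryLeft (E := Coord (m + 1)) (F := ℝ) α w

/-- The interior product `θ ⌟ dv` of a covector with the volume form, that is, the `m`-covector
with `η ∧ (θ ⌟ dv) = ⟨η, θ⟩* dv` for all covectors `η` (see `wedge_interiorProd`). -/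
def interiorProd [IsManifold (𝓡 (m + 1)) ∞ M] (g : CoMetric m M) (dv : VolumeForm m M)
    (x : M) (θ : Cotan m x) : Alt m m x :=
  contract x (dv.form x) (g.sharp x θ)

theorem wedge_contract_aux (n : ℕ) (η : Coord (n+1) →L[ℝ] ℝ)
   (α : Coord (n+1) [⋀^Fin (n+1)]→L[ℝ] ℝ)
   (w : Coord (n+1)) (z : Fin (n+1) → Coord (n+1)) :
   ∑ i : Fin (n+1), (-1 : ℝ) ^ (i : ℕ) * (η (z i) * α (Fin.cons w (i.removeNth z))) = η w * α z := by
  have key : ContinuousAlternatingMap.alternatizeUncurryFin (η.smulRight α) = 0 := by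
    ext y
    have := AlternatingMap.map_linearDependent (K := ℝ)
      (ContinuousAlternatingMap.alternatizeUncurryFin (η.smulRight α)).toAlternatingMap y
      (fun h => by have := h.fintype_card_le_finrank; simp at this)
    simpa using this
  have h := congrArg (fun f => f (Fin.cons w z : Fin (n+2) → Coord (n+1))) key
  simp only [ContinuousAlternatingMap.alternatizeUncurryFin_apply] at h
  rw [Fin.sum_univ_succ] at h
  have e : ∀ i : Fin (n+1), i.succ.removeNth (Fin.cons w z : Fin (n+2) → Coord (n+1)) =
      Fin.cons w (i.removeNth z) := by
    intro i
    ext1 j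
    refine Fin.cases ?_ (fun j => ?_) j <;> simp [Fin.removeNth, Fin.succ_succAbove_succ]
  simp only [e] at h
  have e0 : (0 : Fin (n+2)).removeNth (Fin.cons w z : Fin (n+2) → Coord (n+1)) = z := by
    ext1 j; simp [Fin.removeNth]
  simp [e0, pow_succ] at h
  linarith

/-- The defining property `η ∧ (θ ⌟ dv) = ⟨η, θ⟩* dv` of the interior product, with the wedge product
of a covector and an `m`-covector written out. -/
theorem wedge_interiorProd [IsManifold (𝓡 (m + 1)) ∞ M] (g : CoMetric m M) (dv : VolumeForm m M)
    (x : M) (η θ : Cotan m x) (z : Fin (m + 1) → Tan m x) :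
    ∑ i : Fin (m + 1), (-1 : ℝ) ^ (i : ℕ) * (η (z i) * interiorProd g dv x θ (i.removeNth z)) =
      g.form x η θ * dv.form x z := by
  rw [← g.apply_sharp]
  exact wedge_contract_aux m η (dv.form x) (g.sharp x θ) z

/-- The pull-back of a form on `M` under the inverse of the chart at `x`, a form on (an open subset
of) `ℝ^{m+1}`. -/
def chartForm {n : ℕ} (α : ∀ y : M, Alt m n y) (x : M) (z : Coord (m + 1)) :
    Coord (m + 1) [⋀^Fin n]→L[ℝ] ℝ :=
  (α ((extChartAt (𝓡 (m + 1)) x).symm z)).compContinuousLinearMap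
    (mfderiv 𝓘(ℝ, Coord (m + 1)) (𝓡 (m + 1)) (extChartAt (𝓡 (m + 1)) x).symm z)

/-- The exterior derivative of a form on `M`, computed at `x` in the chart at `x`. -/
def extDerivM {n : ℕ} (α : ∀ y : M, Alt m n y) (x : M) : Alt m (n + 1) x :=
  ContinuousAlternatingMap.compContinuousLinearMap
    (extDeriv (chartForm α x) (extChartAt (𝓡 (m + 1)) x x))
    (mfderiv (𝓡 (m + 1)) 𝓘(ℝ, Coord (m + 1)) (extChartAt (𝓡 (m + 1)) x) x)

/-- The area form `|dφ|_*^{-(1-p)} dφ ⌟ dv` of the level sets of `φ`. -/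
def areaForm [IsManifold (𝓡 (m + 1)) ∞ M] (g : CoMetric m M) (dv : VolumeForm m M)
    (φ : M → ℝ) (p : ℝ) (x : M) : Alt m m x :=
  interiorProd g dv x ((g.norm x (dAt m φ x) ^ (1 - p))⁻¹ • dAt m φ x)

/-- The function `H_{φ,p}` with `d (|dφ|_*^{-(1-p)} dφ ⌟ dv) = H_{φ,p} dv`. Both sides are top
degree forms, so `H_{φ,p}` is the quotient of their values on any basis. -/
def meanCurv [IsManifold (𝓡 (m + 1)) ∞ M] (g : CoMetric m M) (dv : VolumeForm m M)
    (φ : M → ℝ) (p : ℝ) (x : M) : ℝ :=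
  extDerivM (areaForm g dv φ p) x (stdVec x) / dv.form x (stdVec x)

end Curvature

section Translations

variable {m : ℕ} {M : Type*} [TopologicalSpace M] [ChartedSpace (Coord (m + 1)) M]

/-- The differential of a map `M → M`. -/
def tanMap (m : ℕ) {M : Type*} [TopologicalSpace M] [ChartedSpace (Coord (m + 1)) M]
    (F : M → M) (x : M) : Tan m x →L[ℝ] Tan m (F x) :=
  mfderiv (𝓡 (m + 1)) (𝓡 (m + 1)) F x

/-- `Ψ_a`, `|a| < δ`, are isometric translations on the neighbourhood `U` of `p₀`: a smooth
one-parameter family of local diffeomorphisms of `U` into `M` with the (local) group law, which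
preserves the inner product on covectors and the volume form. -/
structure IsIsometricTranslations [IsManifold (𝓡 (m + 1)) ∞ M] (g : CoMetric m M) (dv : VolumeForm m M)
    (p₀ : M) (U : Set M) (δ : ℝ) (Ψ : ℝ → M → M) : Prop where
  isOpen : IsOpen U
  mem : p₀ ∈ U
  pos : 0 < δ
  smooth : ContMDiffOn (𝓘(ℝ, ℝ).prod (𝓡 (m + 1))) (𝓡 (m + 1)) ∞
    (fun z : ℝ × M => Ψ z.1 z.2) (Set.Ioo (-δ) δ ×ˢ U)
  localDiffeo : ∀ a ∈ Set.Ioo (-δ) δ,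
    IsLocalDiffeomorphOn (𝓡 (m + 1)) (𝓡 (m + 1)) ∞ (Ψ a) U
  zero : ∀ x ∈ U, Ψ 0 x = x
  add : ∀ a ∈ Set.Ioo (-δ) δ, ∀ b ∈ Set.Ioo (-δ) δ, a + b ∈ Set.Ioo (-δ) δ →
    ∀ x ∈ U, Ψ b x ∈ U → Ψ (a + b) x = Ψ a (Ψ b x)
  isometry : ∀ a ∈ Set.Ioo (-δ) δ, ∀ x ∈ U, Ψ a x ∈ U → ∀ θ η : Cotan m (Ψ a x),
    g.form x (θ.comp (tanMap m (Ψ a) x)) (η.comp (tanMap m (Ψ a) x)) = g.form (Ψ a x) θ η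
  volume : ∀ a ∈ Set.Ioo (-δ) δ, ∀ x ∈ U, Ψ a x ∈ U →
    (dv.form (Ψ a x)).compContinuousLinearMap (tanMap m (Ψ a) x) = dv.form x

/-- `φ` is a defining function of `S` on the open set `W`. -/
def IsDefiningFn (m : ℕ) {M : Type*} [TopologicalSpace M] [ChartedSpace (Coord (m + 1)) M]
    (S W : Set M) (φ : M → ℝ) : Prop :=
  IsOpen W ∧ SmoothFnOn m φ W ∧ ∀ x ∈ W, dAt m φ x ≠ 0 ∧ (x ∈ S ↔ φ x = 0)

/-- A smooth (embedded) hypersurface. -/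
def IsHypersurface (m : ℕ) {M : Type*} [TopologicalSpace M] [ChartedSpace (Coord (m + 1)) M]
    (S : Set M) : Prop :=
  ∀ x ∈ S, ∃ (W : Set M) (φ : M → ℝ), x ∈ W ∧ IsDefiningFn m S W φ

/-- The tangent space `T_x S` of a hypersurface: the kernel of `dφ_x`, where `φ` is a local defining
function near `x` (the kernel is the same for all of them). -/
def hypersurfaceTangent (S : Set M) (x : M) : Set (Tan m x) :=
  {w | ∀ (W : Set M) (φ : M → ℝ), x ∈ W → IsDefiningFn m S W φ → dAt m φ x w = 0}

/-- The initial velocity of `a ↦ Ψ_a x`. -/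
def velocity (m : ℕ) {M : Type*} [TopologicalSpace M] [ChartedSpace (Coord (m + 1)) M]
    (Ψ : ℝ → M → M) (x : M) : Tan m (Ψ 0 x) :=
  mfderiv 𝓘(ℝ, ℝ) (𝓡 (m + 1)) (fun a : ℝ => Ψ a x) 0 (1 : ℝ)

/-- `Ψ` is transversal to `S` in `U` (on `U` one has `Ψ 0 x = x`). -/
def IsTransversal (m : ℕ) {M : Type*} [TopologicalSpace M] [ChartedSpace (Coord (m + 1)) M]
    (Ψ : ℝ → M → M) (S U : Set M) : Prop :=
  ∀ x ∈ S ∩ U, velocity m Ψ x ∉ hypersurfaceTangent S (Ψ 0 x)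

/-- The density `A(q)` in `dv = A dx¹ ∧ … ∧ dx^{m+1}` for the coordinates `e`. -/
def density [IsManifold (𝓡 (m + 1)) ∞ M] (dv : VolumeForm m M)
    (e : OpenPartialHomeomorph M (Coord (m + 1))) (q : M) : ℝ :=
  dv.form (e.symm (e q)) (fun i =>
    mfderiv 𝓘(ℝ, Coord (m + 1)) (𝓡 (m + 1)) e.symm (e q)
      (EuclideanSpace.single i (1 : ℝ) : Coord (m + 1)))

/-- `e = (x¹, …, x^{m+1})` is a system of translation-isometric coordinates on the neighbourhood
`V = e.source` of `p₀`, for translations `Ψ_a`, `|a| < δ`, on `U` and the hypersurface `S`. -/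
structure IsTranslationIsometricCoords [IsManifold (𝓡 (m + 1)) ∞ M] (dv : VolumeForm m M)
    (p₀ : M) (U : Set M) (δ : ℝ) (Ψ : ℝ → M → M) (S : Set M) (e : OpenPartialHomeomorph M (Coord (m + 1))) : Prop where
  mem_atlas : e ∈ IsManifold.maximalAtlas (𝓡 (m + 1)) ∞ M
  mem : p₀ ∈ e.source
  subset : e.source ⊆ U
  surface : ∀ q ∈ e.source, (q ∈ S ↔ e q (Fin.last m) = 0)
  origin : e p₀ = 0
  coord_castSucc : ∀ q ∈ e.source, ∀ a ∈ Set.Ioo (-δ) δ, Ψ a q ∈ e.source →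
    ∀ j : Fin m, e (Ψ a q) j.castSucc = e q j.castSucc
  coord_last : ∀ q ∈ e.source, ∀ a ∈ Set.Ioo (-δ) δ, Ψ a q ∈ e.source →
    e (Ψ a q) (Fin.last m) = e q (Fin.last m) + a
  density_eq : ∀ q ∈ e.source, ∀ a ∈ Set.Ioo (-δ) δ, Ψ a q ∈ e.source →
    density dv e (Ψ a q) = density dv e q

/-- The point `(x¹, …, x^m, t)` of `ℝ^{m+1}`. -/
def append {m : ℕ} (x : Coord m) (t : ℝ) : Coord (m + 1) :=
  WithLp.toLp 2 (Fin.snoc (α := fun _ => ℝ) x.ofLp t)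

/-- The projection `(x¹, …, x^{m+1}) ↦ (x¹, …, x^m)`. -/
def proj {m : ℕ} (z : Coord (m + 1)) : Coord m :=
  WithLp.toLp 2 (fun j : Fin m => z j.castSucc)

/-- The part `{x^{m+1} = 0}` of the coordinate domain, i.e. `S ∩ V` in the coordinates
`x¹, …, x^m`. -/
def baseDomain (e : OpenPartialHomeomorph M (Coord (m + 1))) : Set (Coord m) :=
  {x | append x 0 ∈ e.target}

/-- The point of `M` with coordinates `(x, u x)`. -/
def graphPoint (e : OpenPartialHomeomorph M (Coord (m + 1))) (u : Coord m → ℝ) (x : Coord m) : M :=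
  e.symm (append x (u x))

/-- The defining function `u(x¹, …, x^m) - x^{m+1}` of the graph of `u`. -/
def graphFn (e : OpenPartialHomeomorph M (Coord (m + 1))) (u : Coord m → ℝ) (q : M) : ℝ :=
  u (proj (e q)) - e q (Fin.last m)

/-- `u : S ∩ V → ℝ` is smooth and its graph lies in `V`. -/
def IsGraph (e : OpenPartialHomeomorph M (Coord (m + 1))) (u : Coord m → ℝ) : Prop :=
  ContDiffOn ℝ ∞ u (baseDomain e) ∧ ∀ x ∈ baseDomain e, append x (u x) ∈ e.target

/-- The graph of `u` has no singular points: `|d(u - x^{m+1})|_* ≠ 0` along the graph. -/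
def IsNonsingularGraph (g : CoMetric m M) (e : OpenPartialHomeomorph M (Coord (m + 1)))
    (u : Coord m → ℝ) : Prop :=
  ∀ x ∈ baseDomain e, g.norm (graphPoint e u x) (dAt m (graphFn e u) (graphPoint e u x)) ≠ 0

/-- `H_p(u)(x) = H_{φ,p}(x, u x)` with `φ = u - x^{m+1}`. -/
def graphCurv [IsManifold (𝓡 (m + 1)) ∞ M] (g : CoMetric m M) (dv : VolumeForm m M)
    (e : OpenPartialHomeomorph M (Coord (m + 1))) (p : ℝ) (u : Coord m → ℝ) (x : Coord m) : ℝ :=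
  meanCurv g dv (graphFn e u) p (graphPoint e u x)

end Translations

section Rank

variable {m : ℕ} {M : Type*} [TopologicalSpace M] [ChartedSpace (Coord (m + 1)) M]

/-- Membership in `£(X₁, …, X_k)` over the open set `W`: the smallest `C^∞(W)`-module of vector
fields that contains `X₁, …, X_k` and is closed under the Lie bracket. (Only the values on `W`
matter.) -/
inductive LieSpan (W : Set M) {k : ℕ} (X : Fin k → ∀ x : M, Tan m x) :
    (∀ x : M, Tan m x) → Prop
  | gen (i : Fin k) : LieSpan W X (X i)
  | zero : LieSpan W X (fun _ => 0)
  | add (Y Z : ∀ x : M, Tan m x) : LieSpan W X Y → LieSpan W X Z →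
      LieSpan W X (fun x => Y x + Z x)
  | smul (f : M → ℝ) (Z : ∀ x : M, Tan m x) : SmoothFnOn m f W → LieSpan W X Z →
      LieSpan W X (fun x => f x • Z x)
  | bracket (Y Z : ∀ x : M, Tan m x) : LieSpan W X Y → LieSpan W X Z →
      LieSpan W X (VectorField.mlieBracket (𝓡 (m + 1)) Y Z)

/-- The rank of `£(X₁, …, X_k)` at `x`. -/
def lieRank (W : Set M) {k : ℕ} (X : Fin k → ∀ x : M, Tan m x) (x : M) : ℕ :=
  Module.finrank ℝ (Submodule.span ℝ {w : Tan m x | ∃ Z, LieSpan W X Z ∧ Z x = w})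

/-- The degree of degeneracy is constant, equal to `l`, near `p₀`: `dim ξ = m + 1 - l`. -/
def HasDegeneracy (g : CoMetric m M) (p₀ : M) (l : ℕ) : Prop :=
  ∀ᶠ x in 𝓝 p₀, Module.finrank ℝ (g.horizontal x) + l = m + 1

/-- The rank condition near `p₀`: any `m - l` smooth local sections of `ξ` that are independent
wherever defined generate, under the Lie bracket, a space of dimension at least `m` at each point. -/
def RankCondition [IsManifold (𝓡 (m + 1)) ∞ M] (g : CoMetric m M) (p₀ : M) (l : ℕ) : Prop :=
  ∃ O : Set M, IsOpen O ∧ p₀ ∈ O ∧ ∀ W ⊆ O, IsOpen W →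
    ∀ X : Fin (m - l) → ∀ x : M, Tan m x,
      (∀ i, SmoothFieldOn (X i) W) → (∀ i, ∀ x ∈ W, X i x ∈ g.horizontal x) →
      (∀ x ∈ W, LinearIndependent ℝ (fun i => X i x)) →
      ∀ x ∈ W, m ≤ lieRank W X x

end Rank

end SubRiem

end

/-!
In translation-isometric coordinates neither the metric nor the density depends on the last
coordinate, so the curvatures of the two graphs, known only along the graphs, are the values of the
operators `φ ↦ H_{φ,p}` on `φ = v - x^{m+1}` and `φ = u - x^{m+1}` in a whole neighbourhood of the
origin. Linearizing, `w = v - u ≥ 0` satisfies `L w ≤ C |dw|` for a degenerate elliptic operator `L`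
whose symbol at a covector `η` is nonnegative and vanishes only if `η` is orthogonal to the
horizontal directions in the level sets of `φ`.

If the zero set `F` of `w` has an exterior normal `ν`, Hopf's argument with a Gaussian barrier shows
that `ν` is characteristic for `L`. Hence the horizontal fields that annihilate `φ` are tangent to
`F` in the sense of Bony, and so are their brackets, which by the rank condition fill the level sets
of `φ`. The direction of the translations is tangent to `F` as well, since `w` does not depend on
the last coordinate, and it is transversal to the level sets. So `F` has no exterior normals near
the origin, which forces it to be a neighbourhood of the origin.
-/

namespace SubRiem

open Set Filter Asymptotics Metric

section ExteriorNormals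

variable {E : Type*} [NormedAddCommGroup E] {F : Set E}

/-- `ν` is an exterior normal to `F` at `y` in the sense of Bony: no point of `F` is closer to
`y + ν` than `y` is. -/
def IsExteriorNormal (F : Set E) (y ν : E) : Prop :=
  ∀ z ∈ F, ‖ν‖ ≤ ‖y + ν - z‖

lemma isExteriorNormal_of_infDist_eq_dist {c y : E} (h : infDist c F = dist c y) :
    IsExteriorNormal F y (c - y) := by
  intro z hz
  rw [add_sub_cancel, ← dist_eq_norm, ← dist_eq_norm, ← h]
  exact infDist_le_dist_of_mem hz

variable [InnerProductSpace ℝ E] {O : Set E}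

/-- A vector field is tangent to `F` in `O` if it is orthogonal to all exterior normals to `F` at
points of `O`. -/
def IsTangentOn (F O : Set E) (X : E → E) : Prop :=
  ∀ y ∈ F ∩ O, ∀ ν, IsExteriorNormal F y ν → inner ℝ (X y) ν = 0

lemma IsExteriorNormal.inner_nonpos {y ν w : E} (hν : IsExteriorNormal F y ν)
    (hw : w ∈ posTangentConeAt F y) : inner ℝ ν w ≤ 0 := by
  have hmin : IsLocalMinOn (fun z => ‖y + ν - z‖ ^ 2) F y := by
    filter_upwards [self_mem_nhdsWithin] with z hz
    rw [add_sub_cancel_left]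
    exact pow_le_pow_left₀ (norm_nonneg _) (hν z hz) 2
  have hderiv := ((hasFDerivAt_id (𝕜 := ℝ) y).const_sub (y + ν)).norm_sq
  have h := hmin.hasFDerivWithinAt_nonneg hderiv.hasFDerivWithinAt hw
  simp only [id_eq, add_sub_cancel_left, smul_apply, ContinuousLinearMap.comp_apply, neg_apply,
    ContinuousLinearMap.id_apply, innerSL_apply_apply, inner_neg_right, smul_neg, nsmul_eq_mul,
    Nat.cast_ofNat] at h
  linarith

lemma IsTangentOn.neg {X : E → E} (h : IsTangentOn F O X) : IsTangentOn F O (-X) := by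
  intro y hy ν hν
  rw [Pi.neg_apply, inner_neg_left, h y hy ν hν, neg_zero]

end ExteriorNormals

section DistanceAlongCurves

variable {E : Type*} [NormedAddCommGroup E] [InnerProductSpace ℝ E] {F : Set E}

lemma eventually_slope_infDist_sq_lt {γ : ℝ → E} {γ' y : E} {s r : ℝ} (hγ : HasDerivAt γ γ' s)
    (hy : y ∈ F) (hs : infDist (γ s) F = dist (γ s) y) (hr : 2 * inner ℝ γ' (γ s - y) < r) :
    ∀ᶠ t in 𝓝[>] s, (t - s)⁻¹ * (infDist (γ t) F ^ 2 - infDist (γ s) F ^ 2) < r := by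
  have hderiv : HasDerivAt (fun t => ‖γ t - y‖ ^ 2) (2 * inner ℝ γ' (γ s - y)) s := by
    simpa only [real_inner_comm] using (hγ.sub_const y).norm_sq
  have hslope := (hasDerivAt_iff_tendsto_slope.1 hderiv).mono_left (nhdsGT_le_nhdsNE s)
  filter_upwards [hslope.eventually_lt_const hr, self_mem_nhdsWithin] with t ht hst
  refine lt_of_le_of_lt ?_ ht
  have hdist : infDist (γ t) F ≤ ‖γ t - y‖ := dist_eq_norm (γ t) y ▸ infDist_le_dist_of_mem hy
  rw [slope_def_field, div_eq_inv_mul, hs, dist_eq_norm (γ s)]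
  have := sub_pos.2 (mem_Ioi.1 hst)
  have := infDist_nonneg (s := F) (x := γ t)
  gcongr

lemma gronwallBound_zero_le {K ε : ℝ} (hK : 0 < K) (hε : 0 ≤ ε) (t : ℝ) :
    gronwallBound 0 K ε t ≤ ε * t * Real.exp (K * t) := by
  have hexp : Real.exp (K * t) - 1 ≤ K * t * Real.exp (K * t) := by
    have h := mul_le_mul_of_nonneg_right (Real.add_one_le_exp (-(K * t))) (Real.exp_pos (K * t)).le
    rw [← Real.exp_add, neg_add_cancel, Real.exp_zero] at h
    linarith
  simp only [gronwallBound_of_K_ne_0 hK.ne', zero_mul, zero_add]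
  calc ε / K * (Real.exp (K * t) - 1) ≤ ε / K * (K * t * Real.exp (K * t)) := by gcongr
    _ = ε * t * Real.exp (K * t) := by field_simp

lemma infDist_sq_le_of_inner_deriv_le [ProperSpace E] (hF : IsClosed F) {γ γ' : ℝ → E}
    {T ε L : ℝ} (hL : 0 ≤ L) (h0 : γ 0 ∈ F) (hγ : ∀ s, HasDerivAt γ (γ' s) s)
    (hin : ∀ s ∈ Ico 0 T, ∀ y ∈ F, infDist (γ s) F = dist (γ s) y →
      inner ℝ (γ' s) (γ s - y) ≤ (ε + L * ‖γ s - y‖) * ‖γ s - y‖) :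
    ∀ t ∈ Icc 0 T, infDist (γ t) F ^ 2 ≤ ε ^ 2 * t * Real.exp ((1 + 2 * L) * t) := by
  choose P hPF hP using fun x => hF.exists_infDist_eq_dist ⟨_, h0⟩ x
  have hcont : Continuous γ := continuous_iff_continuousAt.2 fun s => (hγ s).continuousAt
  intro t ht
  have hgronwall := le_gronwallBound_of_liminf_deriv_right_le (δ := 0) (K := 1 + 2 * L)
    (ε := ε ^ 2) (f := fun s => infDist (γ s) F ^ 2)
    (f' := fun s => 2 * inner ℝ (γ' s) (γ s - P (γ s)))
    (((continuous_infDist_pt F).comp hcont).pow 2).continuousOn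
    (fun s _ r hr => (eventually_slope_infDist_sq_lt (hγ s) (hPF _) (hP _) hr).frequently)
    (by simp [infDist_zero_of_mem h0])
    (fun s hs => by
      have h := hin s hs (P (γ s)) (hPF _) (hP _)
      rw [hP (γ s), dist_eq_norm]
      nlinarith [sq_nonneg (ε - ‖γ s - P (γ s)‖)]) t ht
  rw [sub_zero] at hgronwall
  exact hgronwall.trans (gronwallBound_zero_le (by linarith) (sq_nonneg ε) t)

end DistanceAlongCurves

section C11Bounds

variable {E E' : Type*} [NormedAddCommGroup E] [NormedSpace ℝ E] [NormedAddCommGroup E']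
  [NormedSpace ℝ E'] {X : E → E'} {B : Set E} {M : ℝ}

/-- On `B`, the norm of `X`, the norm of its derivative and the Lipschitz constant of its derivative
are bounded by `M`. -/
structure HasC11BoundOn (X : E → E') (B : Set E) (M : ℝ) : Prop where
  differentiableAt : ∀ a ∈ B, DifferentiableAt ℝ X a
  norm_le : ∀ a ∈ B, ‖X a‖ ≤ M
  norm_fderiv_le : ∀ a ∈ B, ‖fderiv ℝ X a‖ ≤ M
  norm_fderiv_sub_le : ∀ a ∈ B, ∀ b ∈ B, ‖fderiv ℝ X b - fderiv ℝ X a‖ ≤ M * ‖b - a‖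

lemma exists_hasC11BoundOn_ball {y : E} (hX : ContDiffAt ℝ 2 X y) :
    ∃ M, ∀ᶠ r in 𝓝[>] (0 : ℝ), HasC11BoundOn X (ball y r) M := by
  have hX' : ContDiffAt ℝ 1 (fderiv ℝ X) y := hX.fderiv_right (by norm_num)
  obtain ⟨K, s, hs, hlip⟩ := hX'.exists_lipschitzOnWith
  have hnear : ∀ᶠ a in 𝓝 y, DifferentiableAt ℝ X a ∧ ‖X a‖ < ‖X y‖ + 1 ∧
      ‖fderiv ℝ X a‖ < ‖fderiv ℝ X y‖ + 1 ∧ a ∈ s := by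
    filter_upwards [hX.eventually (by simp), hX.continuousAt.norm.eventually_lt_const
      (lt_add_one _), hX'.continuousAt.norm.eventually_lt_const (lt_add_one _), hs]
      with a h₁ h₂ h₃ h₄ using ⟨h₁.differentiableAt (by simp), h₂, h₃, h₄⟩
  obtain ⟨ρ, hρ, hball⟩ := Metric.eventually_nhds_iff_ball.1 hnear
  have hX₀ := norm_nonneg (X y)
  have hX₁ := norm_nonneg (fderiv ℝ X y)
  refine ⟨‖X y‖ + 1 + (‖fderiv ℝ X y‖ + 1) + K, ?_⟩
  filter_upwards [Ioo_mem_nhdsGT hρ] with r hr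
  replace hball := fun a ha => hball a (ball_subset_ball hr.2.le ha)
  refine ⟨fun a ha => (hball a ha).1, fun a ha => ?_, fun a ha => ?_, fun a ha b hb => ?_⟩
  · linarith [(hball a ha).2.1, K.2]
  · linarith [(hball a ha).2.2.1, K.2]
  · refine (hlip.norm_sub_le (hball b hb).2.2.2 (hball a ha).2.2.2).trans ?_
    gcongr
    linarith

lemma HasC11BoundOn.norm_image_sub_le (h : HasC11BoundOn X B M) (hB : Convex ℝ B) {a b : E}
    (ha : a ∈ B) (hb : b ∈ B) : ‖X b - X a‖ ≤ M * ‖b - a‖ :=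
  hB.norm_image_sub_le_of_norm_fderiv_le h.differentiableAt h.norm_fderiv_le ha hb

lemma HasC11BoundOn.norm_sub_sub_fderiv_le (h : HasC11BoundOn X B M) (hB : Convex ℝ B) {a b : E}
    (ha : a ∈ B) (hb : b ∈ B) : ‖X b - X a - fderiv ℝ X a (b - a)‖ ≤ M * ‖b - a‖ ^ 2 := by
  have hM : 0 ≤ M := (norm_nonneg _).trans (h.norm_le a ha)
  have hseg : segment ℝ a b ⊆ B := hB.segment_subset ha hb
  have hderiv : ∀ x ∈ segment ℝ a b, ‖fderiv ℝ X x - fderiv ℝ X a‖ ≤ M * ‖b - a‖ := by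
    intro x hx
    refine (h.norm_fderiv_sub_le a ha x (hseg hx)).trans ?_
    gcongr
    exact norm_sub_le_of_mem_segment hx
  refine ((convex_segment a b).norm_image_sub_le_of_norm_fderiv_le'
    (fun x hx => h.differentiableAt x (hseg hx)) hderiv (left_mem_segment ℝ a b)
    (right_mem_segment ℝ a b)).trans_eq ?_
  ring

end C11Bounds

section TaylorStep

variable {E : Type*} [NormedAddCommGroup E] [NormedSpace ℝ E] {X : E → E} {B : Set E} {M : ℝ}
  {z : E}

/-- The second order Taylor polynomial of the flow of `X` issued from `z`. -/
noncomputable def taylorStep (X : E → E) (z : E) (t : ℝ) : E :=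
  z + t • X z + (t ^ 2 / 2) • fderiv ℝ X z (X z)

lemma hasDerivAt_taylorStep (X : E → E) (z : E) (t : ℝ) :
    HasDerivAt (taylorStep X z) (X z + t • fderiv ℝ X z (X z)) t := by
  refine ((((hasDerivAt_id t).smul_const (X z)).const_add z).add
    ((((hasDerivAt_id t).pow 2).div_const 2).smul_const (fderiv ℝ X z (X z)))).congr_deriv ?_
  simp

lemma taylorStep_sub (X : E → E) (z : E) (t : ℝ) :
    taylorStep X z t - z = t • X z + (t ^ 2 / 2) • fderiv ℝ X z (X z) := by
  rw [taylorStep, add_assoc, add_sub_cancel_left]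

lemma HasC11BoundOn.norm_fderiv_apply_le (h : HasC11BoundOn X B M) (hz : z ∈ B) {v : E} {K : ℝ}
    (hv : ‖v‖ ≤ K) : ‖fderiv ℝ X z v‖ ≤ M * K :=
  (fderiv ℝ X z).le_of_opNorm_le_of_le (h.norm_fderiv_le z hz) hv

lemma HasC11BoundOn.norm_taylorStep_sub_le (h : HasC11BoundOn X B M) (hz : z ∈ B) {t : ℝ}
    (ht : t ∈ Icc 0 1) : ‖taylorStep X z t - z‖ ≤ (M + M * M) * t := by
  obtain ⟨ht0, ht1⟩ := ht
  have hX := h.norm_le z hz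
  have hX' := h.norm_fderiv_apply_le hz hX
  have ht2 : t ^ 2 / 2 ≤ t := by nlinarith
  calc ‖taylorStep X z t - z‖ ≤ ‖t • X z‖ + ‖(t ^ 2 / 2) • fderiv ℝ X z (X z)‖ :=
        taylorStep_sub X z t ▸ norm_add_le _ _
    _ = t * ‖X z‖ + t ^ 2 / 2 * ‖fderiv ℝ X z (X z)‖ := by
        rw [norm_smul, norm_smul, Real.norm_of_nonneg ht0, Real.norm_of_nonneg (by positivity)]
    _ ≤ t * M + t * (M * M) := by gcongr
    _ = (M + M * M) * t := by ring

lemma HasC11BoundOn.norm_taylorStep_deriv_sub_le (h : HasC11BoundOn X B M) (hB : Convex ℝ B)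
    (hz : z ∈ B) {t : ℝ} (ht : t ∈ Icc 0 1) (hzt : taylorStep X z t ∈ B) :
    ‖X z + t • fderiv ℝ X z (X z) - X (taylorStep X z t)‖ ≤
      (M * (M + M * M) ^ 2 + M * (M * M)) * t ^ 2 := by
  have hM : 0 ≤ M := (norm_nonneg _).trans (h.norm_le z hz)
  set D := fderiv ℝ X z (X z)
  have hD : ‖fderiv ℝ X z D‖ ≤ M * (M * M) :=
    h.norm_fderiv_apply_le hz (h.norm_fderiv_apply_le hz (h.norm_le z hz))
  have hsplit : X z + t • D - X (taylorStep X z t) =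
      -(X (taylorStep X z t) - X z - fderiv ℝ X z (taylorStep X z t - z)) -
        (t ^ 2 / 2) • fderiv ℝ X z D := by
    rw [taylorStep_sub, map_add, map_smul, map_smul]
    abel
  have hremainder := (h.norm_sub_sub_fderiv_le hB hz hzt).trans <|
    mul_le_mul_of_nonneg_left (pow_le_pow_left₀ (norm_nonneg _) (h.norm_taylorStep_sub_le hz ht) 2)
      hM
  rw [hsplit]
  refine (norm_sub_le _ _).trans ?_
  rw [norm_neg, norm_smul, Real.norm_of_nonneg (by positivity : 0 ≤ t ^ 2 / 2)]
  nlinarith [mul_le_mul_of_nonneg_left hD (by positivity : 0 ≤ t ^ 2 / 2),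
    (by positivity : 0 ≤ M * (M * M) * t ^ 2)]

end TaylorStep

section TaylorStepTangent

variable {E : Type*} [NormedAddCommGroup E] [InnerProductSpace ℝ E] {F O : Set E}
  {X : E → E}

lemma IsTangentOn.inner_le_of_isExteriorNormal (hT : IsTangentOn F O X) {x a v : E} {M : ℝ}
    (haF : a ∈ F) (haO : a ∈ O) (ha : IsExteriorNormal F a (x - a))
    (hX : ‖X x - X a‖ ≤ M * ‖x - a‖) :
    inner ℝ v (x - a) ≤ (‖v - X x‖ + M * ‖x - a‖) * ‖x - a‖ := by
  have hortho : inner ℝ (X a) (x - a) = 0 := hT a ⟨haF, haO⟩ (x - a) ha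
  calc inner ℝ v (x - a) = inner ℝ ((v - X x) + (X x - X a)) (x - a) := by
        rw [sub_add_sub_cancel, inner_sub_left, hortho, sub_zero]
    _ ≤ (‖v - X x‖ + ‖X x - X a‖) * ‖x - a‖ :=
        (real_inner_le_norm _ _).trans (by gcongr; exact norm_add_le _ _)
    _ ≤ (‖v - X x‖ + M * ‖x - a‖) * ‖x - a‖ := by gcongr

variable [ProperSpace E]

lemma IsTangentOn.infDist_taylorStep_sq_le (hF : IsClosed F) (hT : IsTangentOn F O X) {y z : E}
    {r M t : ℝ} (hO : ball y (3 * r) ⊆ O) (hX : HasC11BoundOn X (ball y (3 * r)) M)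
    (hzF : z ∈ F) (hzr : z ∈ ball y r) (ht : t ∈ Icc 0 1) (htr : (M + M * M) * t < r) :
    infDist (taylorStep X z t) F ^ 2 ≤
      (M * (M + M * M) ^ 2 + M * (M * M)) ^ 2 * Real.exp (1 + 2 * M) * t ^ 5 := by
  obtain ⟨ht0, ht1⟩ := ht
  have hconv := convex_ball y (3 * r)
  have hr : 0 < r := pos_of_mem_ball hzr
  have hz : z ∈ ball y (3 * r) := ball_subset_ball (by linarith) hzr
  have hM : 0 ≤ M := (norm_nonneg _).trans (hX.norm_le z hz)
  set c := M * (M + M * M) ^ 2 + M * (M * M)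
  have hstep : ∀ s ∈ Icc 0 t, dist (taylorStep X z s) z < r := fun s hs => by
    have h := hX.norm_taylorStep_sub_le hz ⟨hs.1, hs.2.trans ht1⟩
    have h' := mul_le_mul_of_nonneg_left hs.2 (by positivity : 0 ≤ M + M * M)
    rw [dist_eq_norm]
    linarith
  have hinner : ∀ s ∈ Ico 0 t, ∀ a ∈ F,
      infDist (taylorStep X z s) F = dist (taylorStep X z s) a →
      inner ℝ (X z + s • fderiv ℝ X z (X z)) (taylorStep X z s - a) ≤
        (c * t ^ 2 + M * ‖taylorStep X z s - a‖) * ‖taylorStep X z s - a‖ := by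
    intro s hs a haF ha
    have hsz := hstep s ⟨hs.1, hs.2.le⟩
    have hsa : dist (taylorStep X z s) a < r := (ha ▸ infDist_le_dist_of_mem hzF).trans_lt hsz
    have hsy : taylorStep X z s ∈ ball y (3 * r) :=
      mem_ball.2 (by linarith [dist_triangle (taylorStep X z s) z y, mem_ball.1 hzr])
    have hay : a ∈ ball y (3 * r) := mem_ball.2 (by
      linarith [dist_triangle_left a z (taylorStep X z s), dist_triangle a z y, mem_ball.1 hzr])
    have herr := hX.norm_taylorStep_deriv_sub_le hconv hz ⟨hs.1, hs.2.le.trans ht1⟩ hsy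
    have hst : c * s ^ 2 ≤ c * t ^ 2 := by have := hs.1; have := hs.2; gcongr
    refine (hT.inner_le_of_isExteriorNormal haF (hO hay) (isExteriorNormal_of_infDist_eq_dist ha)
      (hX.norm_image_sub_le hconv hay hsy)).trans ?_
    gcongr
    exact herr.trans hst
  have hdist := infDist_sq_le_of_inner_deriv_le hF hM (by simpa [taylorStep] using hzF)
    (hasDerivAt_taylorStep X z) hinner t ⟨ht0, le_rfl⟩
  have hexp : Real.exp ((1 + 2 * M) * t) ≤ Real.exp (1 + 2 * M) :=
    Real.exp_le_exp.2 (mul_le_of_le_one_right (by positivity) ht1)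
  calc infDist (taylorStep X z t) F ^ 2
      ≤ (c * t ^ 2) ^ 2 * t * Real.exp (1 + 2 * M) := hdist.trans (by gcongr)
    _ = c ^ 2 * Real.exp (1 + 2 * M) * t ^ 5 := by ring

lemma IsTangentOn.infDist_taylorStep_isLittleO (hF : IsClosed F) (hT : IsTangentOn F O X) {y : E}
    (hO : O ∈ 𝓝 y) (hX : ContDiffAt ℝ 2 X y) :
    (fun q : E × ℝ => infDist (taylorStep X q.1 q.2) F) =o[𝓝[F] y ×ˢ 𝓝[>] 0] fun q => q.2 ^ 2 := by
  obtain ⟨M, hM⟩ := exists_hasC11BoundOn_ball hX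
  obtain ⟨R, hR, hRO⟩ := Metric.mem_nhds_iff.1 hO
  obtain ⟨ρ, hρX, hρ0, hρR⟩ := (hM.and (Ioo_mem_nhdsGT hR)).exists
  obtain ⟨r, rfl⟩ : ∃ r, ρ = 3 * r := ⟨ρ / 3, by ring⟩
  have hr : 0 < r := by linarith
  set C := (M * (M + M * M) ^ 2 + M * (M * M)) ^ 2 * Real.exp (1 + 2 * M)
  refine IsLittleO.of_bound fun ε hε => ?_
  have hball : ∀ᶠ z in 𝓝[F] y, z ∈ F ∧ z ∈ ball y r :=
    eventually_mem_nhdsWithin.and (mem_nhdsWithin_of_mem_nhds (ball_mem_nhds y hr))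
  have hsmall : ∀ᶠ t in 𝓝[>] (0 : ℝ), t ∈ Ioo 0 1 ∧ (M + M * M) * t < r ∧ C * t < ε ^ 2 := by
    have htend : ∀ K δ : ℝ, 0 < δ → ∀ᶠ t in 𝓝[>] (0 : ℝ), K * t < δ := fun K δ hδ =>
      nhdsWithin_le_nhds (((continuous_const_mul K).tendsto' 0 0 (mul_zero K)).eventually_lt_const
        hδ)
    exact Filter.Eventually.and (Ioo_mem_nhdsGT one_pos) <|
      (htend _ r hr).and (htend _ _ (by positivity))
  filter_upwards [hball.prod_mk hsmall] with q ⟨⟨hqF, hqr⟩, ⟨hq0, hq1⟩, hqM, hqC⟩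
  rw [Real.norm_of_nonneg infDist_nonneg, Real.norm_of_nonneg (by positivity)]
  refine le_of_sq_le_sq ?_ (by positivity)
  calc infDist (taylorStep X q.1 q.2) F ^ 2
      ≤ C * q.2 ^ 5 := hT.infDist_taylorStep_sq_le hF ((ball_subset_ball hρR.le).trans hRO) hρX hqF
        hqr ⟨hq0.le, hq1.le⟩ hqM
    _ = C * q.2 * q.2 ^ 4 := by ring
    _ ≤ ε ^ 2 * q.2 ^ 4 := by gcongr
    _ = (ε * q.2 ^ 2) ^ 2 := by ring

end TaylorStepTangent

section RightExpansions

variable {E : Type*} [NormedAddCommGroup E] [NormedSpace ℝ E] {z : ℝ → E} {y a b : E}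

/-- The curve `z` has the one-sided second order expansion `z t = y + t a + t² b + o(t²)` as
`t → 0⁺`. -/
def HasRightExpansion (z : ℝ → E) (y a b : E) : Prop :=
  (fun t => z t - (y + t • a + t ^ 2 • b)) =o[𝓝[>] 0] fun t : ℝ => t ^ 2

lemma tendsto_id_nhdsGT_zero : Tendsto (fun t : ℝ => t) (𝓝[>] 0) (𝓝 0) :=
  tendsto_id.mono_left nhdsWithin_le_nhds

lemma smul_isBigO_self {l : Filter ℝ} (f : ℝ → ℝ) (a : E) : (fun t => f t • a) =O[l] f :=
  IsBigO.of_bound ‖a‖ (Eventually.of_forall fun t => by rw [norm_smul, mul_comm])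

lemma hasRightExpansion_const (y : E) : HasRightExpansion (fun _ => y) y 0 0 := by
  simp [HasRightExpansion]

lemma HasRightExpansion.sub_sub_smul_isLittleO (hz : HasRightExpansion z y a b) :
    (fun t => z t - y - t • a) =o[𝓝[>] 0] fun t : ℝ => t := by
  have hsq : (fun t : ℝ => t ^ 2) =o[𝓝[>] 0] fun t : ℝ => t :=
    (isLittleO_pow_id one_lt_two).mono nhdsWithin_le_nhds
  refine ((hz.trans hsq).add ((smul_isBigO_self _ b).trans_isLittleO hsq)).congr_left fun t => ?_
  abel

lemma HasRightExpansion.sub_isBigO (hz : HasRightExpansion z y a b) :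
    (fun t => z t - y) =O[𝓝[>] 0] fun t : ℝ => t := by
  refine (hz.sub_sub_smul_isLittleO.isBigO.add (smul_isBigO_self _ a)).congr_left fun t => ?_
  abel

lemma HasRightExpansion.tendsto (hz : HasRightExpansion z y a b) : Tendsto z (𝓝[>] 0) (𝓝 y) := by
  simpa only [sub_add_cancel, zero_add] using
    (hz.sub_isBigO.trans_tendsto tendsto_id_nhdsGT_zero).add_const y

lemma HasRightExpansion.congr_isLittleO {z' : ℝ → E} (hz : HasRightExpansion z y a b)
    (h : (fun t => z' t - z t) =o[𝓝[>] 0] fun t : ℝ => t ^ 2) : HasRightExpansion z' y a b :=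
  (h.add hz).congr_left fun _ => sub_add_sub_cancel _ _ _

lemma HasRightExpansion.taylorStep {X : E → E} (hX : ContDiffAt ℝ 2 X y)
    (hz : HasRightExpansion z y a b) :
    HasRightExpansion (fun t => taylorStep X (z t) t) y (a + X y)
      (b + fderiv ℝ X y a + (1 / 2 : ℝ) • fderiv ℝ X y (X y)) := by
  have hX' : HasFDerivAt X (fderiv ℝ X y) y := (hX.differentiableAt (by simp)).hasFDerivAt
  have hfirst : (fun t : ℝ => t • (X (z t) - X y - t • fderiv ℝ X y a))
      =o[𝓝[>] 0] fun t : ℝ => t ^ 2 := by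
    have hX_err := (hX'.isLittleO.comp_tendsto hz.tendsto).trans_isBigO hz.sub_isBigO
    have hz_err := ((fderiv ℝ X y).isBigO_comp _ _).trans_isLittleO hz.sub_sub_smul_isLittleO
    refine (((isBigO_refl (fun t : ℝ => t) (𝓝[>] 0)).smul_isLittleO
      (hX_err.add hz_err)).congr_left fun t => ?_).congr_right fun t => (pow_two t).symm
    simp only [Function.comp_apply, map_sub, map_smul]
    congr 1
    abel
  have hsecond : (fun t : ℝ => t ^ 2 • (1 / 2 : ℝ) •
      (fderiv ℝ X (z t) (X (z t)) - fderiv ℝ X y (X y))) =o[𝓝[>] 0] fun t : ℝ => t ^ 2 := by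
    have hcont : ContinuousAt (fun x => fderiv ℝ X x (X x)) y :=
      (hX.fderiv_right (m := 1) (by norm_num)).continuousAt.clm_apply hX.continuousAt
    have hlim :=
      (tendsto_sub_nhds_zero_iff.2 (hcont.tendsto.comp hz.tendsto)).const_smul (1 / 2 : ℝ)
    rw [smul_zero] at hlim
    simpa only [smul_eq_mul, mul_one, Function.comp_apply] using
      (isBigO_refl (fun t : ℝ => t ^ 2) (𝓝[>] 0)).smul_isLittleO ((isLittleO_one_iff ℝ).2 hlim)
  refine ((hfirst.add hsecond).add hz).congr_left fun t => ?_
  simp only [SubRiem.taylorStep]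
  module

lemma HasRightExpansion.mem_posTangentConeAt {F : Set E}
    (hz : HasRightExpansion z y 0 b) (hzF : ∀ᶠ t in 𝓝[>] 0, z t ∈ F) :
    b ∈ posTangentConeAt F y := by
  refine mem_tangentConeAt_of_seq (𝓝[>] (0 : ℝ)) (fun t => (t.toNNReal ^ 2)⁻¹) (fun t => z t - y)
    (tendsto_sub_nhds_zero_iff.2 hz.tendsto)
    (hzF.mono fun t ht => by rwa [add_sub_cancel]) ?_
  have hlim := (IsLittleO.tendsto_inv_smul_nhds_zero hz).add_const b
  rw [zero_add] at hlim
  refine hlim.congr' ?_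
  filter_upwards [self_mem_nhdsWithin] with t ht
  have ht2 : t ^ 2 ≠ 0 := pow_ne_zero _ (ne_of_gt ht)
  rw [NNReal.smul_def, NNReal.coe_inv, NNReal.coe_pow, Real.coe_toNNReal t (le_of_lt ht), smul_zero,
    add_zero, ← sub_sub, smul_sub _ (z t - y), inv_smul_smul₀ ht2, sub_add_cancel]

end RightExpansions

section LieBracketTangent

variable {E : Type*} [NormedAddCommGroup E] [InnerProductSpace ℝ E] [ProperSpace E] {F O : Set E}
  {X Y : E → E} {y : E}

lemma IsTangentOn.exists_curve_step (hF : IsClosed F) (hT : IsTangentOn F O X) (hO : O ∈ 𝓝 y)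
    (hX : ContDiffAt ℝ 2 X y) {z : ℝ → E} {a b : E} (hzF : ∀ᶠ t in 𝓝[>] 0, z t ∈ F)
    (hz : HasRightExpansion z y a b) :
    ∃ z' : ℝ → E, (∀ᶠ t in 𝓝[>] 0, z' t ∈ F) ∧ HasRightExpansion z' y (a + X y)
      (b + fderiv ℝ X y a + (1 / 2 : ℝ) • fderiv ℝ X y (X y)) := by
  obtain ⟨t₀, ht₀⟩ := hzF.exists
  choose P hPF hP using fun x => hF.exists_infDist_eq_dist ⟨_, ht₀⟩ x
  refine ⟨fun t => P (taylorStep X (z t) t), Eventually.of_forall fun t => hPF _,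
    (hz.taylorStep hX).congr_isLittleO (IsLittleO.of_norm_left ?_)⟩
  have hlim : Tendsto (fun t => (z t, t)) (𝓝[>] 0) (𝓝[F] y ×ˢ 𝓝[>] 0) :=
    (tendsto_nhdsWithin_iff.2 ⟨hz.tendsto, hzF⟩).prodMk tendsto_id
  refine ((hT.infDist_taylorStep_isLittleO hF hO hX).comp_tendsto hlim).congr_left fun t => ?_
  rw [Function.comp_apply, hP, dist_comm, dist_eq_norm]

/-- Following `X`, `Y`, `-X`, `-Y` in turn for the time `t`, and projecting back to `F` after each
step, the first order terms cancel and the second order term is the bracket. -/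
lemma IsTangentOn.exists_commutator_curve (hF : IsClosed F) (hTX : IsTangentOn F O X)
    (hTY : IsTangentOn F O Y) (hO : O ∈ 𝓝 y) (hX : ContDiffAt ℝ 2 X y) (hY : ContDiffAt ℝ 2 Y y)
    (hy : y ∈ F) : ∃ z : ℝ → E, (∀ᶠ t in 𝓝[>] 0, z t ∈ F) ∧
      HasRightExpansion z y 0 (VectorField.lieBracket ℝ X Y y) := by
  obtain ⟨z₁, hz₁, e₁⟩ := hTX.exists_curve_step hF hO hX (Eventually.of_forall fun _ => hy)
    (hasRightExpansion_const y)
  obtain ⟨z₂, hz₂, e₂⟩ := hTY.exists_curve_step hF hO hY hz₁ e₁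
  obtain ⟨z₃, hz₃, e₃⟩ := hTX.neg.exists_curve_step hF hO hX.neg hz₂ e₂
  obtain ⟨z₄, hz₄, e₄⟩ := hTY.neg.exists_curve_step hF hO hY.neg hz₃ e₃
  refine ⟨z₄, hz₄, ?_⟩
  convert e₄ using 1
  · simp only [Pi.neg_apply]
    abel
  · simp only [VectorField.lieBracket_eq, Pi.neg_apply, fderiv_neg, map_add, map_neg, map_zero,
      zero_add, neg_apply, neg_neg]
    module

lemma IsTangentOn.lieBracket (hF : IsClosed F) (hO : IsOpen O) (hX : ContDiffOn ℝ 2 X O)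
    (hY : ContDiffOn ℝ 2 Y O) (hTX : IsTangentOn F O X) (hTY : IsTangentOn F O Y) :
    IsTangentOn F O (VectorField.lieBracket ℝ X Y) := by
  intro y hy ν hν
  have hyO := hO.mem_nhds hy.2
  obtain ⟨z, hzF, hz⟩ := hTX.exists_commutator_curve hF hTY hyO (hX.contDiffAt hyO)
    (hY.contDiffAt hyO) hy.1
  obtain ⟨z', hz'F, hz'⟩ := hTY.exists_commutator_curve hF hTX hyO (hY.contDiffAt hyO)
    (hX.contDiffAt hyO) hy.1
  have hle := hν.inner_nonpos (hz.mem_posTangentConeAt hzF)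
  have hge := hν.inner_nonpos (hz'.mem_posTangentConeAt hz'F)
  rw [VectorField.lieBracket_swap, inner_neg_right, neg_nonpos] at hge
  rw [real_inner_comm]
  exact le_antisymm hle hge

end LieBracketTangent

section LocalMinima

lemma deriv_deriv_nonneg_of_isLocalMin {f : ℝ → ℝ} {t : ℝ} (h : IsLocalMin f t)
    (hf : ContinuousAt f t) : 0 ≤ deriv (deriv f) t := by
  by_contra! hneg
  have hmax := isLocalMax_of_deriv_deriv_neg hneg h.deriv_eq_zero hf
  have hconst : f =ᶠ[𝓝 t] fun _ => f t := by
    filter_upwards [h, hmax] with s hs hs' using le_antisymm hs' hs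
  have hzero : deriv (deriv f) t = 0 := by
    rw [hconst.deriv.deriv_eq]
    simp only [deriv_const']
  exact hneg.ne hzero

lemma exists_isLocalMin_sub_smul {X : Type*} [PseudoMetricSpace X] [ProperSpace X]
    {w ψ : X → ℝ} {y : X} {ρ : ℝ} (hρ : 0 < ρ)
    (hw : ContinuousOn w (closedBall y ρ)) (hψ : Continuous ψ)
    (hw0 : ∀ x ∈ closedBall y ρ, 0 ≤ w x) (hwy : w y = 0)
    (hpos : ∀ x ∈ sphere y ρ, ψ y ≤ ψ x → 0 < w x) :
    ∃ ε > (0 : ℝ), ∃ x ∈ ball y ρ, IsLocalMin (w - ε • ψ) x := by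
  have hcpt : IsCompact (sphere y ρ ∩ {x | ψ y ≤ ψ x}) :=
    (isCompact_sphere y ρ).inter_right (isClosed_le continuous_const hψ)
  obtain ⟨δ, hδ, hδw⟩ := hcpt.exists_forall_le'
    (hw.mono (inter_subset_left.trans sphere_subset_closedBall)) fun x hx => hpos x hx.1 hx.2
  obtain ⟨K, hK⟩ := (isCompact_sphere y ρ).exists_bound_of_continuousOn
    (hψ.sub continuous_const : Continuous fun x => ψ x - ψ y).continuousOn
  set ε := δ / (|K| + 1)
  have hε : 0 < ε := by positivity
  have hεK : ε * (|K| + 1) = δ := div_mul_cancel₀ δ (by positivity)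
  refine ⟨ε, hε, exists_isLocalMin_mem_ball (hw.sub (hψ.const_smul ε).continuousOn)
    (mem_closedBall_self hρ.le) fun x hx => ?_⟩
  simp only [Pi.sub_apply, Pi.smul_apply, smul_eq_mul, hwy, zero_sub]
  rcases le_or_gt (ψ y) (ψ x) with hxy | hxy
  · have hψx : ψ x - ψ y < |K| + 1 :=
      ((le_abs_self _).trans ((hK x hx).trans (le_abs_self K))).trans_lt (lt_add_one _)
    have := mul_lt_mul_of_pos_left hψx hε
    linarith [hδw x ⟨hx, hxy⟩]
  · have := mul_lt_mul_of_pos_left hxy hε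
    linarith [hw0 x (sphere_subset_closedBall hx)]

variable {E : Type*} [NormedAddCommGroup E] [NormedSpace ℝ E] {f : E → ℝ} {x : E}

lemma fderiv_fderiv_apply_eq_deriv_deriv (hf : ContDiffAt ℝ 2 f x) (η : E) :
    fderiv ℝ (fderiv ℝ f) x η η = deriv (deriv fun t : ℝ => f (x + t • η)) 0 := by
  have hline : ∀ t : ℝ, HasDerivAt (fun t : ℝ => x + t • η) η t := fun t => by
    simpa using ((hasDerivAt_id t).smul_const η).const_add x
  have hlim : Tendsto (fun t : ℝ => x + t • η) (𝓝 0) (𝓝 x) := by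
    simpa using (hline 0).continuousAt.tendsto
  have hderiv : deriv (fun t : ℝ => f (x + t • η)) =ᶠ[𝓝 0] fun t => fderiv ℝ f (x + t • η) η := by
    filter_upwards [hlim.eventually (hf.eventually (by simp))] with t ht
    exact ((ht.differentiableAt (by simp)).hasFDerivAt.comp_hasDerivAt t (hline t)).deriv
  have hf' : HasFDerivAt (fderiv ℝ f) (fderiv ℝ (fderiv ℝ f) x) (x + (0 : ℝ) • η) := by
    rw [zero_smul, add_zero]
    exact ((hf.fderiv_right (m := 1) (by norm_num)).differentiableAt one_ne_zero).hasFDerivAt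
  rw [hderiv.deriv_eq]
  have hcomp := HasFDerivAt.comp_hasDerivAt (f := fun t : ℝ => x + t • η) 0 hf' (hline 0)
  simpa using (hcomp.clm_apply (hasDerivAt_const 0 η)).deriv.symm

lemma fderiv_fderiv_apply_nonneg_of_isLocalMin (h : IsLocalMin f x) (hf : ContDiffAt ℝ 2 f x)
    (η : E) : 0 ≤ fderiv ℝ (fderiv ℝ f) x η η := by
  have hline : Continuous fun t : ℝ => x + t • η := by fun_prop
  rw [fderiv_fderiv_apply_eq_deriv_deriv hf]
  refine deriv_deriv_nonneg_of_isLocalMin ?_ ?_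
  · exact IsLocalMin.comp_continuous (f := f) (g := fun t : ℝ => x + t • η) (by simpa using h)
      hline.continuousAt
  · exact ContinuousAt.comp' (by simpa using hf.continuousAt) hline.continuousAt

lemma fderiv_fderiv_sub {g : E → ℝ} (hf : ContDiffAt ℝ 2 f x) (hg : ContDiffAt ℝ 2 g x) :
    fderiv ℝ (fderiv ℝ (f - g)) x = fderiv ℝ (fderiv ℝ f) x - fderiv ℝ (fderiv ℝ g) x := by
  have hev : fderiv ℝ (f - g) =ᶠ[𝓝 x] fderiv ℝ f - fderiv ℝ g := by
    filter_upwards [hf.eventually (by simp), hg.eventually (by simp)] with z hfz hgz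
    exact fderiv_sub (hfz.differentiableAt (by simp)) (hgz.differentiableAt (by simp))
  rw [hev.fderiv_eq]
  exact fderiv_sub ((hf.fderiv_right (m := 1) (by norm_num)).differentiableAt one_ne_zero)
    ((hg.fderiv_right (m := 1) (by norm_num)).differentiableAt one_ne_zero)

lemma fderiv_eq_of_isLocalMin_sub {g : E → ℝ} (h : IsLocalMin (f - g) x)
    (hf : DifferentiableAt ℝ f x) (hg : DifferentiableAt ℝ g x) : fderiv ℝ f x = fderiv ℝ g x :=
  sub_eq_zero.1 ((fderiv_sub hf hg).symm.trans h.fderiv_eq_zero)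

end LocalMinima

section TraceComp

variable {E : Type*} [NormedAddCommGroup E]

/-- The contraction `tr (T S)` of a contravariant tensor `T` with a bilinear form `S`. With
`S = D²w x`, these are the second order operators of the maximum principle. -/
noncomputable def traceComp [NormedSpace ℝ E] (T : (E →L[ℝ] ℝ) →L[ℝ] E) :
    (E →L[ℝ] E →L[ℝ] ℝ) →ₗ[ℝ] ℝ :=
  LinearMap.trace ℝ E ∘ₗ ContinuousLinearMap.coeLM ℝ ∘ₗ
    (ContinuousLinearMap.compL ℝ E (E →L[ℝ] ℝ) E T).toLinearMap

lemma traceComp_apply [NormedSpace ℝ E] (T : (E →L[ℝ] ℝ) →L[ℝ] E) (S : E →L[ℝ] E →L[ℝ] ℝ) :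
    traceComp T S = LinearMap.trace ℝ E (T ∘L S : E →L[ℝ] E) := rfl

lemma traceComp_smulRight [NormedSpace ℝ E] [FiniteDimensional ℝ E] (T : (E →L[ℝ] ℝ) →L[ℝ] E)
    (η θ : E →L[ℝ] ℝ) : traceComp T (η.smulRight θ) = η (T θ) := by
  have hcomp : T ∘L η.smulRight θ = η.smulRight (T θ) := by
    ext v
    simp
  rw [traceComp_apply, hcomp]
  exact LinearMap.trace_smulRight _ _

variable [InnerProductSpace ℝ E]

/-- The covector `⟨x, ·⟩`, as a function of `x`; `innerSL` is only conjugate-linear. -/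
noncomputable def innerCovec : E →L[ℝ] E →L[ℝ] ℝ :=
  LinearMap.mkContinuous₂ (innerₗ E) 1 (fun x y => by
    simpa using norm_inner_le_norm (𝕜 := ℝ) x y)

@[simp] lemma innerCovec_apply (x y : E) : innerCovec x y = inner ℝ x y := rfl

@[simp] lemma norm_innerCovec (x : E) : ‖innerCovec x‖ = ‖x‖ :=
  innerSL_apply_norm (𝕜 := ℝ) x

variable [FiniteDimensional ℝ E]

lemma exists_orthonormalBasis_eigenvalues {S : E →L[ℝ] E →L[ℝ] ℝ} (hS : ∀ x y, S x y = S y x) :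
    ∃ (b : OrthonormalBasis (Fin (Module.finrank ℝ E)) ℝ E) (μ : Fin (Module.finrank ℝ E) → ℝ),
      ∀ i, S (b i) = μ i • innerCovec (b i) := by
  let S' : E →ₗ[ℝ] E := (InnerProductSpace.toDual ℝ E).symm.toLinearEquiv.toLinearMap ∘ₛₗ
    S.toLinearMap
  have hinner : ∀ x y, inner ℝ (S' x) y = S x y := fun x y => InnerProductSpace.toDual_symm_apply
  have hsymm : S'.IsSymmetric := fun x y => by rw [hinner, real_inner_comm, hinner, hS]
  refine ⟨hsymm.eigenvectorBasis rfl, hsymm.eigenvalues rfl, fun i => ?_⟩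
  ext y
  rw [← hinner, hsymm.apply_eigenvectorBasis]
  simp [inner_smul_left]

lemma traceComp_nonneg {T : (E →L[ℝ] ℝ) →L[ℝ] E} (hT : ∀ η : E →L[ℝ] ℝ, 0 ≤ η (T η))
    {S : E →L[ℝ] E →L[ℝ] ℝ} (hsymm : ∀ x y, S x y = S y x) (hS : ∀ x, 0 ≤ S x x) :
    0 ≤ traceComp T S := by
  obtain ⟨b, μ, hb⟩ := exists_orthonormalBasis_eigenvalues hsymm
  have hμ : ∀ i, 0 ≤ μ i := fun i => by simpa [hb] using hS (b i)
  rw [traceComp_apply, LinearMap.trace_eq_sum_inner _ b]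
  refine Finset.sum_nonneg fun i _ => ?_
  have heq : inner ℝ (b i) ((T ∘L S) (b i)) = μ i * innerCovec (b i) (T (innerCovec (b i))) := by
    rw [ContinuousLinearMap.comp_apply, hb, map_smul, inner_smul_right, innerCovec_apply]
  exact heq ▸ mul_nonneg (hμ i) (hT _)

lemma continuousAt_traceComp {X : Type*} [TopologicalSpace X] {T : X → (E →L[ℝ] ℝ) →L[ℝ] E} {x : X}
    (hT : ContinuousAt T x) (S : E →L[ℝ] E →L[ℝ] ℝ) : ContinuousAt (fun z => traceComp (T z) S) x :=
  (((LinearMap.trace ℝ E).comp (ContinuousLinearMap.coeLM ℝ)).continuous_of_finiteDimensional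
    (E := E →L[ℝ] E)).continuousAt.comp (hT.clm_comp continuousAt_const)

end TraceComp

section GaussianBarrier

variable {E : Type*} [NormedAddCommGroup E]

/-- The Gaussian `x ↦ exp (-α ‖x - c‖²)`, Hopf's barrier function. -/
noncomputable def gaussian (α : ℝ) (c x : E) : ℝ :=
  Real.exp (-α * ‖x - c‖ ^ 2)

lemma gaussian_pos (α : ℝ) (c x : E) : 0 < gaussian α c x :=
  Real.exp_pos _

lemma gaussian_le_gaussian_iff {α : ℝ} (hα : 0 < α) {c x y : E} :
    gaussian α c y ≤ gaussian α c x ↔ ‖x - c‖ ≤ ‖y - c‖ := by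
  rw [gaussian, gaussian, Real.exp_le_exp, neg_mul, neg_mul, neg_le_neg_iff,
    mul_le_mul_iff_right₀ hα, pow_le_pow_iff_left₀ (norm_nonneg _) (norm_nonneg _) two_ne_zero]

variable [InnerProductSpace ℝ E]

lemma contDiff_gaussian (α : ℝ) (c : E) {n : WithTop ℕ∞} : ContDiff ℝ n (gaussian α c) :=
  (contDiff_const.mul ((contDiff_id.sub contDiff_const).norm_sq ℝ)).exp

lemma hasFDerivAt_gaussian (α : ℝ) (c x : E) :
    HasFDerivAt (gaussian α c) ((-(2 * α) * gaussian α c x) • innerCovec (x - c)) x := by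
  refine ((((hasFDerivAt_id x).sub_const c).norm_sq.const_mul (-α)).exp).congr_fderiv ?_
  ext v
  simp [gaussian]
  ring

lemma norm_fderiv_gaussian {α : ℝ} (hα : 0 < α) (c x : E) :
    ‖fderiv ℝ (gaussian α c) x‖ = 2 * α * gaussian α c x * ‖x - c‖ := by
  have hpos := mul_pos (mul_pos two_pos hα) (gaussian_pos α c x)
  rw [(hasFDerivAt_gaussian α c x).fderiv, norm_smul, norm_innerCovec, neg_mul, norm_neg,
    Real.norm_of_nonneg hpos.le]

lemma fderiv_fderiv_gaussian (α : ℝ) (c x : E) :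
    fderiv ℝ (fderiv ℝ (gaussian α c)) x = (2 * α * gaussian α c x) •
      ((2 * α) • (innerCovec (x - c)).smulRight (innerCovec (x - c)) - innerCovec) := by
  have hfderiv : fderiv ℝ (gaussian α c) =
      fun x => (-(2 * α) * gaussian α c x) • innerCovec (x - c) :=
    funext fun x => (hasFDerivAt_gaussian α c x).fderiv
  rw [hfderiv]
  refine (((hasFDerivAt_gaussian α c x).const_mul (-(2 * α))).smul
    ((innerCovec (E := E)).hasFDerivAt.comp x ((hasFDerivAt_id x).sub_const c))).fderiv.trans ?_
  ext v u
  simp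
  ring

variable [FiniteDimensional ℝ E] {T : E → (E →L[ℝ] ℝ) →L[ℝ] E} {c y : E}

lemma traceComp_fderiv_fderiv_gaussian (T : (E →L[ℝ] ℝ) →L[ℝ] E) (α : ℝ) (c x : E) :
    traceComp T (fderiv ℝ (fderiv ℝ (gaussian α c)) x) = 2 * α * gaussian α c x *
      (2 * α * innerCovec (x - c) (T (innerCovec (x - c))) - traceComp T innerCovec) := by
  rw [fderiv_fderiv_gaussian, map_smul (traceComp T), map_sub (traceComp T), map_smul (traceComp T),
    traceComp_smulRight, smul_eq_mul, smul_eq_mul]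

lemma exists_gaussian_strict_subsolution (hT : ContinuousAt T y)
    (hpos : 0 < innerCovec (y - c) (T y (innerCovec (y - c)))) (C : ℝ) :
    ∃ α > 0, ∀ᶠ x in 𝓝 y, C * ‖fderiv ℝ (gaussian α c) x‖ <
      traceComp (T x) (fderiv ℝ (fderiv ℝ (gaussian α c)) x) := by
  have hlarge : ∀ᶠ α : ℝ in atTop, traceComp (T y) innerCovec + C * ‖y - c‖ <
      2 * α * innerCovec (y - c) (T y (innerCovec (y - c))) :=
    ((tendsto_id.const_mul_atTop two_pos).atTop_mul_const hpos).eventually_gt_atTop _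
  obtain ⟨α, hα, hαpos⟩ := (hlarge.and (eventually_gt_atTop 0)).exists
  have hcovec : ContinuousAt (fun x : E => innerCovec (x - c)) y := by fun_prop
  have hleft : ContinuousAt (fun x => traceComp (T x) innerCovec + C * ‖x - c‖) y :=
    (continuousAt_traceComp hT _).add (by fun_prop)
  have hright : ContinuousAt
      (fun x => 2 * α * innerCovec (x - c) (T x (innerCovec (x - c)))) y :=
    continuousAt_const.mul (hcovec.clm_apply (hT.clm_apply hcovec))
  refine ⟨α, hαpos, ?_⟩
  filter_upwards [hleft.eventually_lt hright hα] with x hx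
  rw [norm_fderiv_gaussian hαpos, traceComp_fderiv_fderiv_gaussian, mul_left_comm]
  have := gaussian_pos α c x
  gcongr
  linarith

end GaussianBarrier

section HopfLemma

variable {E : Type*} [NormedAddCommGroup E] [InnerProductSpace ℝ E] {F B : Set E} {w : E → ℝ}
  {y ν : E}

lemma IsExteriorNormal.notMem_of_norm_sub_le (hν : IsExteriorNormal F y ν) {x : E} (hxy : x ≠ y)
    (hx : ‖x - (y + (1 / 2 : ℝ) • ν)‖ ≤ ‖y - (y + (1 / 2 : ℝ) • ν)‖) : x ∉ F := by
  intro hxF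
  have hclose := pow_le_pow_left₀ (norm_nonneg _) hx 2
  have hfar := pow_le_pow_left₀ (norm_nonneg _) (hν x hxF) 2
  have hd : 0 < ‖x - y‖ ^ 2 := pow_pos (norm_pos_iff.2 (sub_ne_zero.2 hxy)) 2
  rw [sub_add_cancel_left, norm_neg, ← sub_sub, norm_sub_sq_real, real_inner_smul_right] at hclose
  rw [add_sub_right_comm, ← neg_sub x y, neg_add_eq_sub, norm_sub_sq_real, real_inner_comm] at hfar
  linarith

variable [FiniteDimensional ℝ E] {T : E → (E →L[ℝ] ℝ) →L[ℝ] E}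

lemma traceComp_fderiv_fderiv_le_of_isLocalMin_sub {T : (E →L[ℝ] ℝ) →L[ℝ] E}
    (hT : ∀ η : E →L[ℝ] ℝ, 0 ≤ η (T η)) {φ : E → ℝ} {x : E} (h : IsLocalMin (w - φ) x)
    (hw : ContDiffAt ℝ 2 w x) (hφ : ContDiffAt ℝ 2 φ x) :
    traceComp T (fderiv ℝ (fderiv ℝ φ) x) ≤ traceComp T (fderiv ℝ (fderiv ℝ w) x) := by
  have hsub : ContDiffAt ℝ 2 (w - φ) x := hw.sub hφ
  rw [← sub_nonneg, ← map_sub, ← fderiv_fderiv_sub hw hφ]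
  exact traceComp_nonneg hT (hsub.isSymmSndFDerivAt (by simp))
    (fderiv_fderiv_apply_nonneg_of_isLocalMin h hsub)

/-- Hopf's lemma, in the form used by Bony: otherwise a Gaussian centred inside the exterior ball
would be a strict subsolution touching `w` from below. -/
lemma IsExteriorNormal.characteristic (hν : IsExteriorNormal F y ν) (hB : IsOpen B)
    (hw : ContDiffOn ℝ 2 w B) (hw0 : ∀ x ∈ B, 0 ≤ w x)
    (hT0 : ∀ x ∈ B, ∀ η : E →L[ℝ] ℝ, 0 ≤ η (T x η))
    (hT : ContinuousOn T B) {C : ℝ}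
    (hle : ∀ x ∈ B, traceComp (T x) (fderiv ℝ (fderiv ℝ w) x) ≤ C * ‖fderiv ℝ w x‖)
    (hF : ∀ x ∈ B, w x = 0 → x ∈ F) (hy : y ∈ B) (hwy : w y = 0) :
    innerCovec ν (T y (innerCovec ν)) = 0 := by
  by_contra hne
  set c := y + (1 / 2 : ℝ) • ν
  have hpos : 0 < innerCovec (y - c) (T y (innerCovec (y - c))) := by
    have := (hT0 y hy _).lt_of_ne' hne
    simp only [c, sub_add_cancel_left, map_neg, map_smul, neg_apply, smul_apply, smul_eq_mul]
    linarith
  obtain ⟨α, hα, hψ⟩ := exists_gaussian_strict_subsolution (hT.continuousAt (hB.mem_nhds hy)) hpos C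
  obtain ⟨ρ, hρ, hball⟩ := nhds_basis_closedBall.mem_iff.1 (inter_mem hψ (hB.mem_nhds hy))
  obtain ⟨ε, hε, x, hx, hmin⟩ := exists_isLocalMin_sub_smul (ψ := gaussian α c) hρ
    (hw.continuousOn.mono fun x hx => (hball hx).2) (contDiff_gaussian α c (n := 0)).continuous
    (fun x hx => hw0 x (hball hx).2) hwy fun x hx hxy => by
      have hxB := (hball (sphere_subset_closedBall hx)).2
      exact (hw0 x hxB).lt_of_ne' fun h => hν.notMem_of_norm_sub_le (ne_of_mem_sphere hx hρ.ne')
        ((gaussian_le_gaussian_iff hα).1 hxy) (hF x hxB h)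
  obtain ⟨hψx, hxB⟩ := hball (ball_subset_closedBall hx)
  have hwx : ContDiffAt ℝ 2 w x := hw.contDiffAt (hB.mem_nhds hxB)
  have hψC : ContDiff ℝ 2 (gaussian α c) := contDiff_gaussian α c
  have hderiv := fderiv_eq_of_isLocalMin_sub hmin (hwx.differentiableAt (by simp))
    ((hψC.differentiable (by simp) x).const_smul ε)
  have htrace := traceComp_fderiv_fderiv_le_of_isLocalMin_sub (hT0 x hxB) hmin hwx
    (hψC.contDiffAt.const_smul ε)
  rw [fderiv_const_smul_field] at hderiv
  rw [fderiv_const_smul_field, Pi.smul_def,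
    fderiv_fun_const_smul ((hψC.fderiv_right (m := 1) (by norm_num)).differentiable one_ne_zero x),
    map_smul, smul_eq_mul] at htrace
  have hnorm : ‖fderiv ℝ w x‖ = ε * ‖fderiv ℝ (gaussian α c) x‖ := by
    rw [hderiv, Pi.smul_apply, norm_smul, Real.norm_of_nonneg hε.le]
  have hstrict := mul_lt_mul_of_pos_left hψx hε
  have hle' := hle x hxB
  rw [hnorm] at hle'
  linarith

end HopfLemma

section Linearization

variable {E : Type*} [NormedAddCommGroup E] [NormedSpace ℝ E] {K : E × (E →L[ℝ] ℝ) → E}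
  {A : E → ℝ} {f : E → ℝ} {x : E}

/-- The quasilinear operator `f ↦ A⁻¹ div K(z, df)`, a divergence with respect to the volume form
of density `A`. -/
noncomputable def weightedDiv (A : E → ℝ) (K : E × (E →L[ℝ] ℝ) → E) (f : E → ℝ) (z : E) : ℝ :=
  (A z)⁻¹ * LinearMap.trace ℝ E (fderiv ℝ (fun z => K (z, fderiv ℝ f z)) z : E →L[ℝ] E)

/-- `weightedDiv A K f` at `z` as a function of the 2-jet `(z, df, d²f)`. -/
noncomputable def weightedDivJet (A : E → ℝ) (K : E × (E →L[ℝ] ℝ) → E)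
    (q : E × (E →L[ℝ] ℝ) × (E →L[ℝ] E →L[ℝ] ℝ)) : ℝ :=
  (A q.1)⁻¹ * LinearMap.trace ℝ E
    (fderiv ℝ K (q.1, q.2.1) ∘L (ContinuousLinearMap.id ℝ E).prod q.2.2 : E →L[ℝ] E)

/-- The principal symbol of `weightedDiv A K`: its derivative in the variable `d²f` is
`traceComp (weightedDivSymbol A K (z, df))`. -/
noncomputable def weightedDivSymbol (A : E → ℝ) (K : E × (E →L[ℝ] ℝ) → E)
    (q : E × (E →L[ℝ] ℝ)) : (E →L[ℝ] ℝ) →L[ℝ] E :=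
  (A q.1)⁻¹ • (fderiv ℝ K q ∘L ContinuousLinearMap.inr ℝ E (E →L[ℝ] ℝ))

lemma weightedDiv_eq_weightedDivJet (hf : ContDiffAt ℝ 2 f x)
    (hK : DifferentiableAt ℝ K (x, fderiv ℝ f x)) :
    weightedDiv A K f x = weightedDivJet A K (x, fderiv ℝ f x, fderiv ℝ (fderiv ℝ f) x) := by
  have hdf : DifferentiableAt ℝ (fderiv ℝ f) x :=
    (hf.fderiv_right (m := 1) (by norm_num)).differentiableAt one_ne_zero
  have hchain := hK.hasFDerivAt.comp (f := fun z => (z, fderiv ℝ f z)) x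
    ((hasFDerivAt_id x).prodMk hdf.hasFDerivAt)
  rw [weightedDiv, weightedDivJet, ← hchain.fderiv]
  rfl

lemma weightedDivJet_sub_weightedDivJet (z : E) (θ : E →L[ℝ] ℝ) (S T : E →L[ℝ] E →L[ℝ] ℝ) :
    weightedDivJet A K (z, θ, S) - weightedDivJet A K (z, θ, T) =
      traceComp (weightedDivSymbol A K (z, θ)) (S - T) := by
  have hcomp : (fderiv ℝ K (z, θ) ∘L ContinuousLinearMap.inr ℝ E (E →L[ℝ] ℝ)) ∘L (S - T) =
      fderiv ℝ K (z, θ) ∘L (ContinuousLinearMap.id ℝ E).prod S -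
        fderiv ℝ K (z, θ) ∘L (ContinuousLinearMap.id ℝ E).prod T := by
    ext v
    simp [← map_sub]
  rw [weightedDivJet, weightedDivJet, traceComp_apply, weightedDivSymbol,
    ContinuousLinearMap.smul_comp, hcomp]
  simp [mul_sub]

variable [FiniteDimensional ℝ E]

lemma contDiffAt_weightedDivJet {θ : E →L[ℝ] ℝ} (hA : ContDiffAt ℝ 1 A x) (hA0 : A x ≠ 0)
    (hK : ContDiffAt ℝ 2 K (x, θ)) (S : E →L[ℝ] E →L[ℝ] ℝ) :
    ContDiffAt ℝ 1 (weightedDivJet A K) (x, θ, S) := by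
  have hA' : ContDiffAt ℝ 1
      (fun q : E × (E →L[ℝ] ℝ) × (E →L[ℝ] E →L[ℝ] ℝ) => (A q.1)⁻¹) (x, θ, S) :=
    (hA.comp _ contDiffAt_fst).inv hA0
  have hK' : ContDiffAt ℝ 1 (fun q : E × (E →L[ℝ] ℝ) × (E →L[ℝ] E →L[ℝ] ℝ) =>
      fderiv ℝ K (q.1, q.2.1)) (x, θ, S) :=
    ContDiffAt.comp (g := fderiv ℝ K)
      (f := fun q : E × (E →L[ℝ] ℝ) × (E →L[ℝ] E →L[ℝ] ℝ) => (q.1, q.2.1)) _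
      (hK.fderiv_right (by norm_num)) (by fun_prop)
  have hprod : ContDiff ℝ 1 fun q : E × (E →L[ℝ] ℝ) × (E →L[ℝ] E →L[ℝ] ℝ) =>
      (ContinuousLinearMap.id ℝ E).prod q.2.2 := by
    have hsum : (fun q : E × (E →L[ℝ] ℝ) × (E →L[ℝ] E →L[ℝ] ℝ) =>
        (ContinuousLinearMap.id ℝ E).prod q.2.2) = fun q =>
        ContinuousLinearMap.inl ℝ E (E →L[ℝ] ℝ) +
          (ContinuousLinearMap.inr ℝ E (E →L[ℝ] ℝ)).comp q.2.2 := by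
      ext q v <;> simp
    rw [hsum]
    exact contDiff_const.add (contDiff_const.clm_comp (contDiff_snd.comp contDiff_snd))
  exact hA'.mul ((((LinearMap.trace ℝ E).comp
    (ContinuousLinearMap.coeLM ℝ)).toContinuousLinearMap.contDiff.contDiffAt).comp _
      (hK'.clm_comp hprod.contDiffAt))

/-- The 2-jets `(df, d²g)` and `(dg, d²g)` differ only in first order, so there the Lipschitz
bound on `weightedDivJet` costs a multiple of `‖df - dg‖`. -/
lemma exists_traceComp_sub_le_of_weightedDiv_le {g : E → ℝ} (hf : ContDiffAt ℝ 2 f x)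
    (hg : ContDiffAt ℝ 2 g x) (hfg : fderiv ℝ f x = fderiv ℝ g x)
    (hK : ContDiffAt ℝ 2 K (x, fderiv ℝ g x)) (hA : ContDiffAt ℝ 1 A x) (hA0 : A x ≠ 0)
    (hle : ∀ᶠ z in 𝓝 x, weightedDiv A K f z ≤ weightedDiv A K g z) :
    ∃ C, ∀ᶠ z in 𝓝 x, traceComp (weightedDivSymbol A K (z, fderiv ℝ f z))
      (fderiv ℝ (fderiv ℝ (f - g)) z) ≤ C * ‖fderiv ℝ (f - g) z‖ := by
  have hf1 : ContinuousAt (fderiv ℝ f) x :=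
    (hf.fderiv_right (m := 1) (by norm_num)).continuousAt
  have hg1 : ContDiffAt ℝ 1 (fderiv ℝ g) x := hg.fderiv_right (by norm_num)
  have hg2 : ContinuousAt (fderiv ℝ (fderiv ℝ g)) x :=
    (hg1.fderiv_right (m := 0) (by norm_num)).continuousAt
  obtain ⟨L, t, ht, hL⟩ :=
    (contDiffAt_weightedDivJet hA hA0 hK (fderiv ℝ (fderiv ℝ g) x)).exists_lipschitzOnWith
  have hft := (continuousAt_id.prodMk (hf1.prodMk hg2)).preimage_mem_nhds (by rwa [hfg])
  have hgt := (continuousAt_id.prodMk (hg1.continuousAt.prodMk hg2)).preimage_mem_nhds ht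
  have hKev := hK.eventually (by simp)
  have hKf := (continuousAt_id.prodMk hf1).eventually (by simpa only [id, hfg] using hKev)
  have hKg := (continuousAt_id.prodMk hg1.continuousAt).eventually hKev
  refine ⟨L, ?_⟩
  filter_upwards [hle, hft, hgt, hKf, hKg, hf.eventually (by simp), hg.eventually (by simp)]
    with z hz hfz hgz hKfz hKgz hf2 hg2
  rw [weightedDiv_eq_weightedDivJet hf2 (hKfz.differentiableAt two_ne_zero),
    weightedDiv_eq_weightedDivJet hg2 (hKgz.differentiableAt two_ne_zero)] at hz
  rw [fderiv_fderiv_sub hf2 hg2, ← weightedDivJet_sub_weightedDivJet,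
    fderiv_sub (hf2.differentiableAt two_ne_zero) (hg2.differentiableAt two_ne_zero)]
  have hdist : weightedDivJet A K (z, fderiv ℝ g z, fderiv ℝ (fderiv ℝ g) z) -
      weightedDivJet A K (z, fderiv ℝ f z, fderiv ℝ (fderiv ℝ g) z) ≤
        L * ‖fderiv ℝ f z - fderiv ℝ g z‖ := by
    refine (le_abs_self _).trans ?_
    have hL := hL.dist_le_mul _ hgz _ hfz
    rwa [Prod.dist_eq, Prod.dist_eq, dist_self, dist_self, max_eq_left dist_nonneg,
      max_eq_right dist_nonneg, dist_comm (fderiv ℝ g z), dist_eq_norm (fderiv ℝ f z)] at hL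
  linarith

end Linearization

section Flux

variable {E : Type*} [NormedAddCommGroup E] [NormedSpace ℝ E]

lemma sq_apply_le_apply_mul_apply {G : (E →L[ℝ] ℝ) →L[ℝ] E}
    (hs : ∀ θ η : E →L[ℝ] ℝ, θ (G η) = η (G θ)) (h0 : ∀ θ : E →L[ℝ] ℝ, 0 ≤ θ (G θ))
    (θ η : E →L[ℝ] ℝ) : θ (G η) ^ 2 ≤ θ (G θ) * η (G η) := by
  have h := discrim_le_zero (a := η (G η)) (b := 2 * θ (G η)) (c := θ (G θ)) fun t => by
    have := h0 (θ + t • η)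
    simp only [map_add, map_smul, add_apply, smul_apply, smul_eq_mul, hs η θ] at this
    linarith
  rw [discrim] at h
  linarith

/-- The flux `A |θ|^{p-1} G θ`, where `|θ|² = θ (G θ)`. -/
noncomputable def flux (A : E → ℝ) (G : E → (E →L[ℝ] ℝ) →L[ℝ] E) (p : ℝ)
    (q : E × (E →L[ℝ] ℝ)) : E :=
  (A q.1 * (√(q.2 (G q.1 q.2)) ^ (1 - p))⁻¹) • G q.1 q.2

variable {A : E → ℝ} {G : E → (E →L[ℝ] ℝ) →L[ℝ] E} {p : ℝ} {x : E} {θ : E →L[ℝ] ℝ}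

lemma contDiffAt_flux {n : WithTop ℕ∞} (hA : ContDiffAt ℝ n A x) (hG : ContDiffAt ℝ n G x)
    (hθ : 0 < θ (G x θ)) : ContDiffAt ℝ n (flux A G p) (x, θ) := by
  have hA' : ContDiffAt ℝ n (fun q : E × (E →L[ℝ] ℝ) => A q.1) (x, θ) :=
    hA.comp _ contDiffAt_fst
  have hG' : ContDiffAt ℝ n (fun q : E × (E →L[ℝ] ℝ) => G q.1 q.2) (x, θ) :=
    (hG.comp (x, θ) contDiffAt_fst).clm_apply contDiffAt_snd
  have hsqrt : 0 < √(θ (G x θ)) := Real.sqrt_pos.2 hθ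
  have hnorm := ((contDiffAt_snd.clm_apply hG').sqrt hθ.ne').rpow_const_of_ne
    (p := 1 - p) hsqrt.ne'
  exact (hA'.mul (hnorm.inv (Real.rpow_pos_of_pos hsqrt _).ne')).smul hG'

lemma contDiffAt_flux_fderiv {n : WithTop ℕ∞} {φ : E → ℝ} (hA : ContDiffAt ℝ n A x)
    (hG : ContDiffAt ℝ n G x) (hφ : ContDiffAt ℝ (n + 1) φ x)
    (hpos : 0 < fderiv ℝ φ x (G x (fderiv ℝ φ x))) :
    ContDiffAt ℝ n (fun z => flux A G p (z, fderiv ℝ φ z)) x :=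
  ContDiffAt.comp (g := flux A G p) (f := fun z => (z, fderiv ℝ φ z)) x
    (contDiffAt_flux hA hG hpos) (contDiffAt_id.prodMk (hφ.fderiv_right le_rfl))

lemma weightedDiv_flux_add_right {φ : E → ℝ} {a : E} (hA : ∀ᶠ z in 𝓝 x, A (z + a) = A z)
    (hG : ∀ᶠ z in 𝓝 x, G (z + a) = G z)
    (hφ : ∀ᶠ z in 𝓝 x, fderiv ℝ φ (z + a) = fderiv ℝ φ z) :
    weightedDiv A (flux A G p) φ (x + a) = weightedDiv A (flux A G p) φ x := by
  have hflux : (fun z => flux A G p (z + a, fderiv ℝ φ (z + a))) =ᶠ[𝓝 x]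
      fun z => flux A G p (z, fderiv ℝ φ z) := by
    filter_upwards [hA, hG, hφ] with z hAz hGz hφz
    simp only [flux, hAz, hGz, hφz]
  rw [weightedDiv, hA.self_of_nhds, ← fderiv_comp_add_right, hflux.fderiv_eq, weightedDiv]

/-- The scalar factor of `flux` along a line, where `|θ + t η|² = a + 2 b t + c t²`. -/
lemma hasDerivAt_inv_sqrt_rpow_quadratic {a : ℝ} (ha : 0 < a) (b c r : ℝ) :
    HasDerivAt (fun t : ℝ => (√(a + 2 * b * t + c * t ^ 2) ^ r)⁻¹) (-r * b / a * (√a ^ r)⁻¹) 0 := by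
  have hsqrt : 0 < √a := Real.sqrt_pos.2 ha
  have hquad : HasDerivAt (fun t : ℝ => a + 2 * b * t + c * t ^ 2) (2 * b) 0 := by
    refine ((((hasDerivAt_id (0 : ℝ)).const_mul (2 * b)).const_add a).add
      (((hasDerivAt_id (0 : ℝ)).pow 2).const_mul c)).congr_deriv ?_
    simp
  have h := ((hquad.sqrt (by simpa using ha.ne')).rpow_const (p := r)
    (Or.inl (by simpa using hsqrt.ne'))).inv (by simpa using (Real.rpow_pos_of_pos hsqrt r).ne')
  refine h.congr_deriv ?_
  simp only [mul_zero, add_zero, ne_eq, OfNat.ofNat_ne_zero, not_false_eq_true, zero_pow,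
    Real.rpow_sub_one hsqrt.ne']
  field_simp
  rw [Real.sq_sqrt ha.le]
  ring

lemma apply_weightedDivSymbol_flux (hA : ContDiffAt ℝ 1 A x) (hA0 : A x ≠ 0)
    (hG : ContDiffAt ℝ 1 G x) (hs : ∀ θ η : E →L[ℝ] ℝ, θ (G x η) = η (G x θ))
    (hθ : 0 < θ (G x θ)) (η : E →L[ℝ] ℝ) :
    η (weightedDivSymbol A (flux A G p) (x, θ) η) =
      (√(θ (G x θ)) ^ (1 - p))⁻¹ * (η (G x η) + (p - 1) * (θ (G x η) ^ 2 / θ (G x θ))) := by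
  have hfl : HasFDerivAt (flux A G p) (fderiv ℝ (flux A G p) (x, θ)) (x, θ + (0 : ℝ) • η) := by
    simpa using ((contDiffAt_flux (p := p) hA hG hθ).differentiableAt one_ne_zero).hasFDerivAt
  have hline : HasDerivAt (fun t : ℝ => (x, θ + t • η)) ((0 : E), η) 0 := by
    simpa using (hasDerivAt_const (0 : ℝ) x).prodMk
      (((hasDerivAt_id (0 : ℝ)).smul_const η).const_add θ)
  have hderiv : HasDerivAt (fun t : ℝ => η (flux A G p (x, θ + t • η)))
      (η (fderiv ℝ (flux A G p) (x, θ) (0, η))) 0 :=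
    η.hasFDerivAt.comp_hasDerivAt 0
      (hfl.comp_hasDerivAt (f := fun t : ℝ => (x, θ + t • η)) 0 hline)
  have hlin : HasDerivAt (fun t : ℝ => θ (G x η) + t * η (G x η)) (η (G x η)) 0 := by
    simpa using ((hasDerivAt_id (0 : ℝ)).mul_const (η (G x η))).const_add (θ (G x η))
  have hformula : (fun t : ℝ => η (flux A G p (x, θ + t • η))) = fun t : ℝ =>
      A x * (√(θ (G x θ) + 2 * θ (G x η) * t + η (G x η) * t ^ 2) ^ (1 - p))⁻¹ *
        (θ (G x η) + t * η (G x η)) := by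
    funext t
    have hquad : (θ + t • η) (G x (θ + t • η)) =
        θ (G x θ) + 2 * θ (G x η) * t + η (G x η) * t ^ 2 := by
      simp only [map_add, map_smul, add_apply, smul_apply, smul_eq_mul, hs η θ]
      ring
    rw [flux, hquad]
    simp only [map_add, map_smul, smul_eq_mul, hs η θ]
  rw [hformula] at hderiv
  have hval := hderiv.unique
    (((hasDerivAt_inv_sqrt_rpow_quadratic hθ _ _ (1 - p)).const_mul (A x)).mul hlin)
  simp only [weightedDivSymbol, smul_apply, ContinuousLinearMap.comp_apply,
    ContinuousLinearMap.inr_apply, map_smul, smul_eq_mul, hval, mul_zero, add_zero, zero_mul,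
    ne_eq, OfNat.ofNat_ne_zero, not_false_eq_true, zero_pow]
  field_simp
  ring

lemma apply_weightedDivSymbol_flux_nonneg (hp : 0 ≤ p) (hA : ContDiffAt ℝ 1 A x) (hA0 : A x ≠ 0)
    (hG : ContDiffAt ℝ 1 G x) (hs : ∀ θ η : E →L[ℝ] ℝ, θ (G x η) = η (G x θ))
    (h0 : ∀ θ : E →L[ℝ] ℝ, 0 ≤ θ (G x θ)) (hθ : 0 < θ (G x θ)) (η : E →L[ℝ] ℝ) :
    0 ≤ η (weightedDivSymbol A (flux A G p) (x, θ) η) := by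
  rw [apply_weightedDivSymbol_flux hA hA0 hG hs hθ]
  have hcs : θ (G x η) ^ 2 / θ (G x θ) ≤ η (G x η) := by
    rw [div_le_iff₀' hθ]
    exact sq_apply_le_apply_mul_apply hs h0 θ η
  have hsq : 0 ≤ θ (G x η) ^ 2 / θ (G x θ) := by positivity
  exact mul_nonneg (by positivity) (by nlinarith)

/-- At `p = 0` the covector `θ` is itself characteristic, whence the restriction on `ζ`. -/
lemma apply_eq_zero_of_apply_weightedDivSymbol_flux_eq_zero (hp : 0 ≤ p) (hA : ContDiffAt ℝ 1 A x)
    (hA0 : A x ≠ 0) (hG : ContDiffAt ℝ 1 G x)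
    (hs : ∀ θ η : E →L[ℝ] ℝ, θ (G x η) = η (G x θ)) (h0 : ∀ θ : E →L[ℝ] ℝ, 0 ≤ θ (G x θ))
    (hθ : 0 < θ (G x θ)) {η ζ : E →L[ℝ] ℝ}
    (hη : η (weightedDivSymbol A (flux A G p) (x, θ) η) = 0) (hζ : ζ (G x θ) = 0) :
    η (G x ζ) = 0 := by
  rw [apply_weightedDivSymbol_flux hA hA0 hG hs hθ, mul_eq_zero,
    or_iff_right (inv_pos.2 (Real.rpow_pos_of_pos (Real.sqrt_pos.2 hθ) _)).ne'] at hη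
  set η' := η - (θ (G x η) / θ (G x θ)) • θ with hη'
  have hproj : η' (G x η') = η (G x η) - θ (G x η) ^ 2 / θ (G x θ) := by
    simp only [hη', map_sub, map_smul, sub_apply, smul_apply, smul_eq_mul, hs η θ]
    field_simp
    ring
  have hsq : 0 ≤ θ (G x η) ^ 2 / θ (G x θ) := by positivity
  have hzero : η' (G x η') = 0 := le_antisymm (by rw [hproj]; nlinarith) (h0 _)
  have hcs : ζ (G x η') ^ 2 ≤ 0 := by
    simpa [hzero] using sq_apply_le_apply_mul_apply hs h0 ζ η'
  have hζη' : ζ (G x η') = 0 := pow_eq_zero_iff two_ne_zero |>.1 (hcs.antisymm (sq_nonneg _))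
  rw [hs, ← hζη', hη', map_sub, map_smul, map_sub, map_smul, hζ, smul_zero, sub_zero]

end Flux

section Coordinates

variable {m : ℕ} {M : Type*} [TopologicalSpace M] [ChartedSpace (Coord (m + 1)) M]

/-- The differential of the coordinates `e`. -/
noncomputable def coordDeriv (e : OpenPartialHomeomorph M (Coord (m + 1))) (q : M) :
    Tan m q →L[ℝ] Coord (m + 1) :=
  mfderiv (𝓡 (m + 1)) (𝓡 (m + 1)) e q

/-- The differential of the parametrization `e.symm`. -/
noncomputable def coordInv (e : OpenPartialHomeomorph M (Coord (m + 1))) (z : Coord (m + 1)) :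
    Coord (m + 1) →L[ℝ] Tan m (e.symm z) :=
  mfderiv (𝓡 (m + 1)) (𝓡 (m + 1)) e.symm z

/-- The inner product `⟨·,·⟩*` in the coordinates `e`, encoded as the map `G` from covectors to
vectors, with matrix `g^{ij} = ⟨dxⁱ, dxʲ⟩*`. -/
noncomputable def coordMetric (g : CoMetric m M) (e : OpenPartialHomeomorph M (Coord (m + 1)))
    (z : Coord (m + 1)) : (Coord (m + 1) →L[ℝ] ℝ) →L[ℝ] Coord (m + 1) :=
  ∑ i : Fin (m + 1), ∑ j : Fin (m + 1),
    g.form (e.symm z) (dAt m (fun q => e q i) (e.symm z)) (dAt m (fun q => e q j) (e.symm z)) •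
      (ContinuousLinearMap.apply ℝ ℝ (EuclideanSpace.single j (1 : ℝ) : Coord (m + 1))).smulRight
        (EuclideanSpace.single i (1 : ℝ) : Coord (m + 1))

/-- The density of the volume form in the coordinates `e`. -/
noncomputable def coordDensity [IsManifold (𝓡 (m + 1)) ∞ M] (dv : VolumeForm m M)
    (e : OpenPartialHomeomorph M (Coord (m + 1))) (z : Coord (m + 1)) : ℝ :=
  dv.form (e.symm z) (fun i => coordInv e z (EuclideanSpace.single i (1 : ℝ)))

variable {e : OpenPartialHomeomorph M (Coord (m + 1))}

lemma mdifferentiable_of_mem_maximalAtlas (he : e ∈ IsManifold.maximalAtlas (𝓡 (m + 1)) ∞ M) :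
    e.MDifferentiable (𝓡 (m + 1)) (𝓡 (m + 1)) :=
  ⟨(contMDiffOn_of_mem_maximalAtlas he).mdifferentiableOn (by simp),
    (contMDiffOn_symm_of_mem_maximalAtlas he).mdifferentiableOn (by simp)⟩

lemma coordDeriv_coordInv (he : e ∈ IsManifold.maximalAtlas (𝓡 (m + 1)) ∞ M) {z : Coord (m + 1)}
    (hz : z ∈ e.target) (v : Coord (m + 1)) : coordDeriv e (e.symm z) (coordInv e z v) = v := by
  have h := (mdifferentiable_of_mem_maximalAtlas he).comp_symm_deriv hz
  exact congrArg (fun L : Coord (m + 1) →L[ℝ] Coord (m + 1) => L v) h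

lemma coordInv_coordDeriv (he : e ∈ IsManifold.maximalAtlas (𝓡 (m + 1)) ∞ M) {z : Coord (m + 1)}
    (hz : z ∈ e.target) (v : Tan m (e.symm z)) :
    coordInv e z (coordDeriv e (e.symm z) v) = v := by
  have h := (mdifferentiable_of_mem_maximalAtlas he).symm_comp_deriv (e.map_target hz)
  rw [e.right_inv hz] at h
  exact congrArg (fun L : Coord (m + 1) →L[ℝ] Coord (m + 1) => L v) h

lemma dAt_coord (he : e ∈ IsManifold.maximalAtlas (𝓡 (m + 1)) ∞ M) {q : M} (hq : q ∈ e.source)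
    (i : Fin (m + 1)) : dAt m (fun q => e q i) q =
      (EuclideanSpace.proj i : Coord (m + 1) →L[ℝ] ℝ) ∘L coordDeriv e q := by
  have h1 := ((mdifferentiable_of_mem_maximalAtlas he).mdifferentiableAt hq).hasMFDerivAt
  have h2 : HasMFDerivAt 𝓘(ℝ, Coord (m + 1)) 𝓘(ℝ, ℝ)
      (EuclideanSpace.proj i : Coord (m + 1) →L[ℝ] ℝ) (e q) (EuclideanSpace.proj i) :=
    (EuclideanSpace.proj i : Coord (m + 1) →L[ℝ] ℝ).hasFDerivAt.hasMFDerivAt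
  exact (h2.comp q h1).mfderiv

lemma dAt_symm_eq (he : e ∈ IsManifold.maximalAtlas (𝓡 (m + 1)) ∞ M) {z : Coord (m + 1)}
    (hz : z ∈ e.target) {φ : M → ℝ}
    (hφ : MDifferentiableAt (𝓡 (m + 1)) 𝓘(ℝ, ℝ) φ (e.symm z)) :
    dAt m φ (e.symm z) = (fderiv ℝ (fun z => φ (e.symm z)) z : Coord (m + 1) →L[ℝ] ℝ) ∘L
      coordDeriv e (e.symm z) := by
  have h1 := ((mdifferentiable_of_mem_maximalAtlas he).mdifferentiableAt_symm hz).hasMFDerivAt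
  have h2 : HasFDerivAt (fun z => φ (e.symm z))
      ((dAt m φ (e.symm z)) ∘L coordInv e z : Coord (m + 1) →L[ℝ] ℝ) z :=
    (hφ.hasMFDerivAt.comp z h1).hasFDerivAt
  rw [h2.fderiv]
  ext v
  exact congrArg (dAt m φ (e.symm z)) (coordInv_coordDeriv he hz v).symm

lemma apply_coordMetric (he : e ∈ IsManifold.maximalAtlas (𝓡 (m + 1)) ∞ M) (g : CoMetric m M)
    {z : Coord (m + 1)} (hz : z ∈ e.target) (θ η : Coord (m + 1) →L[ℝ] ℝ) :
    θ (coordMetric g e z η) = g.form (e.symm z) (θ ∘L coordDeriv e (e.symm z))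
      (η ∘L coordDeriv e (e.symm z)) := by
  have key : ∀ L : Coord (m + 1) →L[ℝ] ℝ, (L ∘L coordDeriv e (e.symm z) : Cotan m (e.symm z)) =
      ∑ i : Fin (m + 1), L (EuclideanSpace.single i (1 : ℝ)) •
        dAt m (fun q => e q i) (e.symm z) := by
    intro L
    have hL : L = ∑ i : Fin (m + 1), L (EuclideanSpace.single i (1 : ℝ)) •
        (EuclideanSpace.proj i : Coord (m + 1) →L[ℝ] ℝ) := covec_eq_sum (M := Coord (m + 1)) 0 L
    conv_lhs => rw [hL]
    ext v
    simp [dAt_coord he (e.map_target hz)]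
  rw [key θ, key η]
  simp only [coordMetric, map_sum, map_smul, LinearMap.sum_apply, LinearMap.smul_apply,
    sum_apply, smul_apply, ContinuousLinearMap.smulRight_apply,
    ContinuousLinearMap.apply_apply, smul_eq_mul]
  rw [Finset.sum_comm]
  refine Finset.sum_congr rfl fun j _ => ?_
  rw [Finset.mul_sum]
  refine Finset.sum_congr rfl fun i _ => ?_
  ring

lemma coordDeriv_sharp (he : e ∈ IsManifold.maximalAtlas (𝓡 (m + 1)) ∞ M) (g : CoMetric m M)
    {z : Coord (m + 1)} (hz : z ∈ e.target) (η : Coord (m + 1) →L[ℝ] ℝ) :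
    coordDeriv e (e.symm z) (g.sharp (e.symm z) (η ∘L coordDeriv e (e.symm z))) =
      coordMetric g e z η := by
  ext i
  have h := apply_coordMetric he g hz (EuclideanSpace.proj i) η
  rw [← g.apply_sharp] at h
  exact h.symm

lemma coordMetric_symm (he : e ∈ IsManifold.maximalAtlas (𝓡 (m + 1)) ∞ M) (g : CoMetric m M)
    {z : Coord (m + 1)} (hz : z ∈ e.target) (θ η : Coord (m + 1) →L[ℝ] ℝ) :
    θ (coordMetric g e z η) = η (coordMetric g e z θ) := by
  rw [apply_coordMetric he g hz, apply_coordMetric he g hz, g.symm]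

lemma coordMetric_nonneg (he : e ∈ IsManifold.maximalAtlas (𝓡 (m + 1)) ∞ M) (g : CoMetric m M)
    {z : Coord (m + 1)} (hz : z ∈ e.target) (θ : Coord (m + 1) →L[ℝ] ℝ) :
    0 ≤ θ (coordMetric g e z θ) := by
  rw [apply_coordMetric he g hz]
  exact g.nonneg _ _

lemma smoothFnOn_coord (he : e ∈ IsManifold.maximalAtlas (𝓡 (m + 1)) ∞ M) (i : Fin (m + 1)) :
    SmoothFnOn m (fun q => e q i) e.source :=
  (EuclideanSpace.proj i : Coord (m + 1) →L[ℝ] ℝ).contDiff.contMDiff.comp_contMDiffOn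
    (contMDiffOn_of_mem_maximalAtlas he)

lemma SmoothFnOn.contDiffOn_comp_symm (he : e ∈ IsManifold.maximalAtlas (𝓡 (m + 1)) ∞ M)
    {f : M → ℝ} {W : Set M} (hf : SmoothFnOn m f W) :
    ContDiffOn ℝ ∞ (fun z => f (e.symm z)) (e.target ∩ e.symm ⁻¹' W) := by
  rw [← contMDiffOn_iff_contDiffOn]
  exact ContMDiffOn.comp hf ((contMDiffOn_symm_of_mem_maximalAtlas he).mono
    Set.inter_subset_left) (fun z hz => hz.2)

lemma contDiffOn_coordMetric (he : e ∈ IsManifold.maximalAtlas (𝓡 (m + 1)) ∞ M)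
    (g : CoMetric m M) : ContDiffOn ℝ ∞ (coordMetric g e) e.target := by
  have hcoeff (i j : Fin (m + 1)) : ContDiffOn ℝ ∞ (fun z => g.form (e.symm z)
      (dAt m (fun q => e q i) (e.symm z)) (dAt m (fun q => e q j) (e.symm z))) e.target :=
    ((g.smooth e.source e.open_source _ _ (smoothFnOn_coord he i)
      (smoothFnOn_coord he j)).contDiffOn_comp_symm he).mono fun z hz => ⟨hz, e.map_target hz⟩
  refine contDiffOn_clm_apply.2 fun η => ?_
  simp only [coordMetric, sum_apply, smul_apply]
  exact ContDiffOn.sum fun i _ => ContDiffOn.sum fun j _ => (hcoeff i j).smul contDiffOn_const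

end Coordinates

section Fields

open VectorField

variable {m : ℕ} {M : Type*} [TopologicalSpace M] [ChartedSpace (Coord (m + 1)) M]
  {e : OpenPartialHomeomorph M (Coord (m + 1))}

/-- The coordinate expression of a vector field, a vector field on `e.target`. -/
noncomputable def coordField (e : OpenPartialHomeomorph M (Coord (m + 1))) (Z : ∀ x : M, Tan m x)
    (z : Coord (m + 1)) : Coord (m + 1) :=
  coordDeriv e (e.symm z) (Z (e.symm z))

/-- The vector field on `e.source` with the coordinate expression `Y`. -/
noncomputable def fieldOfCoord (e : OpenPartialHomeomorph M (Coord (m + 1)))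
    (Y : Coord (m + 1) → Coord (m + 1)) (q : M) : Tan m q :=
  mpullback (𝓡 (m + 1)) (𝓡 (m + 1)) e Y q

lemma inverse_coordDeriv (he : e ∈ IsManifold.maximalAtlas (𝓡 (m + 1)) ∞ M)
    {z : Coord (m + 1)} (hz : z ∈ e.target) : (coordDeriv e (e.symm z)).inverse = coordInv e z :=
  ContinuousLinearMap.inverse_eq (by ext1 v; exact coordDeriv_coordInv he hz v)
    (by ext1 v; exact coordInv_coordDeriv he hz v)

lemma inverse_coordInv (he : e ∈ IsManifold.maximalAtlas (𝓡 (m + 1)) ∞ M)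
    {z : Coord (m + 1)} (hz : z ∈ e.target) : (coordInv e z).inverse = coordDeriv e (e.symm z) :=
  ContinuousLinearMap.inverse_eq (by ext1 v; exact coordInv_coordDeriv he hz v)
    (by ext1 v; exact coordDeriv_coordInv he hz v)

lemma isInvertible_coordDeriv (he : e ∈ IsManifold.maximalAtlas (𝓡 (m + 1)) ∞ M)
    {z : Coord (m + 1)} (hz : z ∈ e.target) : (coordDeriv e (e.symm z)).IsInvertible :=
  ContinuousLinearMap.IsInvertible.of_inverse (by ext1 v; exact coordDeriv_coordInv he hz v)
    (by ext1 v; exact coordInv_coordDeriv he hz v)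

lemma isInvertible_coordInv (he : e ∈ IsManifold.maximalAtlas (𝓡 (m + 1)) ∞ M)
    {z : Coord (m + 1)} (hz : z ∈ e.target) : (coordInv e z).IsInvertible :=
  ContinuousLinearMap.IsInvertible.of_inverse (by ext1 v; exact coordInv_coordDeriv he hz v)
    (by ext1 v; exact coordDeriv_coordInv he hz v)

lemma fieldOfCoord_symm (he : e ∈ IsManifold.maximalAtlas (𝓡 (m + 1)) ∞ M)
    (Y : Coord (m + 1) → Coord (m + 1)) {z : Coord (m + 1)} (hz : z ∈ e.target) :
    fieldOfCoord e Y (e.symm z) = coordInv e z (Y z) := by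
  change (coordDeriv e (e.symm z)).inverse (Y (e (e.symm z))) = _
  rw [inverse_coordDeriv he hz, e.right_inv hz]

lemma coordField_fieldOfCoord (he : e ∈ IsManifold.maximalAtlas (𝓡 (m + 1)) ∞ M)
    (Y : Coord (m + 1) → Coord (m + 1)) {z : Coord (m + 1)} (hz : z ∈ e.target) :
    coordField e (fieldOfCoord e Y) z = Y z := by
  rw [coordField, fieldOfCoord_symm he Y hz, coordDeriv_coordInv he hz]

lemma mpullback_symm_eq (he : e ∈ IsManifold.maximalAtlas (𝓡 (m + 1)) ∞ M)
    (Z : ∀ x : M, Tan m x) {z : Coord (m + 1)} (hz : z ∈ e.target) :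
    mpullback (𝓡 (m + 1)) (𝓡 (m + 1)) e.symm Z z = coordField e Z z := by
  change (coordInv e z).inverse (Z (e.symm z)) = _
  rw [inverse_coordInv he hz, coordField]

variable [IsManifold (𝓡 (m + 1)) ∞ M]

lemma smoothFieldOn_fieldOfCoord (he : e ∈ IsManifold.maximalAtlas (𝓡 (m + 1)) ∞ M)
    {Y : Coord (m + 1) → Coord (m + 1)} {N : Set (Coord (m + 1))} (hN : IsOpen N)
    (hY : ContDiffOn ℝ ∞ Y N) {W : Set M} (hW : W ⊆ e.source) (hWN : ∀ q ∈ W, e q ∈ N) :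
    SmoothFieldOn (fieldOfCoord e Y) W := by
  intro q hq
  refine ContMDiffAt.contMDiffWithinAt ?_
  refine ContMDiffAt.mpullback_vectorField_preimage (n := ∞) ?_
    (contMDiffAt_of_mem_maximalAtlas he (hW hq)) ?_ (by norm_cast)
  · exact contMDiffAt_vectorSpace_iff_contDiffAt.2 (hY.contDiffAt (hN.mem_nhds (hWN q hq)))
  · have h := isInvertible_coordDeriv he (e.map_source (hW hq))
    rw [e.left_inv (hW hq)] at h
    exact h

lemma SmoothFieldOn.contDiffOn_coordField (he : e ∈ IsManifold.maximalAtlas (𝓡 (m + 1)) ∞ M)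
    {Z : ∀ x : M, Tan m x} {W : Set M} (hW : IsOpen W) (hZ : SmoothFieldOn Z W) :
    ContDiffOn ℝ ∞ (coordField e Z) (e.target ∩ e.symm ⁻¹' W) := by
  intro z hz
  refine ContDiffAt.contDiffWithinAt ?_
  have h1 : ContMDiffAt (𝓡 (m + 1)) (𝓡 (m + 1)).tangent ∞
      (fun x => (⟨x, Z x⟩ : TangentBundle (𝓡 (m + 1)) M)) (e.symm z) :=
    hZ.contMDiffAt (hW.mem_nhds hz.2)
  have h2 := ContMDiffAt.mpullback_vectorField_preimage (n := ∞) h1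
    (contMDiffAt_symm_of_mem_maximalAtlas he hz.1) (isInvertible_coordInv he hz.1) (by norm_cast)
  refine (contMDiffAt_vectorSpace_iff_contDiffAt.1 h2).congr_of_eventuallyEq ?_
  filter_upwards [e.open_target.mem_nhds hz.1] with y hy
  exact (mpullback_symm_eq he Z hy).symm

lemma coordField_mlieBracket (he : e ∈ IsManifold.maximalAtlas (𝓡 (m + 1)) ∞ M)
    {Y Z : ∀ x : M, Tan m x} {W : Set M} (hW : IsOpen W) (hY : SmoothFieldOn Y W)
    (hZ : SmoothFieldOn Z W) {z : Coord (m + 1)} (hz : z ∈ e.target) (hzW : e.symm z ∈ W) :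
    coordField e (mlieBracket (𝓡 (m + 1)) Y Z) z =
      lieBracket ℝ (coordField e Y) (coordField e Z) z := by
  have hev (V : ∀ x : M, Tan m x) :
      mpullback (𝓡 (m + 1)) (𝓡 (m + 1)) e.symm V =ᶠ[𝓝 z] coordField e V := by
    filter_upwards [e.open_target.mem_nhds hz] with y hy
    exact mpullback_symm_eq he V hy
  have hman : IsManifold (𝓡 (m + 1)) (minSmoothness ℝ 2) M := by
    rw [minSmoothness_of_isRCLikeNormedField]; infer_instance
  have hman' : IsManifold (𝓡 (m + 1)) (minSmoothness ℝ 2) (Coord (m + 1)) := by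
    rw [minSmoothness_of_isRCLikeNormedField]; infer_instance
  have h := mpullback_mlieBracket (I := 𝓡 (m + 1)) (I' := 𝓡 (m + 1)) (n := ∞) (f := e.symm)
    (V := Y) (W := Z) (x₀ := z)
    ((hY.contMDiffAt (hW.mem_nhds hzW)).mdifferentiableAt (by simp))
    ((hZ.contMDiffAt (hW.mem_nhds hzW)).mdifferentiableAt (by simp))
    (contMDiffAt_symm_of_mem_maximalAtlas he hz)
    (by rw [minSmoothness_of_isRCLikeNormedField]; exact WithTop.coe_le_coe.2 le_top)
  rw [← mpullback_symm_eq he _ hz, h, ← mlieBracketWithin_univ,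
    mlieBracketWithin_eq_lieBracketWithin]
  exact (congrFun (lieBracketWithin_univ (𝕜 := ℝ) (E := Coord (m + 1))) z).trans
    ((hev Y).lieBracket_vectorField_eq (hev Z))

lemma SmoothFieldOn.mlieBracket {Y Z : ∀ x : M, Tan m x} {W : Set M} (hW : IsOpen W)
    (hY : SmoothFieldOn Y W) (hZ : SmoothFieldOn Z W) :
    SmoothFieldOn (mlieBracket (𝓡 (m + 1)) Y Z) W := by
  intro q hq
  have hman : IsManifold (𝓡 (m + 1)) (minSmoothness ℝ 2) M := by
    rw [minSmoothness_of_isRCLikeNormedField]; infer_instance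
  have hman' : IsManifold (𝓡 (m + 1)) (((⊤ : ℕ∞) : ℕ∞ω) + 1) M :=
    inferInstanceAs (IsManifold (𝓡 (m + 1)) ∞ M)
  exact (ContMDiffAt.mlieBracket_vectorField (m := ⊤) (n := ⊤) (hY.contMDiffAt (hW.mem_nhds hq))
    (hZ.contMDiffAt (hW.mem_nhds hq))
    (by rw [minSmoothness_of_isRCLikeNormedField]; norm_cast)).contMDiffWithinAt

lemma contDiffOn_coordDensity (he : e ∈ IsManifold.maximalAtlas (𝓡 (m + 1)) ∞ M)
    (dv : VolumeForm m M) : ContDiffOn ℝ ∞ (coordDensity dv e) e.target := by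
  have h := (dv.smooth e.source e.open_source
    (fun i => fieldOfCoord e (fun _ => EuclideanSpace.single i (1 : ℝ)))
    (fun i => smoothFieldOn_fieldOfCoord he isOpen_univ contDiffOn_const subset_rfl
      (fun _ _ => mem_univ _))).contDiffOn_comp_symm he
  refine (h.mono fun z hz => ⟨hz, e.map_target hz⟩).congr fun z hz => ?_
  refine congrArg (dv.form (e.symm z)) (funext fun i => ?_)
  exact (fieldOfCoord_symm he (fun _ => EuclideanSpace.single i (1 : ℝ)) hz).symm

end Fields

section Curvature

variable {m n : ℕ} {M : Type*} [TopologicalSpace M] [ChartedSpace (Coord (m + 1)) M]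
  {e c : OpenPartialHomeomorph M (Coord (m + 1))}

lemma topForm_ext {D D' : Coord n [⋀^Fin n]→L[ℝ] ℝ}
    (h : D (fun i => EuclideanSpace.single i (1 : ℝ)) =
      D' fun i => EuclideanSpace.single i (1 : ℝ)) : D = D' := by
  have hbasis : ⇑(EuclideanSpace.basisFun (Fin n) ℝ).toBasis =
      fun i => EuclideanSpace.single i (1 : ℝ) := by
    ext1 i
    simp
  refine ContinuousAlternatingMap.toAlternatingMap_injective ?_
  rw [D.toAlternatingMap.eq_smul_basis_det (EuclideanSpace.basisFun (Fin n) ℝ).toBasis,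
    D'.toAlternatingMap.eq_smul_basis_det (EuclideanSpace.basisFun (Fin n) ℝ).toBasis, hbasis]
  exact congrArg (· • _) h

/-- Cartan's formula `d (ι_V D) = (div V) D` for a constant top degree form `D`. -/
lemma extDeriv_curryLeft (D : Coord (m + 1) [⋀^Fin (m + 1)]→L[ℝ] ℝ)
    {V : Coord (m + 1) → Coord (m + 1)} {z : Coord (m + 1)} (hV : DifferentiableAt ℝ V z) :
    extDeriv (fun z => D.curryLeft (V z)) z =
      LinearMap.trace ℝ (Coord (m + 1)) (fderiv ℝ V z : Coord (m + 1) →L[ℝ] Coord (m + 1)) • D := by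
  refine topForm_ext ?_
  have hcurry : fderiv ℝ (fun z => D.curryLeft (V z)) z = D.curryLeft ∘L fderiv ℝ V z :=
    (D.curryLeft.hasFDerivAt.comp z hV.hasFDerivAt).fderiv
  rw [extDeriv, hcurry, ContinuousAlternatingMap.alternatizeUncurryFin_apply,
    ContinuousAlternatingMap.smul_apply, smul_eq_mul,
    LinearMap.trace_eq_sum_inner _ (EuclideanSpace.basisFun (Fin (m + 1)) ℝ), Finset.sum_mul]
  refine Finset.sum_congr rfl fun i _ => ?_
  have hwedge := wedge_contract_aux m (EuclideanSpace.proj i) D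
    (fderiv ℝ V z (EuclideanSpace.single i (1 : ℝ))) fun i => EuclideanSpace.single i (1 : ℝ)
  rw [Finset.sum_eq_single i (fun k _ hk => by simp [hk.symm]) (by simp)] at hwedge
  have hdiag : inner ℝ (EuclideanSpace.basisFun (Fin (m + 1)) ℝ i)
      ((fderiv ℝ V z : Coord (m + 1) →ₗ[ℝ] Coord (m + 1))
        (EuclideanSpace.basisFun (Fin (m + 1)) ℝ i)) =
      EuclideanSpace.proj i (fderiv ℝ V z (EuclideanSpace.single i (1 : ℝ))) := by
    simp [EuclideanSpace.inner_single_left]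
  rw [hdiag, ← hwedge]
  simp [Matrix.vecCons]

/-- The pull-back of a form on `M` under the parametrization `e.symm`. -/
noncomputable def coordForm (e : OpenPartialHomeomorph M (Coord (m + 1)))
    (α : ∀ y : M, Alt m n y) (z : Coord (m + 1)) : Coord (m + 1) [⋀^Fin n]→L[ℝ] ℝ :=
  (α (e.symm z)).compContinuousLinearMap (coordInv e z)

lemma coordForm_coordDeriv (he : e ∈ IsManifold.maximalAtlas (𝓡 (m + 1)) ∞ M)
    (α : ∀ y : M, Alt m n y) {q : M} (hq : q ∈ e.source) (w : Fin n → Tan m q) :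
    coordForm e α (e q) (fun i => coordDeriv e q (w i)) = α q w := by
  obtain ⟨z, hz, rfl⟩ : ∃ z ∈ e.target, e.symm z = q := ⟨e q, e.map_source hq, e.left_inv hq⟩
  rw [e.right_inv hz]
  exact congrArg (α (e.symm z)) (funext fun i => coordInv_coordDeriv he hz (w i))

lemma hasFDerivAt_transition (he : e ∈ IsManifold.maximalAtlas (𝓡 (m + 1)) ∞ M)
    (hc : c ∈ IsManifold.maximalAtlas (𝓡 (m + 1)) ∞ M) {z : Coord (m + 1)} (hz : z ∈ c.target)
    (hze : c.symm z ∈ e.source) :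
    HasFDerivAt (fun z => e (c.symm z))
      (coordDeriv e (c.symm z) ∘L coordInv c z : Coord (m + 1) →L[ℝ] Coord (m + 1)) z :=
  (((mdifferentiable_of_mem_maximalAtlas he).mdifferentiableAt hze).hasMFDerivAt.comp z
    ((mdifferentiable_of_mem_maximalAtlas hc).mdifferentiableAt_symm hz).hasMFDerivAt).hasFDerivAt

lemma fderiv_transition_coordDeriv (he : e ∈ IsManifold.maximalAtlas (𝓡 (m + 1)) ∞ M)
    (hc : c ∈ IsManifold.maximalAtlas (𝓡 (m + 1)) ∞ M) {q : M} (hqc : q ∈ c.source)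
    (hqe : q ∈ e.source) (v : Tan m q) :
    fderiv ℝ (fun z => e (c.symm z)) (c q) (coordDeriv c q v) = coordDeriv e q v := by
  obtain ⟨z, hz, rfl⟩ : ∃ z ∈ c.target, c.symm z = q := ⟨c q, c.map_source hqc, c.left_inv hqc⟩
  rw [c.right_inv hz, (hasFDerivAt_transition he hc hz hqe).fderiv]
  exact congrArg (coordDeriv e (c.symm z)) (coordInv_coordDeriv hc hz v)

lemma contDiffAt_transition (he : e ∈ IsManifold.maximalAtlas (𝓡 (m + 1)) ∞ M)
    (hc : c ∈ IsManifold.maximalAtlas (𝓡 (m + 1)) ∞ M) {z : Coord (m + 1)} (hz : z ∈ c.target)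
    (hze : c.symm z ∈ e.source) : ContDiffAt ℝ ∞ (fun z => e (c.symm z)) z :=
  contMDiffAt_iff_contDiffAt.1 (ContMDiffAt.comp (I' := 𝓡 (m + 1)) z
    (contMDiffAt_of_mem_maximalAtlas he hze) (contMDiffAt_symm_of_mem_maximalAtlas hc hz))

lemma coordForm_eq_pullback_transition (he : e ∈ IsManifold.maximalAtlas (𝓡 (m + 1)) ∞ M)
    (hc : c ∈ IsManifold.maximalAtlas (𝓡 (m + 1)) ∞ M) (α : ∀ y : M, Alt m n y)
    {z : Coord (m + 1)} (hz : z ∈ c.target) (hze : c.symm z ∈ e.source) :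
    coordForm c α z = (coordForm e α (e (c.symm z))).compContinuousLinearMap
      (fderiv ℝ (fun z => e (c.symm z)) z) := by
  ext w
  rw [(hasFDerivAt_transition he hc hz hze).fderiv]
  exact (coordForm_coordDeriv he α hze fun i => coordInv c z (w i)).symm

lemma mdifferentiableAt_of_comp_symm (he : e ∈ IsManifold.maximalAtlas (𝓡 (m + 1)) ∞ M)
    {φ : M → ℝ} {z : Coord (m + 1)} (hz : z ∈ e.target)
    (hφ : DifferentiableAt ℝ (fun z => φ (e.symm z)) z) :
    MDifferentiableAt (𝓡 (m + 1)) 𝓘(ℝ, ℝ) φ (e.symm z) := by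
  have hcoord := (mdifferentiable_of_mem_maximalAtlas he).mdifferentiableAt (e.map_target hz)
  have hφ' : MDifferentiableAt 𝓘(ℝ, Coord (m + 1)) 𝓘(ℝ, ℝ) (fun z => φ (e.symm z))
      (e (e.symm z)) := by
    rw [e.right_inv hz]
    exact hφ.mdifferentiableAt
  refine (hφ'.comp (e.symm z) hcoord).congr_of_eventuallyEq ?_
  filter_upwards [e.open_source.mem_nhds (e.map_target hz)] with q hq
  simp [e.left_inv hq]

variable [IsManifold (𝓡 (m + 1)) ∞ M]

lemma extDerivM_eq (he : e ∈ IsManifold.maximalAtlas (𝓡 (m + 1)) ∞ M) (α : ∀ y : M, Alt m n y)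
    {q : M} (hq : q ∈ e.source) (hα : DifferentiableAt ℝ (coordForm e α) (e q))
    (w : Fin (n + 1) → Tan m q) :
    extDerivM α q w = extDeriv (coordForm e α) (e q) (fun i => coordDeriv e q (w i)) := by
  set c := chartAt (Coord (m + 1)) q
  have hc : c ∈ IsManifold.maximalAtlas (𝓡 (m + 1)) ∞ M := IsManifold.chart_mem_maximalAtlas q
  have hqc : q ∈ c.source := mem_chart_source _ q
  have hcq : c q ∈ c.target := c.map_source hqc
  have hqe : c.symm (c q) ∈ e.source := by rwa [c.left_inv hqc]
  have hpull : coordForm c α =ᶠ[𝓝 (c q)] fun z => (coordForm e α (e (c.symm z))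
      ).compContinuousLinearMap (fderiv ℝ (fun z => e (c.symm z)) z) := by
    filter_upwards [c.open_target.mem_nhds hcq,
      (c.continuousAt_symm hcq).eventually (e.open_source.mem_nhds hqe)] with z hz hze
    exact coordForm_eq_pullback_transition he hc α hz hze
  have hextDeriv : extDeriv (coordForm c α) (c q) = (extDeriv (coordForm e α) (e q)
      ).compContinuousLinearMap (fderiv ℝ (fun z => e (c.symm z)) (c q)) := by
    rw [hpull.extDeriv_eq, extDeriv_pullback (f := fun z => e (c.symm z)) (r := ∞)
      (by rwa [c.left_inv hqc]) (contDiffAt_transition he hc hcq hqe)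
      (by rw [minSmoothness_of_isRCLikeNormedField]; exact WithTop.coe_le_coe.2 le_top),
      c.left_inv hqc]
  change extDeriv (coordForm c α) (c q) (fun i => coordDeriv c q (w i)) = _
  rw [hextDeriv]
  exact congrArg (extDeriv (coordForm e α) (e q))
    (funext fun i => fderiv_transition_coordDeriv he hc hqc hq (w i))

lemma coordDensity_ne_zero (he : e ∈ IsManifold.maximalAtlas (𝓡 (m + 1)) ∞ M)
    (dv : VolumeForm m M) {z : Coord (m + 1)} (hz : z ∈ e.target) : coordDensity dv e z ≠ 0 := by
  intro hzero
  have hform : coordForm e dv.form z = 0 := topForm_ext hzero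
  apply dv.ne_zero (e.symm z)
  ext w
  rw [← coordForm_coordDeriv he dv.form (e.map_target hz) w, e.right_inv hz, hform]
  rfl

lemma volumeForm_apply_stdVec_ne_zero (dv : VolumeForm m M) (q : M) :
    dv.form q (stdVec q) ≠ 0 := fun hzero => dv.ne_zero q (topForm_ext hzero)

lemma coordForm_areaForm (he : e ∈ IsManifold.maximalAtlas (𝓡 (m + 1)) ∞ M) (g : CoMetric m M)
    (dv : VolumeForm m M) {φ : M → ℝ} {p : ℝ} {z : Coord (m + 1)} (hz : z ∈ e.target)
    {θ : Coord (m + 1) →L[ℝ] ℝ} (hφ : HasFDerivAt (fun z => φ (e.symm z)) θ z) :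
    coordForm e (areaForm g dv φ p) z = (coordForm e dv.form z).curryLeft
      ((√(θ (coordMetric g e z θ)) ^ (1 - p))⁻¹ • coordMetric g e z θ) := by
  have hd : dAt m φ (e.symm z) = θ ∘L coordDeriv e (e.symm z) := by
    rw [dAt_symm_eq he hz (mdifferentiableAt_of_comp_symm he hz hφ.differentiableAt), hφ.fderiv]
  have hnorm : g.norm (e.symm z) (dAt m φ (e.symm z)) = √(θ (coordMetric g e z θ)) := by
    rw [CoMetric.norm, hd, ← apply_coordMetric he g hz]
  have hsharp : g.sharp (e.symm z) (dAt m φ (e.symm z)) = coordInv e z (coordMetric g e z θ) := by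
    rw [← coordDeriv_sharp he g hz, coordInv_coordDeriv he hz, hd]
  ext w
  refine congrArg (dv.form (e.symm z)) (funext fun i => ?_)
  refine Fin.cases ?_ (fun i => ?_) i
  · change g.sharp (e.symm z) ((g.norm (e.symm z) (dAt m φ (e.symm z)) ^ (1 - p))⁻¹ •
      dAt m φ (e.symm z)) =
      coordInv e z ((√(θ (coordMetric g e z θ)) ^ (1 - p))⁻¹ • coordMetric g e z θ)
    rw [map_smul, map_smul (coordInv e z), hsharp, hnorm]
  · rfl

/-- Near `z` the form `dv` is `coordDensity` times the constant form that it induces at `z`. -/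
lemma extDeriv_coordForm_areaForm (he : e ∈ IsManifold.maximalAtlas (𝓡 (m + 1)) ∞ M)
    (g : CoMetric m M) (dv : VolumeForm m M) {φ : M → ℝ} {p : ℝ} {z : Coord (m + 1)}
    (hz : z ∈ e.target) (hφ : ∀ᶠ y in 𝓝 z, DifferentiableAt ℝ (fun z => φ (e.symm z)) y)
    (hV : DifferentiableAt ℝ (fun y => flux (coordDensity dv e) (coordMetric g e) p
      (y, fderiv ℝ (fun z => φ (e.symm z)) y)) z) :
    DifferentiableAt ℝ (coordForm e (areaForm g dv φ p)) z ∧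
      extDeriv (coordForm e (areaForm g dv φ p)) z =
        weightedDiv (coordDensity dv e) (flux (coordDensity dv e) (coordMetric g e) p)
          (fun z => φ (e.symm z)) z • coordForm e dv.form z := by
  set A := coordDensity dv e
  let D := (A z)⁻¹ • coordForm e dv.form z
  have hD (y : Coord (m + 1)) : coordForm e dv.form y = A y • D :=
    topForm_ext (by
      change A y = A y * ((A z)⁻¹ * A z)
      rw [inv_mul_cancel₀ (coordDensity_ne_zero he dv hz), mul_one])
  have harea : coordForm e (areaForm g dv φ p) =ᶠ[𝓝 z] fun y => D.curryLeft
      (flux A (coordMetric g e) p (y, fderiv ℝ (fun z => φ (e.symm z)) y)) := by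
    filter_upwards [e.open_target.mem_nhds hz, hφ] with y hy hφy
    rw [coordForm_areaForm he g dv hy hφy.hasFDerivAt, hD, flux]
    ext w
    simp [mul_left_comm, mul_assoc]
  refine ⟨(D.curryLeft.differentiableAt.comp z hV).congr_of_eventuallyEq harea, ?_⟩
  rw [harea.extDeriv_eq, extDeriv_curryLeft D hV, weightedDiv, mul_comm, mul_smul]

lemma meanCurv_symm (he : e ∈ IsManifold.maximalAtlas (𝓡 (m + 1)) ∞ M) (g : CoMetric m M)
    (dv : VolumeForm m M) {φ : M → ℝ} {p : ℝ} {z : Coord (m + 1)} (hz : z ∈ e.target)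
    (hφ : ContDiffAt ℝ 2 (fun z => φ (e.symm z)) z)
    (hpos : 0 < fderiv ℝ (fun z => φ (e.symm z)) z
      (coordMetric g e z (fderiv ℝ (fun z => φ (e.symm z)) z))) :
    meanCurv g dv φ p (e.symm z) =
      weightedDiv (coordDensity dv e) (flux (coordDensity dv e) (coordMetric g e) p)
        (fun z => φ (e.symm z)) z := by
  have hA : ContDiffAt ℝ 1 (coordDensity dv e) z :=
    ((contDiffOn_coordDensity he dv).contDiffAt (e.open_target.mem_nhds hz)).of_le (by simp)
  have hG : ContDiffAt ℝ 1 (coordMetric g e) z :=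
    ((contDiffOn_coordMetric he g).contDiffAt (e.open_target.mem_nhds hz)).of_le (by simp)
  have hV := (contDiffAt_flux_fderiv (p := p) hA hG (by simpa [one_add_one_eq_two] using hφ)
    hpos).differentiableAt one_ne_zero
  have hφ' := (hφ.eventually (by simp)).mono fun y hy => hy.differentiableAt two_ne_zero
  obtain ⟨hdiff, hextDeriv⟩ := extDeriv_coordForm_areaForm he g dv hz hφ' hV
  have hsrc := e.map_target hz
  rw [meanCurv, extDerivM_eq he _ hsrc (by rwa [e.right_inv hz]), e.right_inv hz, hextDeriv,
    div_eq_iff (volumeForm_apply_stdVec_ne_zero dv _), ← coordForm_coordDeriv he dv.form hsrc,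
    e.right_inv hz]
  rfl

end Curvature

section Append

variable {m : ℕ}

/-- The direction of the translations in translation-isometric coordinates. -/
noncomputable abbrev lastVec (m : ℕ) : Coord (m + 1) := EuclideanSpace.single (Fin.last m) 1

lemma contDiff_proj : ContDiff ℝ ∞ (proj : Coord (m + 1) → Coord m) :=
  contDiff_euclidean.2 fun j => (EuclideanSpace.proj (𝕜 := ℝ) j.castSucc).contDiff

lemma proj_zero : proj (0 : Coord (m + 1)) = 0 := by
  ext
  simp [proj]

lemma proj_add_smul_lastVec (z : Coord (m + 1)) (t : ℝ) : proj (z + t • lastVec m) = proj z := by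
  ext
  simp [proj]

lemma append_proj (z : Coord (m + 1)) (s : ℝ) :
    append (proj z) s = z + (s - z (Fin.last m)) • lastVec m := by
  ext j
  refine Fin.lastCases ?_ (fun j => ?_) j <;> simp [append, proj]

lemma proj_append (x : Coord m) (s : ℝ) : proj (append x s) = x := by
  ext
  simp [append, proj]

lemma continuous_append_zero : Continuous (fun x : Coord m => append x 0) := by
  refine (PiLp.continuous_toLp 2 _).comp (continuous_pi fun j => ?_)
  refine Fin.lastCases (by simpa using continuous_const) (fun j => ?_) j
  simp only [Fin.snoc_castSucc]
  fun_prop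

lemma append_zero_zero : append (0 : Coord m) 0 = 0 := by
  ext j
  refine Fin.lastCases ?_ (fun j => ?_) j <;> simp [append]

/-- The defining function `u - x^{m+1}` of the graph of `u`, in coordinates. -/
noncomputable def coordGraphFn (u : Coord m → ℝ) (z : Coord (m + 1)) : ℝ :=
  u (proj z) - z (Fin.last m)

lemma coordGraphFn_sub (u v : Coord m → ℝ) (z : Coord (m + 1)) :
    (coordGraphFn u - coordGraphFn v) z = u (proj z) - v (proj z) :=
  sub_sub_sub_cancel_right _ _ _

lemma coordGraphFn_add_smul_lastVec (u : Coord m → ℝ) (z : Coord (m + 1)) (t : ℝ) :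
    coordGraphFn u (z + t • lastVec m) = coordGraphFn u z - t := by
  simp [coordGraphFn, proj_add_smul_lastVec, sub_add_eq_sub_sub]

lemma fderiv_coordGraphFn_add_smul_lastVec (u : Coord m → ℝ) (z : Coord (m + 1)) (t : ℝ) :
    fderiv ℝ (coordGraphFn u) (z + t • lastVec m) = fderiv ℝ (coordGraphFn u) z := by
  rw [← fderiv_comp_add_right, funext fun y => coordGraphFn_add_smul_lastVec u y t,
    fderiv_sub_const]

lemma fderiv_coordGraphFn_lastVec {u : Coord m → ℝ} {z : Coord (m + 1)}
    (hu : DifferentiableAt ℝ (coordGraphFn u) z) :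
    fderiv ℝ (coordGraphFn u) z (lastVec m) = -1 := by
  rw [← hu.lineDeriv_eq_fderiv, lineDeriv,
    funext fun t => coordGraphFn_add_smul_lastVec u z t]
  simp

end Append

section Translations

variable {m : ℕ} {M : Type*} [TopologicalSpace M] [ChartedSpace (Coord (m + 1)) M]
  [IsManifold (𝓡 (m + 1)) ∞ M] {e : OpenPartialHomeomorph M (Coord (m + 1))} {g : CoMetric m M}
  {dv : VolumeForm m M} {p₀ : M} {U : Set M} {δ : ℝ} {Ψ : ℝ → M → M} {S : Set M}

lemma IsTranslationIsometricCoords.zero_mem_target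
    (he : IsTranslationIsometricCoords dv p₀ U δ Ψ S e) : (0 : Coord (m + 1)) ∈ e.target :=
  he.origin ▸ e.map_source he.mem

lemma IsTranslationIsometricCoords.symm_zero
    (he : IsTranslationIsometricCoords dv p₀ U δ Ψ S e) : e.symm 0 = p₀ := by
  rw [← he.origin, e.left_inv he.mem]

lemma eventually_translation_mem (hΨ : IsIsometricTranslations g dv p₀ U δ Ψ)
    (he : IsTranslationIsometricCoords dv p₀ U δ Ψ S e) :
    ∀ᶠ a : Coord (m + 1) × ℝ in 𝓝 (0, 0),
      a.1 ∈ e.target ∧ a.2 ∈ Ioo (-δ) δ ∧ Ψ a.2 (e.symm a.1) ∈ e.source := by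
  have h0t := he.zero_mem_target
  have hIoo : Ioo (-δ) δ ∈ 𝓝 (0 : ℝ) := Ioo_mem_nhds (neg_lt_zero.2 hΨ.pos) hΨ.pos
  have hΨc : Tendsto (fun z : ℝ × M => Ψ z.1 z.2) (𝓝 (0, p₀)) (𝓝 p₀) := by
    simpa only [ContinuousAt, hΨ.zero p₀ hΨ.mem] using hΨ.smooth.continuousOn.continuousAt
      (prod_mem_nhds hIoo (hΨ.isOpen.mem_nhds hΨ.mem))
  have hsymm : Tendsto (fun a : Coord (m + 1) × ℝ => (a.2, e.symm a.1)) (𝓝 (0, 0))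
      (𝓝 (0, p₀)) := by
    have hcont : ContinuousAt (fun a : Coord (m + 1) × ℝ => (a.2, e.symm a.1)) (0, 0) :=
      continuousAt_snd.prodMk
        (ContinuousAt.comp (g := e.symm) (e.continuousAt_symm h0t) continuousAt_fst)
    simpa only [ContinuousAt, he.symm_zero] using hcont
  filter_upwards [prod_mem_nhds (e.open_target.mem_nhds h0t) hIoo,
    (hΨc.comp hsymm).eventually (e.open_source.mem_nhds he.mem)] with a ha hΨa
  exact ⟨ha.1, ha.2, hΨa⟩

lemma coord_translation (he : IsTranslationIsometricCoords dv p₀ U δ Ψ S e) {q : M}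
    (hq : q ∈ e.source) {t : ℝ} (ht : t ∈ Ioo (-δ) δ) (hΨq : Ψ t q ∈ e.source) :
    e (Ψ t q) = e q + t • lastVec m := by
  ext j
  refine Fin.lastCases ?_ (fun j => ?_) j
  · simp [he.coord_last q hq t ht hΨq]
  · simp [he.coord_castSucc q hq t ht hΨq]

lemma dAt_coord_comp_tanMap (hΨ : IsIsometricTranslations g dv p₀ U δ Ψ)
    (he : IsTranslationIsometricCoords dv p₀ U δ Ψ S e) {q : M} (hq : q ∈ e.source) {t : ℝ}
    (ht : t ∈ Ioo (-δ) δ) (hΨq : Ψ t q ∈ e.source) (k : Fin (m + 1)) :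
    (dAt m (fun q => e q k) (Ψ t q)).comp (tanMap m (Ψ t) q) = dAt m (fun q => e q k) q := by
  have hΨt : MDifferentiableAt (𝓡 (m + 1)) (𝓡 (m + 1)) (Ψ t) q :=
    (hΨ.localDiffeo t ht ⟨q, he.subset hq⟩).mdifferentiableAt (by simp)
  have hcoord {q' : M} (hq' : q' ∈ e.source) :
      MDifferentiableAt (𝓡 (m + 1)) 𝓘(ℝ, ℝ) (fun q => e q k) q' :=
    ((smoothFnOn_coord he.mem_atlas k).contMDiffAt
      (e.open_source.mem_nhds hq')).mdifferentiableAt (by simp)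
  have hcomp : HasMFDerivAt (𝓡 (m + 1)) 𝓘(ℝ, ℝ) (fun q' => e (Ψ t q') k) q
      ((dAt m (fun q => e q k) (Ψ t q)).comp (tanMap m (Ψ t) q)) :=
    (hcoord hΨq).hasMFDerivAt.comp q hΨt.hasMFDerivAt
  have hshift : HasMFDerivAt (𝓡 (m + 1)) 𝓘(ℝ, ℝ) (fun q' => e q' k + (t • lastVec m) k) q
      (dAt m (fun q => e q k) q) :=
    ((hcoord hq).hasMFDerivAt.add
      (hasMFDerivAt_const (I := 𝓡 (m + 1)) (I' := 𝓘(ℝ, ℝ)) ((t • lastVec m) k) q)).congr_mfderiv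
      (add_zero (dAt m (fun q => e q k) q))
  refine hasMFDerivAt_unique hcomp (hshift.congr_of_eventuallyEq ?_)
  filter_upwards [e.open_source.mem_nhds hq,
    hΨt.continuousAt.eventually (e.open_source.mem_nhds hΨq)] with q' hq' hΨq'
  rw [coord_translation he hq' ht hΨq', PiLp.add_apply]

lemma form_coord_translation (hΨ : IsIsometricTranslations g dv p₀ U δ Ψ)
    (he : IsTranslationIsometricCoords dv p₀ U δ Ψ S e) {q : M} (hq : q ∈ e.source) {t : ℝ}
    (ht : t ∈ Ioo (-δ) δ) (hΨq : Ψ t q ∈ e.source) (i j : Fin (m + 1)) :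
    g.form (Ψ t q) (dAt m (fun q => e q i) (Ψ t q)) (dAt m (fun q => e q j) (Ψ t q)) =
      g.form q (dAt m (fun q => e q i) q) (dAt m (fun q => e q j) q) := by
  rw [← hΨ.isometry t ht q (he.subset hq) (he.subset hΨq), dAt_coord_comp_tanMap hΨ he hq ht hΨq,
    dAt_coord_comp_tanMap hΨ he hq ht hΨq]

lemma exists_coordMetric_coordDensity_add_smul_lastVec
    (hΨ : IsIsometricTranslations g dv p₀ U δ Ψ)
    (he : IsTranslationIsometricCoords dv p₀ U δ Ψ S e) :
    ∃ ε > 0, ∀ z ∈ ball (0 : Coord (m + 1)) ε, ∀ t : ℝ, |t| < ε →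
      coordMetric g e (z + t • lastVec m) = coordMetric g e z ∧
        coordDensity dv e (z + t • lastVec m) = coordDensity dv e z := by
  obtain ⟨ε, hε, hball⟩ := Metric.mem_nhds_iff.1 (eventually_translation_mem hΨ he)
  refine ⟨ε, hε, fun z hz t ht => ?_⟩
  obtain ⟨hzt, htδ, hsrc⟩ : z ∈ e.target ∧ t ∈ Ioo (-δ) δ ∧ Ψ t (e.symm z) ∈ e.source := by
    refine hball (a := (z, t)) ?_
    rw [← ball_prod_same]
    exact ⟨hz, by simpa using ht⟩
  have hq := e.map_target hzt
  have hcoord : e (Ψ t (e.symm z)) = z + t • lastVec m := by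
    rw [coord_translation he hq htδ hsrc, e.right_inv hzt]
  have hsymm : e.symm (z + t • lastVec m) = Ψ t (e.symm z) := by
    rw [← hcoord, e.left_inv hsrc]
  constructor
  · simp only [coordMetric]
    refine Finset.sum_congr rfl fun i _ => Finset.sum_congr rfl fun j _ => ?_
    rw [hsymm, form_coord_translation hΨ he hq htδ hsrc]
  · have hdensity : coordDensity dv e (e (Ψ t (e.symm z))) = coordDensity dv e (e (e.symm z)) :=
      he.density_eq _ hq t htδ hsrc
    rwa [hcoord, e.right_inv hzt] at hdensity

end Translations

section Graphs

variable {m : ℕ} {M : Type*} [TopologicalSpace M]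
  {e : OpenPartialHomeomorph M (Coord (m + 1))} {u : Coord m → ℝ}

lemma isOpen_baseDomain (e : OpenPartialHomeomorph M (Coord (m + 1))) : IsOpen (baseDomain e) :=
  e.open_target.preimage continuous_append_zero

lemma graphFn_symm_eventuallyEq {z : Coord (m + 1)} (hz : z ∈ e.target) :
    (fun z => graphFn e u (e.symm z)) =ᶠ[𝓝 z] coordGraphFn u := by
  filter_upwards [e.open_target.mem_nhds hz] with y hy
  simp only [graphFn, coordGraphFn, e.right_inv hy]

lemma IsGraph.contDiffAt_coordGraphFn (hu : IsGraph e u) {z : Coord (m + 1)}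
    (hz : proj z ∈ baseDomain e) : ContDiffAt ℝ ∞ (coordGraphFn u) z :=
  ((hu.1.contDiffAt ((isOpen_baseDomain e).mem_nhds hz)).comp z contDiff_proj.contDiffAt).sub
    (EuclideanSpace.proj (𝕜 := ℝ) (Fin.last m)).contDiff.contDiffAt

variable [ChartedSpace (Coord (m + 1)) M] {g : CoMetric m M}

lemma IsNonsingularGraph.pos (hu' : IsNonsingularGraph g e u)
    (he : e ∈ IsManifold.maximalAtlas (𝓡 (m + 1)) ∞ M) (hu : IsGraph e u) {x : Coord m}
    (hx : x ∈ baseDomain e) :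
    0 < fderiv ℝ (coordGraphFn u) (append x (u x)) (coordMetric g e (append x (u x))
      (fderiv ℝ (coordGraphFn u) (append x (u x)))) := by
  have hz : append x (u x) ∈ e.target := hu.2 x hx
  have hgraphFn := graphFn_symm_eventuallyEq (u := u) hz
  have hdiff := ((hu.contDiffAt_coordGraphFn (by rwa [proj_append])).congr_of_eventuallyEq
    hgraphFn).differentiableAt (by simp)
  have hnorm := hu' x hx
  rw [CoMetric.norm, graphPoint, dAt_symm_eq he hz (mdifferentiableAt_of_comp_symm he hz hdiff),
    hgraphFn.fderiv_eq, ← apply_coordMetric he g hz] at hnorm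
  exact Real.sqrt_pos.1 ((Real.sqrt_nonneg _).lt_of_ne' hnorm)

variable [IsManifold (𝓡 (m + 1)) ∞ M] {dv : VolumeForm m M}

lemma IsNonsingularGraph.graphCurv_eq (hu' : IsNonsingularGraph g e u)
    (he : e ∈ IsManifold.maximalAtlas (𝓡 (m + 1)) ∞ M) (hu : IsGraph e u) (p : ℝ) {x : Coord m}
    (hx : x ∈ baseDomain e) :
    graphCurv g dv e p u x =
      weightedDiv (coordDensity dv e) (flux (coordDensity dv e) (coordMetric g e) p)
        (coordGraphFn u) (append x (u x)) := by
  have hz : append x (u x) ∈ e.target := hu.2 x hx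
  have hgraphFn := graphFn_symm_eventuallyEq (u := u) hz
  have hsmooth : ContDiffAt ℝ ∞ (fun z => graphFn e u (e.symm z)) (append x (u x)) :=
    (hu.contDiffAt_coordGraphFn (by rwa [proj_append])).congr_of_eventuallyEq hgraphFn
  have hflux : (fun z => flux (coordDensity dv e) (coordMetric g e) p
      (z, fderiv ℝ (fun z => graphFn e u (e.symm z)) z)) =ᶠ[𝓝 (append x (u x))]
      fun z => flux (coordDensity dv e) (coordMetric g e) p (z, fderiv ℝ (coordGraphFn u) z) := by
    filter_upwards [hgraphFn.fderiv (𝕜 := ℝ)] with y hy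
    rw [hy]
  rw [graphCurv, graphPoint, meanCurv_symm he g dv hz (hsmooth.of_le (WithTop.coe_le_coe.2 le_top))
    (by rw [hgraphFn.fderiv_eq]; exact hu'.pos he hu hx), weightedDiv, weightedDiv,
    hflux.fderiv_eq]

variable {p₀ : M} {U : Set M} {δ : ℝ} {Ψ : ℝ → M → M} {S : Set M}

lemma IsTranslationIsometricCoords.proj_zero_mem_baseDomain
    (he : IsTranslationIsometricCoords dv p₀ U δ Ψ S e) :
    proj (0 : Coord (m + 1)) ∈ baseDomain e := by
  change append (proj (0 : Coord (m + 1))) 0 ∈ e.target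
  rw [proj_zero, append_zero_zero]
  exact he.zero_mem_target

/-- Translation invariance carries the curvature of the graph to all nearby points, so that the
comparison of two graphs becomes a comparison of their defining functions on an open set. -/
lemma eventually_graphCurv_proj (hΨ : IsIsometricTranslations g dv p₀ U δ Ψ)
    (he : IsTranslationIsometricCoords dv p₀ U δ Ψ S e) (hu : IsGraph e u)
    (hu' : IsNonsingularGraph g e u) (hu0 : u 0 = 0) (p : ℝ) :
    ∀ᶠ z in 𝓝 (0 : Coord (m + 1)),
      0 < fderiv ℝ (coordGraphFn u) z (coordMetric g e z (fderiv ℝ (coordGraphFn u) z)) ∧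
      graphCurv g dv e p u (proj z) =
        weightedDiv (coordDensity dv e) (flux (coordDensity dv e) (coordMetric g e) p)
          (coordGraphFn u) z := by
  obtain ⟨ε, hε, hinv⟩ := exists_coordMetric_coordDensity_add_smul_lastVec hΨ he
  have h0b := he.proj_zero_mem_baseDomain
  have hsmall : ∀ᶠ z in 𝓝 (0 : Coord (m + 1)), |coordGraphFn u z| < ε := by
    have hcont := (hu.contDiffAt_coordGraphFn h0b).continuousAt.tendsto.abs
    rw [coordGraphFn, proj_zero, hu0, PiLp.zero_apply, sub_zero, abs_zero] at hcont
    exact hcont.eventually (gt_mem_nhds hε)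
  filter_upwards [ball_mem_nhds _ hε, hsmall,
    contDiff_proj.continuous.continuousAt.eventually ((isOpen_baseDomain e).mem_nhds h0b)]
    with z hzε ht hzb
  have happend : append (proj z) (u (proj z)) = z + coordGraphFn u z • lastVec m := append_proj z _
  have hpos := hu'.pos he.mem_atlas hu hzb
  have hball := isOpen_ball.mem_nhds hzε
  rw [happend, fderiv_coordGraphFn_add_smul_lastVec, (hinv z hzε _ ht).1] at hpos
  refine ⟨hpos, ?_⟩
  rw [hu'.graphCurv_eq he.mem_atlas hu p hzb, happend]
  exact weightedDiv_flux_add_right (mem_of_superset hball fun y hy => (hinv y hy _ ht).2)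
    (mem_of_superset hball fun y hy => (hinv y hy _ ht).1)
    (Eventually.of_forall fun y => fderiv_coordGraphFn_add_smul_lastVec u y _)

end Graphs

section NormalsAndTangentDirections

variable {E : Type*} [NormedAddCommGroup E]

lemma mem_nhds_of_isExteriorNormal_eq_zero [ProperSpace E] {F N : Set E} {x : E} (hF : IsClosed F)
    (hx : x ∈ F) (hN : N ∈ 𝓝 x)
    (hFN : ∀ y ∈ F ∩ N, ∀ ν, IsExteriorNormal F y ν → ν = 0) : F ∈ 𝓝 x := by
  obtain ⟨r, hr, hball⟩ := Metric.mem_nhds_iff.1 hN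
  filter_upwards [ball_mem_nhds x (half_pos hr)] with c hc
  obtain ⟨y, hyF, hy⟩ := hF.exists_infDist_eq_dist ⟨x, hx⟩ c
  have hyN : y ∈ N := by
    refine hball ?_
    have hcy : dist c y ≤ dist c x := hy ▸ infDist_le_dist_of_mem hx
    rw [mem_ball] at hc ⊢
    linarith [dist_triangle_left y x c]
  rwa [sub_eq_zero.1 (hFN y ⟨hyF, hyN⟩ _ (isExteriorNormal_of_infDist_eq_dist hy))]

variable [InnerProductSpace ℝ E]

lemma isTangentOn_const_of_eventually_add_smul_mem {F O : Set E} {a : E}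
    (h : ∀ y ∈ F ∩ O, ∀ᶠ t in 𝓝 (0 : ℝ), y + t • a ∈ F) : IsTangentOn F O fun _ => a := by
  intro y hy ν hν
  have hpos : a ∈ posTangentConeAt F y :=
    mem_posTangentConeAt_of_frequently_mem ((h y hy).filter_mono nhdsWithin_le_nhds).frequently
  have hneg : -a ∈ posTangentConeAt F y := by
    have hlim : Tendsto (fun t : ℝ => -t) (𝓝[>] 0) (𝓝 0) := by
      simpa using tendsto_neg (0 : ℝ) |>.mono_left nhdsWithin_le_nhds
    refine mem_posTangentConeAt_of_frequently_mem (Eventually.frequently ?_)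
    filter_upwards [hlim.eventually (h y hy)] with t ht
    rwa [smul_neg, ← neg_smul]
  have hle := hν.inner_nonpos hneg
  rw [inner_neg_right, neg_nonpos] at hle
  rw [real_inner_comm]
  exact le_antisymm (hν.inner_nonpos hpos) hle

lemma eq_zero_of_inner_eq_zero_of_finrank_le [FiniteDimensional ℝ E] {K : Submodule ℝ E}
    {θ : E →L[ℝ] ℝ} {a ν : E} (hθ : ∀ x ∈ K, θ x = 0) (ha : θ a ≠ 0)
    (hdim : Module.finrank ℝ E ≤ Module.finrank ℝ K + 1) (hν : ∀ x ∈ K, inner ℝ x ν = 0)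
    (haν : inner ℝ a ν = 0) : ν = 0 := by
  have hlt : K < K ⊔ Submodule.span ℝ {a} :=
    left_lt_sup.2 fun hle => ha (hθ a (hle (Submodule.mem_span_singleton_self a)))
  have htop : K ⊔ Submodule.span ℝ {a} = ⊤ :=
    Submodule.eq_top_of_finrank_eq (le_antisymm (Submodule.finrank_le _)
      (hdim.trans (Submodule.finrank_lt_finrank_of_lt hlt)))
  have horth : K ⊔ Submodule.span ℝ {a} ≤ (Submodule.span ℝ {ν})ᗮ := by
    refine sup_le (fun x hx => ?_) ((Submodule.span_singleton_le_iff_mem _ _).2 ?_)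
    · rw [Submodule.mem_orthogonal_singleton_iff_inner_left]
      exact hν x hx
    · rwa [Submodule.mem_orthogonal_singleton_iff_inner_left]
  rw [htop, top_le_iff, Submodule.orthogonal_eq_top_iff, Submodule.span_singleton_eq_bot] at horth
  exact horth

end NormalsAndTangentDirections

section LevelSets

variable {E : Type*} [NormedAddCommGroup E] [NormedSpace ℝ E] {φ : E → ℝ} {X Y : E → E} {z : E}

lemma fderiv_apply_fderiv_add_eq_zero (hφ : ContDiffAt ℝ 2 φ z) (hX : DifferentiableAt ℝ X z)
    (h : ∀ᶠ y in 𝓝 z, fderiv ℝ φ y (X y) = 0) (w : E) :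
    fderiv ℝ φ z (fderiv ℝ X z w) + fderiv ℝ (fderiv ℝ φ) z w (X z) = 0 := by
  have hφ' : DifferentiableAt ℝ (fderiv ℝ φ) z :=
    (hφ.fderiv_right (m := 1) (by norm_num)).differentiableAt one_ne_zero
  have hzero : HasFDerivAt (fun y => fderiv ℝ φ y (X y)) (0 : E →L[ℝ] ℝ) z :=
    (hasFDerivAt_const (0 : ℝ) z).congr_of_eventuallyEq h
  simpa using DFunLike.congr_fun ((hφ'.hasFDerivAt.clm_apply hX.hasFDerivAt).unique hzero) w

lemma fderiv_apply_lieBracket_eq_zero (hφ : ContDiffAt ℝ 2 φ z) (hX : DifferentiableAt ℝ X z)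
    (hY : DifferentiableAt ℝ Y z) (hφX : ∀ᶠ y in 𝓝 z, fderiv ℝ φ y (X y) = 0)
    (hφY : ∀ᶠ y in 𝓝 z, fderiv ℝ φ y (Y y) = 0) :
    fderiv ℝ φ z (VectorField.lieBracket ℝ X Y z) = 0 := by
  have hsymm : IsSymmSndFDerivAt ℝ φ z := hφ.isSymmSndFDerivAt (by simp)
  have h₁ := fderiv_apply_fderiv_add_eq_zero hφ hY hφY (X z)
  have h₂ := fderiv_apply_fderiv_add_eq_zero hφ hX hφX (Y z)
  rw [VectorField.lieBracket, map_sub]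
  linarith [hsymm.eq (X z) (Y z)]

end LevelSets

section HorizontalFields

variable {E : Type*} [NormedAddCommGroup E] [NormedSpace ℝ E]

/-- The projection of covectors along `θ` onto the covectors orthogonal to `θ` with respect to the
inner product `⟨η, ζ⟩ = η (G ζ)`. -/
noncomputable def orthCovec (G : (E →L[ℝ] ℝ) →L[ℝ] E) (θ : E →L[ℝ] ℝ) :
    (E →L[ℝ] ℝ) →ₗ[ℝ] (E →L[ℝ] ℝ) where
  toFun η := η - (η (G θ) / θ (G θ)) • θ
  map_add' η ζ := by
    rw [add_apply, add_div, add_smul]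
    abel
  map_smul' c η := by
    rw [smul_apply, smul_eq_mul, mul_div_assoc, mul_smul, smul_sub, RingHom.id_apply]

lemma orthCovec_apply_eq_zero {G : (E →L[ℝ] ℝ) →L[ℝ] E} {θ : E →L[ℝ] ℝ} (hθ : θ (G θ) ≠ 0)
    (η : E →L[ℝ] ℝ) : orthCovec G θ η (G θ) = 0 := by
  change (η - (η (G θ) / θ (G θ)) • θ) (G θ) = 0
  rw [sub_apply, smul_apply, smul_eq_mul, div_mul_cancel₀ _ hθ, sub_self]

lemma finrank_range_le_finrank_range_comp_orthCovec_add_one [FiniteDimensional ℝ E]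
    (G : (E →L[ℝ] ℝ) →L[ℝ] E) (θ : E →L[ℝ] ℝ) :
    Module.finrank ℝ G.range ≤ Module.finrank ℝ (G.toLinearMap ∘ₗ orthCovec G θ).range + 1 := by
  have hle : G.range ≤ (G.toLinearMap ∘ₗ orthCovec G θ).range ⊔ Submodule.span ℝ {G θ} := by
    rintro _ ⟨η, rfl⟩
    refine Submodule.mem_sup.2 ⟨G (orthCovec G θ η), ⟨η, rfl⟩, (η (G θ) / θ (G θ)) • G θ,
      Submodule.smul_mem _ _ (Submodule.mem_span_singleton_self _), ?_⟩
    change G (η - (η (G θ) / θ (G θ)) • θ) + _ = G η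
    rw [map_sub, map_smul, sub_add_cancel]
  calc Module.finrank ℝ G.range
      ≤ Module.finrank ℝ
          ((G.toLinearMap ∘ₗ orthCovec G θ).range ⊔ Submodule.span ℝ {G θ} : Submodule ℝ E) :=
        Submodule.finrank_mono hle
    _ ≤ Module.finrank ℝ (G.toLinearMap ∘ₗ orthCovec G θ).range +
          Module.finrank ℝ (Submodule.span ℝ {G θ}) :=
        Submodule.finrank_add_le_finrank_add_finrank _ _
    _ ≤ Module.finrank ℝ (G.toLinearMap ∘ₗ orthCovec G θ).range + 1 := by
        gcongr
        simpa using finrank_span_le_card (R := ℝ) ({G θ} : Set E)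

/-- The field `G η` corrected by a multiple of `G θ` so that `θ` annihilates it. For `θ = dφ` it is
tangent to the level sets of `φ`. -/
noncomputable def horizField (G : E → (E →L[ℝ] ℝ) →L[ℝ] E) (θ : E → E →L[ℝ] ℝ) (η : E →L[ℝ] ℝ)
    (z : E) : E :=
  G z (orthCovec (G z) (θ z) η)

variable {G : E → (E →L[ℝ] ℝ) →L[ℝ] E} {θ : E → E →L[ℝ] ℝ} {z : E}

lemma apply_horizField (hs : ∀ η ζ : E →L[ℝ] ℝ, η (G z ζ) = ζ (G z η)) (hθ : θ z (G z (θ z)) ≠ 0)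
    (η : E →L[ℝ] ℝ) : θ z (horizField G θ η z) = 0 := by
  rw [horizField, hs, orthCovec_apply_eq_zero hθ]

lemma contDiffOn_horizField {n : WithTop ℕ∞} {N : Set E} (hG : ContDiffOn ℝ n G N)
    (hθ : ContDiffOn ℝ n θ N) (h0 : ∀ z ∈ N, θ z (G z (θ z)) ≠ 0) (η : E →L[ℝ] ℝ) :
    ContDiffOn ℝ n (horizField G θ η) N := by
  have hGθ := hG.clm_apply hθ
  exact hG.clm_apply (contDiffOn_const.sub
    (((contDiffOn_const.clm_apply hGθ).div (hθ.clm_apply hGθ) h0).smul hθ))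

lemma exists_linearIndependent_horizField [FiniteDimensional ℝ E]
    (G : E → (E →L[ℝ] ℝ) →L[ℝ] E) (θ : E → E →L[ℝ] ℝ) (z : E) {k : ℕ}
    (hk : k ≤ Module.finrank ℝ (G z).range - 1) :
    ∃ η : Fin k → E →L[ℝ] ℝ, LinearIndependent ℝ fun i => horizField G θ (η i) z := by
  have hk' : k ≤ Module.finrank ℝ ((G z).toLinearMap ∘ₗ orthCovec (G z) (θ z)).range :=
    hk.trans (Nat.sub_le_iff_le_add.2 (finrank_range_le_finrank_range_comp_orthCovec_add_one _ _))
  obtain ⟨b, hb⟩ := exists_linearIndependent_of_le_finrank hk'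
  choose η hη using fun i => (b i).2
  refine ⟨η, ?_⟩
  have hb' := hb.map' _ (Submodule.ker_subtype _)
  rwa [show Submodule.subtype _ ∘ b = fun i => horizField G θ (η i) z from
    funext fun i => (hη i).symm] at hb'

end HorizontalFields

section Tangency

variable {E : Type*} [NormedAddCommGroup E] {A : E → ℝ} {p : ℝ} {φ : E → ℝ} {B : Set E}

lemma continuousAt_weightedDivSymbol_flux_fderiv [NormedSpace ℝ E]
    {G : E → (E →L[ℝ] ℝ) →L[ℝ] E} {x : E} (hA : ContDiffAt ℝ 1 A x) (hA0 : A x ≠ 0)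
    (hG : ContDiffAt ℝ 1 G x) (hφ : ContDiffAt ℝ 2 φ x)
    (hpos : 0 < fderiv ℝ φ x (G x (fderiv ℝ φ x))) :
    ContinuousAt (fun z => weightedDivSymbol A (flux A G p) (z, fderiv ℝ φ z)) x := by
  have hφ' : ContinuousAt (fderiv ℝ φ) x := (hφ.fderiv_right (m := 1) (by norm_num)).continuousAt
  have hflux : ContinuousAt (fderiv ℝ (flux A G p)) (x, fderiv ℝ φ x) :=
    ((contDiffAt_flux hA hG hpos).fderiv_right (m := 0) (by simp)).continuousAt
  exact (hA.continuousAt.inv₀ hA0).smul ((ContinuousAt.comp (g := fderiv ℝ (flux A G p))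
    (f := fun z => (z, fderiv ℝ φ z)) hflux (continuousAt_id.prodMk hφ')).clm_comp
    continuousAt_const)

variable [InnerProductSpace ℝ E] [FiniteDimensional ℝ E] {G : E → (E →L[ℝ] ℝ) →L[ℝ] E}

lemma isTangentOn_horizField {F : Set E} {w : E → ℝ} {C : ℝ} (hp : 0 ≤ p) (hB : IsOpen B)
    (hA : ContDiffOn ℝ 1 A B) (hA0 : ∀ x ∈ B, A x ≠ 0) (hG : ContDiffOn ℝ 1 G B)
    (hs : ∀ x ∈ B, ∀ θ η : E →L[ℝ] ℝ, θ (G x η) = η (G x θ))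
    (h0 : ∀ x ∈ B, ∀ θ : E →L[ℝ] ℝ, 0 ≤ θ (G x θ)) (hφ : ContDiffOn ℝ 2 φ B)
    (hpos : ∀ x ∈ B, 0 < fderiv ℝ φ x (G x (fderiv ℝ φ x))) (hw : ContDiffOn ℝ 2 w B)
    (hw0 : ∀ x ∈ B, 0 ≤ w x)
    (hle : ∀ x ∈ B, traceComp (weightedDivSymbol A (flux A G p) (x, fderiv ℝ φ x))
      (fderiv ℝ (fderiv ℝ w) x) ≤ C * ‖fderiv ℝ w x‖)
    (hF : ∀ x ∈ B, w x = 0 ↔ x ∈ F) (η : E →L[ℝ] ℝ) :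
    IsTangentOn F B (horizField G (fderiv ℝ φ) η) := by
  have hAx : ∀ x ∈ B, ContDiffAt ℝ 1 A x := fun x hx => hA.contDiffAt (hB.mem_nhds hx)
  have hGx : ∀ x ∈ B, ContDiffAt ℝ 1 G x := fun x hx => hG.contDiffAt (hB.mem_nhds hx)
  rintro y ⟨hyF, hyB⟩ ν hν
  have hchar := hν.characteristic hB hw hw0
    (fun x hx => apply_weightedDivSymbol_flux_nonneg hp (hAx x hx) (hA0 x hx) (hGx x hx) (hs x hx)
      (h0 x hx) (hpos x hx))
    (fun x hx => (continuousAt_weightedDivSymbol_flux_fderiv (hAx x hx) (hA0 x hx) (hGx x hx)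
      (hφ.contDiffAt (hB.mem_nhds hx)) (hpos x hx)).continuousWithinAt)
    hle (fun x hx => (hF x hx).1) hyB ((hF y hyB).2 hyF)
  rw [real_inner_comm, ← innerCovec_apply]
  exact apply_eq_zero_of_apply_weightedDivSymbol_flux_eq_zero hp (hAx y hyB) (hA0 y hyB)
    (hGx y hyB) (hs y hyB) (h0 y hyB) (hpos y hyB) hchar
    (orthCovec_apply_eq_zero (hpos y hyB).ne' η)

end Tangency

section LieSpan

variable {m : ℕ} {M : Type*} [TopologicalSpace M] [ChartedSpace (Coord (m + 1)) M]
  {e : OpenPartialHomeomorph M (Coord (m + 1))}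

lemma finrank_le_finrank_map_coordDeriv (he : e ∈ IsManifold.maximalAtlas (𝓡 (m + 1)) ∞ M)
    {z : Coord (m + 1)} (hz : z ∈ e.target) (K : Submodule ℝ (Tan m (e.symm z))) :
    Module.finrank ℝ K ≤ Module.finrank ℝ (K.map (coordDeriv e (e.symm z)).toLinearMap) := by
  have hinj : Function.Injective (coordDeriv e (e.symm z)).toLinearMap :=
    Function.LeftInverse.injective (coordInv_coordDeriv he hz)
  exact (Submodule.equivMapOfInjective _ hinj K).finrank_eq.le

lemma finrank_horizontal_le (he : e ∈ IsManifold.maximalAtlas (𝓡 (m + 1)) ∞ M) (g : CoMetric m M)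
    {z : Coord (m + 1)} (hz : z ∈ e.target) :
    Module.finrank ℝ (g.horizontal (e.symm z)) ≤ Module.finrank ℝ (coordMetric g e z).range := by
  refine (finrank_le_finrank_map_coordDeriv he hz _).trans (Submodule.finrank_mono ?_)
  rintro _ ⟨_, ⟨θ, rfl⟩, rfl⟩
  refine ⟨θ ∘L coordInv e z, ?_⟩
  have hθ : (θ ∘L coordInv e z) ∘L coordDeriv e (e.symm z) = θ := by
    ext1 v
    exact congrArg θ (coordInv_coordDeriv he hz v)
  have h := coordDeriv_sharp he g hz (θ ∘L coordInv e z)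
  rw [hθ] at h
  exact h.symm

variable [IsManifold (𝓡 (m + 1)) ∞ M] {W : Set M} {k : ℕ} {X : Fin k → ∀ x : M, Tan m x}
  {Z : ∀ x : M, Tan m x}

lemma LieSpan.smoothFieldOn (hZ : LieSpan W X Z) (hW : IsOpen W)
    (hX : ∀ i, SmoothFieldOn (X i) W) : SmoothFieldOn Z W := by
  induction hZ with
  | gen i => exact hX i
  | zero =>
    exact (Bundle.contMDiff_zeroSection ℝ (TangentSpace (𝓡 (m + 1)) : M → Type)).contMDiffOn
  | add Y Z _ _ ihY ihZ => exact ihY.add_section ihZ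
  | smul f Z hf _ ihZ => exact ContMDiffOn.smul_section hf ihZ
  | bracket Y Z _ _ ihY ihZ => exact ihY.mlieBracket hW ihZ

lemma LieSpan.isTangentOn_coordField (hZ : LieSpan W X Z)
    (he : e ∈ IsManifold.maximalAtlas (𝓡 (m + 1)) ∞ M) (hW : IsOpen W)
    (hX : ∀ i, SmoothFieldOn (X i) W) {F : Set (Coord (m + 1))} (hF : IsClosed F)
    (hXF : ∀ i, IsTangentOn F (e.target ∩ e.symm ⁻¹' W) (coordField e (X i))) :
    IsTangentOn F (e.target ∩ e.symm ⁻¹' W) (coordField e Z) := by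
  induction hZ with
  | gen i => exact hXF i
  | zero =>
    intro y _ ν _
    rw [coordField, map_zero, inner_zero_left]
  | add Y Z _ _ ihY ihZ =>
    intro y hy ν hν
    rw [coordField, map_add, inner_add_left]
    exact (congrArg₂ (· + ·) (ihY y hy ν hν) (ihZ y hy ν hν)).trans (add_zero 0)
  | smul f Z _ _ ihZ =>
    intro y hy ν hν
    rw [coordField, map_smul, inner_smul_left]
    exact (congrArg _ (ihZ y hy ν hν)).trans (mul_zero _)
  | bracket Y Z hY hZ ihY ihZ =>
    have hYs := hY.smoothFieldOn hW hX
    have hZs := hZ.smoothFieldOn hW hX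
    intro y hy ν hν
    rw [coordField_mlieBracket he hW hYs hZs hy.2.1 hy.2.2]
    exact ihY.lieBracket hF (e.isOpen_inter_preimage_symm hW)
      ((hYs.contDiffOn_coordField he hW).of_le (WithTop.coe_le_coe.2 le_top))
      ((hZs.contDiffOn_coordField he hW).of_le (WithTop.coe_le_coe.2 le_top)) ihZ y hy ν hν

lemma LieSpan.fderiv_apply_coordField_eq_zero (hZ : LieSpan W X Z)
    (he : e ∈ IsManifold.maximalAtlas (𝓡 (m + 1)) ∞ M) (hW : IsOpen W)
    (hX : ∀ i, SmoothFieldOn (X i) W) {φ : Coord (m + 1) → ℝ}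
    (hφ : ContDiffOn ℝ 2 φ (e.target ∩ e.symm ⁻¹' W))
    (hXφ : ∀ i, ∀ z ∈ e.target ∩ e.symm ⁻¹' W, fderiv ℝ φ z (coordField e (X i) z) = 0) :
    ∀ z ∈ e.target ∩ e.symm ⁻¹' W, fderiv ℝ φ z (coordField e Z z) = 0 := by
  induction hZ with
  | gen i => exact hXφ i
  | zero =>
    intro z _
    rw [coordField, map_zero, map_zero]
  | add Y Z _ _ ihY ihZ =>
    intro z hz
    rw [coordField, map_add, map_add]
    exact (congrArg₂ (· + ·) (ihY z hz) (ihZ z hz)).trans (add_zero 0)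
  | smul f Z _ _ ihZ =>
    intro z hz
    rw [coordField, map_smul, map_smul]
    exact (congrArg _ (ihZ z hz)).trans (smul_zero _)
  | bracket Y Z hY hZ ihY ihZ =>
    intro z hz
    have hYs := hY.smoothFieldOn hW hX
    have hZs := hZ.smoothFieldOn hW hX
    have hWz := (e.isOpen_inter_preimage_symm hW).mem_nhds hz
    rw [coordField_mlieBracket he hW hYs hZs hz.1 hz.2]
    exact fderiv_apply_lieBracket_eq_zero (hφ.contDiffAt hWz)
      (((hYs.contDiffOn_coordField he hW).contDiffAt hWz).differentiableAt (by simp))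
      (((hZs.contDiffOn_coordField he hW).contDiffAt hWz).differentiableAt (by simp))
      (mem_of_superset hWz ihY) (mem_of_superset hWz ihZ)

lemma IsExteriorNormal.eq_zero_of_le_lieRank (he : e ∈ IsManifold.maximalAtlas (𝓡 (m + 1)) ∞ M)
    (hW : IsOpen W) (hX : ∀ i, SmoothFieldOn (X i) W) {F : Set (Coord (m + 1))} (hF : IsClosed F)
    {φ : Coord (m + 1) → ℝ} (hφ : ContDiffOn ℝ 2 φ (e.target ∩ e.symm ⁻¹' W))
    (hXF : ∀ i, IsTangentOn F (e.target ∩ e.symm ⁻¹' W) (coordField e (X i)))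
    (hXφ : ∀ i, ∀ z ∈ e.target ∩ e.symm ⁻¹' W, fderiv ℝ φ z (coordField e (X i) z) = 0)
    {y ν : Coord (m + 1)} (hν : IsExteriorNormal F y ν) (hyF : y ∈ F) (hy : y ∈ e.target)
    (hyW : e.symm y ∈ W) (hrank : m ≤ lieRank W X (e.symm y)) {a : Coord (m + 1)}
    (ha : fderiv ℝ φ y a ≠ 0) (haν : inner ℝ a ν = 0) : ν = 0 := by
  have hspan (L : Coord (m + 1) →L[ℝ] ℝ) (hL : ∀ Z, LieSpan W X Z → L (coordField e Z y) = 0) :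
      (Submodule.span ℝ {w : Tan m (e.symm y) | ∃ Z, LieSpan W X Z ∧ Z (e.symm y) = w}).map
        (coordDeriv e (e.symm y)).toLinearMap ≤ L.ker := by
    rw [Submodule.map_span_le]
    rintro _ ⟨Z, hZ, rfl⟩
    exact hL Z hZ
  refine eq_zero_of_inner_eq_zero_of_finrank_le
    (hspan (fderiv ℝ φ y) fun Z hZ => ?_) ha ?_ (fun x hx => ?_) haν
  · exact hZ.fderiv_apply_coordField_eq_zero he hW hX hφ hXφ y ⟨hy, hyW⟩
  · rw [finrank_euclideanSpace_fin]
    exact Nat.succ_le_succ (hrank.trans (finrank_le_finrank_map_coordDeriv he hy _))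
  · rw [real_inner_comm]
    refine hspan (innerCovec ν) (fun Z hZ => ?_) hx
    rw [innerCovec_apply, real_inner_comm]
    exact hZ.isTangentOn_coordField he hW hX hF hXF y ⟨hyF, hy, hyW⟩ ν hν

end LieSpan

section Propagation

variable {m l : ℕ} {M : Type*} [TopologicalSpace M] [ChartedSpace (Coord (m + 1)) M]
  {e : OpenPartialHomeomorph M (Coord (m + 1))} {g : CoMetric m M}
  {p₀ : M}

lemma fieldOfCoord_mem_horizontal (he : e ∈ IsManifold.maximalAtlas (𝓡 (m + 1)) ∞ M)
    {Y : Coord (m + 1) → Coord (m + 1)} {z : Coord (m + 1)} (hz : z ∈ e.target)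
    (hY : Y z ∈ (coordMetric g e z).range) :
    fieldOfCoord e Y (e.symm z) ∈ g.horizontal (e.symm z) := by
  obtain ⟨η, hη⟩ := hY
  rw [fieldOfCoord_symm he Y hz, ← hη]
  exact ⟨η ∘L coordDeriv e (e.symm z), by
    rw [← coordInv_coordDeriv he hz (g.sharp _ _), coordDeriv_sharp he g hz]; rfl⟩

lemma linearIndependent_fieldOfCoord (he : e ∈ IsManifold.maximalAtlas (𝓡 (m + 1)) ∞ M) {ι : Type*}
    {Y : ι → Coord (m + 1) → Coord (m + 1)} {z : Coord (m + 1)} (hz : z ∈ e.target)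
    (hY : LinearIndependent ℝ fun i => Y i z) :
    LinearIndependent ℝ fun i => fieldOfCoord e (Y i) (e.symm z) := by
  refine LinearIndependent.of_comp (coordDeriv e (e.symm z)).toLinearMap ?_
  have hcomp : ((coordDeriv e (e.symm z)).toLinearMap ∘ fun i => fieldOfCoord e (Y i) (e.symm z)) =
      fun i => Y i z :=
    funext fun i => coordField_fieldOfCoord he (Y i) hz
  rwa [hcomp]

lemma HasDegeneracy.exists_linearIndependent_horizField (hl : HasDegeneracy g p₀ l)
    (he : e ∈ IsManifold.maximalAtlas (𝓡 (m + 1)) ∞ M) (hp₀ : p₀ ∈ e.source)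
    {B : Set (Coord (m + 1))} (hB : B ∈ 𝓝 (e p₀)) {θ : Coord (m + 1) → Coord (m + 1) →L[ℝ] ℝ}
    (hY : ∀ η, ContinuousOn (horizField (coordMetric g e) θ η) B) :
    ∃ η : Fin (m - l) → Coord (m + 1) →L[ℝ] ℝ, ∀ᶠ z in 𝓝 (e p₀),
      LinearIndependent ℝ fun i => horizField (coordMetric g e) θ (η i) z := by
  have hk : m - l ≤ Module.finrank ℝ (coordMetric g e (e p₀)).range - 1 := by
    have hdim := hl.self_of_nhds
    have hle := finrank_horizontal_le he g (e.map_source hp₀)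
    rw [e.left_inv hp₀] at hle
    omega
  obtain ⟨η, hη⟩ := SubRiem.exists_linearIndependent_horizField (coordMetric g e) θ (e p₀) hk
  exact ⟨η, (continuousAt_pi.2 fun i => (hY (η i)).continuousAt hB).eventually hη.eventually⟩

variable [IsManifold (𝓡 (m + 1)) ∞ M]

lemma RankCondition.exists_le_lieRank_horizField (hrank : RankCondition g p₀ l)
    (hl : HasDegeneracy g p₀ l) (he : e ∈ IsManifold.maximalAtlas (𝓡 (m + 1)) ∞ M)
    (hp₀ : p₀ ∈ e.source) {B : Set (Coord (m + 1))} (hB : IsOpen B) (h0B : e p₀ ∈ B)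
    {θ : Coord (m + 1) → Coord (m + 1) →L[ℝ] ℝ}
    (hY : ∀ η, ContDiffOn ℝ ∞ (horizField (coordMetric g e) θ η) B) :
    ∃ (W : Set M) (X : Fin (m - l) → ∀ x : M, Tan m x) (η : Fin (m - l) → Coord (m + 1) →L[ℝ] ℝ),
      IsOpen W ∧ p₀ ∈ W ∧ e.target ∩ e.symm ⁻¹' W ⊆ B ∧ (∀ i, SmoothFieldOn (X i) W) ∧
      (∀ i, ∀ z ∈ e.target, coordField e (X i) z = horizField (coordMetric g e) θ (η i) z) ∧
      ∀ q ∈ W, m ≤ lieRank W X q := by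
  obtain ⟨O, hO, hpO, hrank⟩ := hrank
  obtain ⟨η, hη⟩ := hl.exists_linearIndependent_horizField he hp₀ (hB.mem_nhds h0B)
    fun η => (hY η).continuousOn
  obtain ⟨N, hNsub, hN, h0N⟩ := _root_.mem_nhds_iff.1 (inter_mem hη (hB.mem_nhds h0B))
  have hW : IsOpen ((e.source ∩ e ⁻¹' N) ∩ O) := (e.isOpen_inter_preimage hN).inter hO
  have hX (i) : SmoothFieldOn (fieldOfCoord e (horizField (coordMetric g e) θ (η i)))
      ((e.source ∩ e ⁻¹' N) ∩ O) :=
    smoothFieldOn_fieldOfCoord he hN ((hY (η i)).mono fun z hz => (hNsub hz).2)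
      (fun q hq => hq.1.1) fun q hq => hq.1.2
  refine ⟨_, _, η, hW, ⟨⟨hp₀, h0N⟩, hpO⟩, ?_, hX,
    fun i z hz => coordField_fieldOfCoord he _ hz,
    hrank _ inter_subset_right hW _ hX (fun i q hq => ?_) fun q hq => ?_⟩
  · rintro z ⟨hz, ⟨-, hzN⟩, -⟩
    rw [mem_preimage, e.right_inv hz] at hzN
    exact (hNsub hzN).2
  · rw [← e.left_inv hq.1.1]
    exact fieldOfCoord_mem_horizontal he (e.map_source hq.1.1) ⟨_, rfl⟩
  · rw [← e.left_inv hq.1.1]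
    exact linearIndependent_fieldOfCoord he (e.map_source hq.1.1) (hNsub hq.1.2).1

/-- An exterior normal of `F` is orthogonal to the brackets of the horizontal fields, which fill the
level sets of `φ`, and to the transversal direction `a`. -/
lemma RankCondition.mem_nhds_of_isTangentOn (hrank : RankCondition g p₀ l)
    (hl : HasDegeneracy g p₀ l) (he : e ∈ IsManifold.maximalAtlas (𝓡 (m + 1)) ∞ M)
    (hp₀ : p₀ ∈ e.source) {B F : Set (Coord (m + 1))} (hB : IsOpen B) (hBe : B ⊆ e.target)
    (h0B : e p₀ ∈ B) (hF : IsClosed F) (h0F : e p₀ ∈ F) {φ : Coord (m + 1) → ℝ}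
    (hφ : ContDiffOn ℝ ∞ φ B)
    (hpos : ∀ z ∈ B, 0 < fderiv ℝ φ z (coordMetric g e z (fderiv ℝ φ z)))
    (htan : ∀ η, IsTangentOn F B (horizField (coordMetric g e) (fderiv ℝ φ) η))
    {a : Coord (m + 1)} (ha : ∀ z ∈ B, fderiv ℝ φ z a ≠ 0) (hta : IsTangentOn F B fun _ => a) :
    F ∈ 𝓝 (e p₀) := by
  have hY (η : Coord (m + 1) →L[ℝ] ℝ) :
      ContDiffOn ℝ ∞ (horizField (coordMetric g e) (fderiv ℝ φ) η) B :=
    contDiffOn_horizField ((contDiffOn_coordMetric he g).mono hBe)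
      (hφ.fderiv_of_isOpen hB (by simp)) (fun z hz => (hpos z hz).ne') η
  obtain ⟨W, X, η, hW, hpW, hWB, hX, hXη, hlie⟩ :=
    hrank.exists_le_lieRank_horizField hl he hp₀ hB h0B hY
  have h0W : e.target ∩ e.symm ⁻¹' W ∈ 𝓝 (e p₀) :=
    (e.isOpen_inter_preimage_symm hW).mem_nhds
      ⟨e.map_source hp₀, by rwa [mem_preimage, e.left_inv hp₀]⟩
  refine mem_nhds_of_isExteriorNormal_eq_zero hF h0F h0W fun y hy ν hν => ?_
  obtain ⟨hyF, hyt, hyW⟩ := hy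
  have hyB : y ∈ B := hWB ⟨hyt, hyW⟩
  refine hν.eq_zero_of_le_lieRank he hW hX hF ((hφ.mono hWB).of_le
    (WithTop.coe_le_coe.2 le_top)) (fun i z hz => ?_) (fun i z hz => ?_) hyF hyt hyW
    (hlie _ hyW) (ha y hyB) (hta y ⟨hyF, hyB⟩ ν hν)
  · rw [hXη i z hz.2.1]
    exact htan (η i) z ⟨hz.1, hWB hz.2⟩
  · rw [hXη i z hz.1]
    exact apply_horizField (coordMetric_symm he g hz.1) (hpos z (hWB hz)).ne' (η i)

end Propagation

section Comparison

variable {m l : ℕ} {M : Type*} [TopologicalSpace M] [ChartedSpace (Coord (m + 1)) M]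
  [IsManifold (𝓡 (m + 1)) ∞ M] {e : OpenPartialHomeomorph M (Coord (m + 1))} {g : CoMetric m M}
  {dv : VolumeForm m M} {p₀ : M}

/-- Bony's strong maximum principle: the zero set of `w` is tangent to the horizontal fields by the
differential inequality and to `a` by invariance. -/
lemma RankCondition.eventually_eq_zero_of_traceComp_le (hrank : RankCondition g p₀ l)
    (hl : HasDegeneracy g p₀ l) (he : e ∈ IsManifold.maximalAtlas (𝓡 (m + 1)) ∞ M)
    (hp₀ : p₀ ∈ e.source) {φ w : Coord (m + 1) → ℝ} {a : Coord (m + 1)} {p C : ℝ} (hp : 0 ≤ p)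
    (hφ : ∀ᶠ z in 𝓝 (e p₀), ContDiffAt ℝ ∞ φ z)
    (hpos : ∀ᶠ z in 𝓝 (e p₀), 0 < fderiv ℝ φ z (coordMetric g e z (fderiv ℝ φ z)))
    (hφa : ∀ᶠ z in 𝓝 (e p₀), fderiv ℝ φ z a ≠ 0) (hw : ∀ᶠ z in 𝓝 (e p₀), ContDiffAt ℝ 2 w z)
    (hw0 : ∀ᶠ z in 𝓝 (e p₀), 0 ≤ w z) (hwp : w (e p₀) = 0) (hwa : ∀ z (t : ℝ), w (z + t • a) = w z)
    (hle : ∀ᶠ z in 𝓝 (e p₀), traceComp (weightedDivSymbol (coordDensity dv e)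
      (flux (coordDensity dv e) (coordMetric g e) p) (z, fderiv ℝ φ z)) (fderiv ℝ (fderiv ℝ w) z) ≤
        C * ‖fderiv ℝ w z‖) :
    ∀ᶠ z in 𝓝 (e p₀), w z = 0 := by
  have htarget : ∀ᶠ z in 𝓝 (e p₀), z ∈ e.target := e.open_target.mem_nhds (e.map_source hp₀)
  obtain ⟨ρ, hρ, hball⟩ := nhds_basis_closedBall.eventually_iff.1 <|
    htarget.and <| hφ.and <| hpos.and <| hφa.and <| hw.and <| hw0.and hle
  simp only [imp_and, forall_and] at hball
  obtain ⟨htarget, hφ, hpos, hφa, hw, hw0, hle⟩ := hball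
  have hsub : ball (e p₀) ρ ⊆ closedBall (e p₀) ρ := ball_subset_closedBall
  have hBe : ball (e p₀) ρ ⊆ e.target := fun z hz => htarget _ (hsub hz)
  have hA := (contDiffOn_coordDensity he dv).mono hBe
  have hG := (contDiffOn_coordMetric he g).mono hBe
  have hφB : ContDiffOn ℝ ∞ φ (ball (e p₀) ρ) := fun z hz => (hφ _ (hsub hz)).contDiffWithinAt
  have hwB : ContDiffOn ℝ 2 w (ball (e p₀) ρ) := fun z hz => (hw _ (hsub hz)).contDiffWithinAt
  have hF : ∀ z ∈ ball (e p₀) ρ, w z = 0 ↔ z ∈ closedBall (e p₀) ρ ∩ w ⁻¹' {0} :=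
    fun z hz => (and_iff_right (hsub hz)).symm
  have hFclosed : IsClosed (closedBall (e p₀) ρ ∩ w ⁻¹' {0}) :=
    ContinuousOn.preimage_isClosed_of_isClosed
      (fun z hz => (hw z hz).continuousAt.continuousWithinAt) isClosed_closedBall isClosed_singleton
  refine mem_of_superset (hrank.mem_nhds_of_isTangentOn hl he hp₀ isOpen_ball hBe
    (mem_ball_self hρ) hFclosed ⟨mem_closedBall_self hρ.le, hwp⟩ hφB
    (fun z hz => hpos _ (hsub hz)) (fun η => ?_) (fun z hz => hφa _ (hsub hz))
    (isTangentOn_const_of_eventually_add_smul_mem ?_)) inter_subset_right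
  · exact isTangentOn_horizField hp isOpen_ball (hA.of_le (WithTop.coe_le_coe.2 le_top))
      (fun z hz => coordDensity_ne_zero he dv (hBe hz)) (hG.of_le (WithTop.coe_le_coe.2 le_top))
      (fun z hz => coordMetric_symm he g (hBe hz)) (fun z hz => coordMetric_nonneg he g (hBe hz))
      (hφB.of_le (WithTop.coe_le_coe.2 le_top)) (fun z hz => hpos _ (hsub hz)) hwB
      (fun z hz => hw0 _ (hsub hz)) (fun z hz => hle _ (hsub hz)) hF η
  · rintro y ⟨hyF, hyB⟩
    have hline : ContinuousAt (fun t : ℝ => y + t • a) 0 := by fun_prop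
    filter_upwards [hline.eventually (isOpen_ball.mem_nhds (by simpa using hyB))] with t ht
    exact ⟨hsub ht, (hwa y t).trans hyF.2⟩

variable {U : Set M} {δ : ℝ} {Ψ : ℝ → M → M} {S : Set M} {u v : Coord m → ℝ}

lemma IsTranslationIsometricCoords.eventually_proj_mem_baseDomain
    (he : IsTranslationIsometricCoords dv p₀ U δ Ψ S e) :
    ∀ᶠ z in 𝓝 (0 : Coord (m + 1)), proj z ∈ baseDomain e :=
  contDiff_proj.continuous.continuousAt.eventually
    ((isOpen_baseDomain e).mem_nhds he.proj_zero_mem_baseDomain)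

lemma fderiv_coordGraphFn_eq_of_le (he : IsTranslationIsometricCoords dv p₀ U δ Ψ S e)
    (hu : IsGraph e u) (hv : IsGraph e v) (hle : ∀ x ∈ baseDomain e, u x ≤ v x)
    (h0 : v 0 = u 0) : fderiv ℝ (coordGraphFn v) 0 = fderiv ℝ (coordGraphFn u) 0 := by
  refine fderiv_eq_of_isLocalMin_sub ?_
    ((hv.contDiffAt_coordGraphFn he.proj_zero_mem_baseDomain).differentiableAt (by simp))
    ((hu.contDiffAt_coordGraphFn he.proj_zero_mem_baseDomain).differentiableAt (by simp))
  filter_upwards [he.eventually_proj_mem_baseDomain] with z hz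
  rw [coordGraphFn_sub, coordGraphFn_sub, proj_zero, h0, sub_self]
  exact sub_nonneg.2 (hle _ hz)

/-- Both defining functions have the same differential at the origin, so the difference of the
curvatures linearizes to a degenerate elliptic operator with a bounded first-order term. -/
lemma exists_traceComp_coordGraphFn_sub_le (hΨ : IsIsometricTranslations g dv p₀ U δ Ψ)
    (he : IsTranslationIsometricCoords dv p₀ U δ Ψ S e) (hu : IsGraph e u) (hv : IsGraph e v)
    (hu' : IsNonsingularGraph g e u) (hv' : IsNonsingularGraph g e v)
    (hle : ∀ x ∈ baseDomain e, u x ≤ v x) (hu0 : u 0 = 0) (hv0 : v 0 = 0) {p : ℝ}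
    (hH : ∀ x ∈ baseDomain e, graphCurv g dv e p v x ≤ graphCurv g dv e p u x) :
    ∃ C, ∀ᶠ z in 𝓝 (0 : Coord (m + 1)), traceComp (weightedDivSymbol (coordDensity dv e)
      (flux (coordDensity dv e) (coordMetric g e) p) (z, fderiv ℝ (coordGraphFn v) z))
      (fderiv ℝ (fderiv ℝ (coordGraphFn v - coordGraphFn u)) z) ≤
        C * ‖fderiv ℝ (coordGraphFn v - coordGraphFn u) z‖ := by
  have hucurv := eventually_graphCurv_proj hΨ he hu hu' hu0 p
  have hvcurv := eventually_graphCurv_proj hΨ he hv hv' hv0 p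
  have htarget := e.open_target.mem_nhds he.zero_mem_target
  have h0b := he.proj_zero_mem_baseDomain
  have hA : ContDiffAt ℝ ∞ (coordDensity dv e) 0 :=
    (contDiffOn_coordDensity he.mem_atlas dv).contDiffAt htarget
  have hG : ContDiffAt ℝ ∞ (coordMetric g e) 0 :=
    (contDiffOn_coordMetric he.mem_atlas g).contDiffAt htarget
  refine exists_traceComp_sub_le_of_weightedDiv_le
    ((hv.contDiffAt_coordGraphFn h0b).of_le (WithTop.coe_le_coe.2 le_top))
    ((hu.contDiffAt_coordGraphFn h0b).of_le (WithTop.coe_le_coe.2 le_top))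
    (fderiv_coordGraphFn_eq_of_le he hu hv hle (hv0.trans hu0.symm))
    ((contDiffAt_flux hA hG hucurv.self_of_nhds.1).of_le (WithTop.coe_le_coe.2 le_top))
    (hA.of_le (WithTop.coe_le_coe.2 le_top))
    (coordDensity_ne_zero he.mem_atlas dv he.zero_mem_target) ?_
  filter_upwards [hucurv, hvcurv, he.eventually_proj_mem_baseDomain] with z huz hvz hz
  rw [← huz.2, ← hvz.2]
  exact hH _ hz

end Comparison

end SubRiem

open SubRiem in
theorem mainTheorem2 {m l : ℕ} {M : Type*} [TopologicalSpace M] [T2Space M]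
    [ChartedSpace (Coord (m + 1)) M] [IsManifold (𝓡 (m + 1)) ∞ M]
    (g : CoMetric m M) (dv : VolumeForm m M) (p₀ : M)
    (hl : HasDegeneracy g p₀ l)
    (U : Set M) (δ : ℝ) (Ψ : ℝ → M → M) (hΨ : IsIsometricTranslations g dv p₀ U δ Ψ)
    (S : Set M) (hS : IsHypersurface m S) (hpS : p₀ ∈ S) (htrans : IsTransversal m Ψ S U)
    (e : OpenPartialHomeomorph M (Coord (m + 1)))
    (he : IsTranslationIsometricCoords dv p₀ U δ Ψ S e)
    (u v : Coord m → ℝ) (hu : IsGraph e u) (hv : IsGraph e v)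
    (hu' : IsNonsingularGraph g e u) (hv' : IsNonsingularGraph g e v)
    (hle : ∀ x ∈ baseDomain e, u x ≤ v x) (hu0 : u 0 = 0) (hv0 : v 0 = 0)
    (p : ℝ) (hp : 0 ≤ p)
    (hH : ∀ x ∈ baseDomain e, graphCurv g dv e p v x ≤ graphCurv g dv e p u x)
    (hrank : RankCondition g p₀ l) :
    ∀ᶠ x in 𝓝 (0 : Coord m), v x = u x := by
  have hb := he.eventually_proj_mem_baseDomain
  have h0 : v 0 - u 0 = 0 := by rw [hu0, hv0, sub_zero]
  obtain ⟨C, hC⟩ := exists_traceComp_coordGraphFn_sub_le hΨ he hu hv hu' hv' hle hu0 hv0 hH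
  have hw : ∀ᶠ z in 𝓝 (0 : Coord (m + 1)), (coordGraphFn v - coordGraphFn u) z = 0 := by
    rw [← he.origin] at hb hC ⊢
    refine hrank.eventually_eq_zero_of_traceComp_le hl he.mem_atlas he.mem (a := lastVec m) hp
      ?_ ?_ ?_ ?_ ?_ ?_ ?_ hC
    · exact hb.mono fun z hz => hv.contDiffAt_coordGraphFn hz
    · exact he.origin ▸ (eventually_graphCurv_proj hΨ he hv hv' hv0 p).mono fun z hz => hz.1
    · filter_upwards [hb] with z hz
      rw [fderiv_coordGraphFn_lastVec ((hv.contDiffAt_coordGraphFn hz).differentiableAt (by simp))]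
      exact neg_ne_zero.2 one_ne_zero
    · exact hb.mono fun z hz => ((hv.contDiffAt_coordGraphFn hz).sub
        (hu.contDiffAt_coordGraphFn hz)).of_le (WithTop.coe_le_coe.2 le_top)
    · exact hb.mono fun z hz => (coordGraphFn_sub v u z).symm ▸ sub_nonneg.2 (hle _ hz)
    · rw [he.origin, coordGraphFn_sub, proj_zero, h0]
    · intro z t
      rw [coordGraphFn_sub, coordGraphFn_sub, proj_add_smul_lastVec]
  rw [← append_zero_zero] at hw
  filter_upwards [continuous_append_zero.continuousAt.eventually hw] with x hx
  rwa [coordGraphFn_sub, proj_append, sub_eq_zero] at hx
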